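/- For $n\ge 1$ let $v\in\mathbb R^n$ be a unit vector, let $A\in\mathbb R^{n\times n\times n}$ have i.i.d. standard Gaussian entries, and put $\tau=n^{3/4}\log n$, $T=\tau v^{\otimes 3}+A$, $f_r(x)=T(x,x,x)-\frac{3\tau}{4}\|x\|^4$. For $t\ge 0$ let $g_r(x,t)=\mathbb E_{y\sim N(0,I_n)}f_r(x+ty)$ be the Gaussian smoothing of $f_r$. Write $u_j=\sum_i(A_{iij}+A_{iji}+A_{jii})$, $\delta(x)=A(x,x,:)+A(x,:,x)+A(:,x,x)$, and $x^\dag=\frac{3\tau v+u}{3\tau(n+2)}$ (the limit as $t\to\infty$ of the maximizer of $g_r(\cdot,t)$). A homotopy path is a continuous $x:[t_0,\infty)\to\mathbb R^n$, $t_0\ge 0$, with $\nabla g_r(x(t),t)=0$ for all $t\ge t_0$ and $x(t)\to x^\dag$ as $t\to\infty$. Fix $K$, $\gamma>\gamma'>0$ and a sequence $\kappa_n$ with $\kappa_n\le n^{1/4}$ for all large $n$ (for instance $\kappa_n=\sqrt{\log n}$). Say that the noise is regular at $x$ if $$K^{-1}\sqrt n\,\|x\|^2\le\|\delta(x)\|\le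 K\sqrt n\,\|x\|^2\quad\text{and}\quad|\langle\delta(x),v\rangle|\le K\kappa_n\|x\|^2.$$ Assume the Strong Independence Conjecture with these parameters: for all large $n$ and all unit vectors $v$, with probability at least $1-n^{-\gamma}$, one has $K^{-1}n\le\|u\|\le Kn$, $|\langle u,v\rangle|\le K\sqrt{n\log n}$, and the noise is regular at every point of every homotopy path. Then there are constants $C,M>0$ and a sequence $\varepsilon_n\to 0$ such that for all large $n$ and all unit vectors $v$, with probability at least $1-n^{-\gamma'}$, the following hold simultaneously. (1) For every $t\ge C/n$ there is a local maximizer $x$ of $g_r(\cdot,t)$ with $\|x-x^\dag\|\le\varepsilon_n\|x^\dag\|$. (2) For every $0\le t<n^{-1}\log^{-2}n$, every local maximizer $x$ of $g_r(\cdot,t)$ is either good, i.e. $M^{-1}\le\|x\|\le M$ and $M^{-1}\le\langle v,x\rangle\le M$, or bad, i.e. $M^{-1}n^{-1/4}\log^{-1}n\le\|x\|\le M n^{-1/4}\log^{-1}n$ and $\langle v,x\rangle\le M n^{-1/2}\log^{-1}n$; in the bad case moreover $|\langle v,x\rangle|\le M n^{-1/2}\log^{-1}n$ whenever the noise is regular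 at $x$. (3) For every $0\le t<n^{-1}\log^{-2}n$, every eigenvector $b$ for the largest eigenvalue of the Hessian $\nabla^2 g_r(x^\dag,t)$ satisfies $\sin\theta(b,v)\le 1/\log^2 n$, where $\theta(b,v)$ is the angle between $b$ and $v$. -/

import Mathlib

open Filter Topology MeasureTheory ProbabilityTheory

noncomputable section

namespace TensorPCA

/-- `ℝⁿ` with the Euclidean norm. -/
abbrev Vec (n : ℕ) : Type := EuclideanSpace ℝ (Fin n)

/-- Third order `n × n × n` tensors, as arrays of `n³` real entries. -/
abbrev Tensor (n : ℕ) : Type := Fin n × Fin n × Fin n → ℝ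

/-- The law of the noise tensor: i.i.d. standard Gaussian entries. -/
def noiseMeasure (n : ℕ) : Measure (Tensor n) :=
  Measure.pi fun _ => gaussianReal 0 1

/-- The trilinear form `A(x, y, z) = ∑ A_{ijk} x_i y_j z_k`. -/
def trilin {n : ℕ} (A : Tensor n) (x y z : Vec n) : ℝ :=
  ∑ i, ∑ j, ∑ k, A (i, j, k) * x i * y j * z k

/-- `δ(x) = A(x, x, :) + A(x, :, x) + A(:, x, x)`. -/
def delta {n : ℕ} (A : Tensor n) (x : Vec n) : Vec n :=
  WithLp.toLp 2 fun k => ∑ i, ∑ j, (A (i, j, k) + A (i, k, j) + A (k, i, j)) * x i * x j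

/-- The vector `u` with `u_j = ∑ i, (A_{iij} + A_{iji} + A_{jii})`. -/
def traceVec {n : ℕ} (A : Tensor n) : Vec n :=
  WithLp.toLp 2 fun j => ∑ i, (A (i, i, j) + A (i, j, i) + A (j, i, i))

/-- The signal strength `τ = n^{3/4} log n`. -/
def tau (n : ℕ) : ℝ := (n : ℝ) ^ (3 / 4 : ℝ) * Real.log n

/-- The input tensor `T = τ v^{⊗3} + A`. -/
def inputTensor {n : ℕ} (v : Vec n) (A : Tensor n) : Tensor n :=
  fun p => tau n * (v p.1 * v p.2.1 * v p.2.2) + A p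

/-- The penalized objective `f_r(x) = T(x, x, x) - (3τ/4) ‖x‖⁴`. -/
def fr {n : ℕ} (v : Vec n) (A : Tensor n) (x : Vec n) : ℝ :=
  trilin (inputTensor v A) x x x - 3 * tau n / 4 * ‖x‖ ^ 4

/-- The smoothed objective `g_r(x, t)`: the convolution of `f_r` with the law `N(0, t² I)`, that is
`g_r(x, t) = E f_r(x + t y)` with `y` standard Gaussian in `ℝⁿ` (so `g_r(x, 0) = f_r(x)`). -/
def gr {n : ℕ} (v : Vec n) (A : Tensor n) (t : ℝ) (x : Vec n) : ℝ :=
  ∫ y, fr v A (x + t • y) ∂(stdGaussian (Vec n))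

/-- The maximizer at infinite smoothing, `x† = (3τ v + u) / (3τ (n + 2))`. -/
def xDagger {n : ℕ} (v : Vec n) (A : Tensor n) : Vec n :=
  (3 * tau n * ((n : ℝ) + 2))⁻¹ • ((3 * tau n) • v + traceVec A)

/-- `x` is a homotopy path on `[t₀, ∞)`: a continuous path of stationary points of `g_r(·, t)`
that tends to `x†` as `t → ∞`. -/
def IsHomotopyPath {n : ℕ} (v : Vec n) (A : Tensor n) (t₀ : ℝ) (x : ℝ → Vec n) : Prop :=
  0 ≤ t₀ ∧ ContinuousOn x (Set.Ici t₀) ∧ Tendsto x atTop (𝓝 (xDagger v A)) ∧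
    ∀ t, t₀ ≤ t → gradient (gr v A t) (x t) = 0

/-- The noise looks independent of the point `x`:
`‖δ(x)‖ = Θ(√n) ‖x‖²` and `|⟨δ(x), v⟩| = O(κ) ‖x‖²`, with implied constant `K`. -/
def NoiseRegularAt {n : ℕ} (K κ : ℝ) (v : Vec n) (A : Tensor n) (x : Vec n) : Prop :=
  √n * ‖x‖ ^ 2 ≤ K * ‖delta A x‖ ∧ ‖delta A x‖ ≤ K * √n * ‖x‖ ^ 2 ∧
    |inner ℝ (delta A x) v| ≤ K * κ * ‖x‖ ^ 2

/-- `‖u‖ = Θ(n)` and `|⟨u, v⟩| = O(√(n log n))`, with implied constant `K`. -/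
def TraceRegular {n : ℕ} (K : ℝ) (v : Vec n) (A : Tensor n) : Prop :=
  (n : ℝ) ≤ K * ‖traceVec A‖ ∧ ‖traceVec A‖ ≤ K * n ∧
    |inner ℝ (traceVec A) v| ≤ K * √(n * Real.log n)

/-- The strong independence conjecture, with implied constant `K`, failure probability at most
`n^{-γ}`, and correlation level `κ n` (the usual level is `κ n = √(log n)`): for all large `n` and
every unit vector `v`, with high probability `u` is regular and the noise is regular at every point
of every homotopy path. -/
def StrongIndependenceConjecture (K γ : ℝ) (κ : ℕ → ℝ) : Prop :=
  ∀ᶠ n : ℕ in atTop, ∀ v : Vec n, ‖v‖ = 1 →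
    noiseMeasure n {A | ¬ (TraceRegular K v A ∧
      ∀ t₀ x, IsHomotopyPath v A t₀ x → ∀ t, t₀ ≤ t → NoiseRegularAt K (κ n) v A (x t))}
      ≤ ENNReal.ofReal ((n : ℝ) ^ (-γ))

/-- Good local maximizers: `‖x‖ = Θ(1)` and `⟨v, x⟩ = Θ(1)`, with implied constant `M`. -/
def IsGood {n : ℕ} (M : ℝ) (v x : Vec n) : Prop :=
  1 / M ≤ ‖x‖ ∧ ‖x‖ ≤ M ∧ 1 / M ≤ inner ℝ v x ∧ inner ℝ v x ≤ M

/-- Norm of the bad local maximizers: `‖x‖ = Θ(n^{-1/4} log^{-1} n)`, with implied constant `M`. -/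
def HasBadNorm {n : ℕ} (M : ℝ) (x : Vec n) : Prop :=
  1 / M * ((n : ℝ) ^ (-(1 / 4) : ℝ) / Real.log n) ≤ ‖x‖ ∧
    ‖x‖ ≤ M * ((n : ℝ) ^ (-(1 / 4) : ℝ) / Real.log n)

/-- The bound `M n^{-1/2} log^{-1} n` on the correlation of bad local maximizers with `v`. -/
def badCorr (n : ℕ) (M : ℝ) : ℝ := M * ((n : ℝ) ^ (-(1 / 2) : ℝ) / Real.log n)

/-- The Hessian of `F` at `x`, as a linear operator. -/
def hessian {n : ℕ} (F : Vec n → ℝ) (x : Vec n) : Vec n →ₗ[ℝ] Vec n :=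
  (fderiv ℝ (gradient F) x : Vec n →L[ℝ] Vec n)

/-- `b` is a top eigenvector of `L`: an eigenvector for the largest eigenvalue. -/
def IsTopEigenvector {n : ℕ} (L : Vec n →ₗ[ℝ] Vec n) (b : Vec n) : Prop :=
  ∃ μ : ℝ, Module.End.HasEigenvector L μ b ∧ ∀ μ' : ℝ, Module.End.HasEigenvalue L μ' → μ' ≤ μ

end TensorPCA

end

/-! Write `q = n^{1/4}`, `l = log n`, so that `τ = q³ l`, and `s = (n + 2) t²`. Smoothing a quartic
polynomial adds, up to a constant, only `t²` times the trace of its quadratic part. Hence `g_r(x,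
t)` is `f_r(x) + t² ⟨3τ v + u, x⟩ - (3τ/2) s ‖x‖²` plus a constant (`gr_eq`), and the landscape is
analysed deterministically under the bounds collected in `NoiseBounds`.

Small smoothing (`NoiseBounds.good_or_bad`). Orthogonally to `v` the signal drops out of the
stationarity equation, and penalty against noise gives `‖x⊥‖ = O(1/(q l))`. At a local maximizer the
Hessian is negative semidefinite; since the matrix `contr A x` has operator norm `O(√n ‖x‖)` but
Frobenius norm of order at least `n ‖x‖`, its positive part is substantial, which forces the penalty
`τ (‖x‖² + s)` to be at least of order `√n ‖x‖`. So `x` is either of norm at least order `1/(q l)`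
or so short that nothing balances the drift `t² u`; the second case is impossible. Along `v`,
stationarity is a perturbation of `a² = (a² + p² + s) a` with `a = ⟨v, x⟩` and `p = ‖x⊥‖`, whose
solutions have `a` of order one or `a` close to `0`. The Hessian along `v` bounds the small
solutions from above, and regular noise bounds them on both sides.

Top eigenvector (`NoiseBounds.sin_angle_le`). At `x†` the signal contributes about `6τ/n` to the
Hessian along `v`. The noise matrix is smaller by a factor of order `l²`, and a spectral gap
argument yields the angle. The exact bound `1/l²` requires a sharp constant for `contr A v u`.

Large smoothing (`NoiseBounds.exists_isLocalMax`). For `t ≥ 4/n` the Hessian is negative definite on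
a small box around `x†`, so the maximizer over the box is unique, continuous in `t` and tends to
`x†`. If it ever met the boundary, then from the last such time on it would be a homotopy path; the
conjecture then makes the noise regular there, and the stationarity equation puts the point strictly
inside, a contradiction (`maximizer_mem_interior`).

Probability. The operator bound is a net argument with Gaussian tails; the Frobenius bound combines
a net with a small ball estimate whose exponent is quadratic in `n` (`stdGaussian_contr_bad_le`).
For `contr A v u`, the vector `u` is independent of the traceless part of `A`, so its direction may
be frozen (`lintegral_exp_tracelessContr_le`). These events fail with exponentially small
probability, which fits between `n^{-γ}` and `n^{-γ'}`. -/

noncomputable section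

namespace TensorPCA

/-! ### The symmetrized noise tensor and its contractions -/

section

variable {n : ℕ}

/-- The sum of the entries of `A` over the six orderings of the indices. -/
def symEntry (A : Tensor n) (i j k : Fin n) : ℝ :=
  A (i, j, k) + A (i, k, j) + A (j, i, k) + A (j, k, i) + A (k, i, j) + A (k, j, i)

/-- The contraction of the symmetrized tensor with two vectors. -/
def contr (A : Tensor n) : Vec n →ₗ[ℝ] Vec n →ₗ[ℝ] Vec n :=
  LinearMap.mk₂ ℝ (fun x y => WithLp.toLp 2 fun k => ∑ i, ∑ j, symEntry A i j k * x i * y j)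
    (by intro x x' y; ext k; simp [← Finset.sum_add_distrib, add_mul, mul_add])
    (by intro c x y; ext k; simp [Finset.mul_sum, mul_assoc, mul_left_comm])
    (by intro x y y'; ext k; simp [← Finset.sum_add_distrib, mul_add])
    (by intro c x y; ext k; simp [Finset.mul_sum, mul_left_comm])

lemma contr_apply (A : Tensor n) (x y : Vec n) (k : Fin n) :
    contr A x y k = ∑ i, ∑ j, symEntry A i j k * x i * y j := rfl

lemma inner_contr (A : Tensor n) (x y z : Vec n) :
    inner ℝ (contr A x y) z = ∑ i, ∑ j, ∑ k, symEntry A i j k * x i * y j * z k := by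
  simp only [PiLp.inner_apply, contr_apply, RCLike.inner_apply, conj_trivial, Finset.mul_sum]
  rw [Finset.sum_comm]
  refine Finset.sum_congr rfl fun i _ => ?_
  rw [Finset.sum_comm]
  refine Finset.sum_congr rfl fun j _ => Finset.sum_congr rfl fun k _ => by ring

lemma contr_comm (A : Tensor n) (x y : Vec n) : contr A x y = contr A y x := by
  ext k
  rw [contr_apply, contr_apply, Finset.sum_comm]
  refine Finset.sum_congr rfl fun i _ => Finset.sum_congr rfl fun j _ => ?_
  simp only [symEntry]; ring

lemma inner_contr_right_comm (A : Tensor n) (x y z : Vec n) :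
    inner ℝ (contr A x y) z = inner ℝ (contr A x z) y := by
  rw [inner_contr, inner_contr]
  refine Finset.sum_congr rfl fun i _ => ?_
  rw [Finset.sum_comm]
  refine Finset.sum_congr rfl fun j _ => Finset.sum_congr rfl fun k _ => ?_
  simp only [symEntry]; ring

lemma inner_contr_swap (A : Tensor n) (x y z : Vec n) :
    inner ℝ (contr A x y) z = inner ℝ y (contr A x z) := by
  rw [inner_contr_right_comm, real_inner_comm]

/-- The symmetrized form as the sum of the trilinear form over the six orderings. -/
lemma inner_contr_eq_trilin (A : Tensor n) (x y z : Vec n) :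
    inner ℝ (contr A x y) z = trilin A x y z + trilin A x z y + trilin A y x z + trilin A y z x
      + trilin A z x y + trilin A z y x := by
  have h1 : trilin A x z y = ∑ i, ∑ j, ∑ k, A (i, k, j) * x i * y j * z k := by
    refine Finset.sum_congr rfl fun i _ => ?_
    rw [Finset.sum_comm]
    exact Finset.sum_congr rfl fun j _ => Finset.sum_congr rfl fun k _ => by ring
  have h2 : trilin A y x z = ∑ i, ∑ j, ∑ k, A (j, i, k) * x i * y j * z k := by
    rw [trilin, Finset.sum_comm]
    exact Finset.sum_congr rfl fun i _ => Finset.sum_congr rfl fun j _ =>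
      Finset.sum_congr rfl fun k _ => by ring
  have h3 : trilin A y z x = ∑ i, ∑ j, ∑ k, A (j, k, i) * x i * y j * z k := by
    rw [trilin]
    simp_rw [Finset.sum_comm (s := Finset.univ) (t := Finset.univ) (f := fun j k => A (_, j, k) * _ * _ * _)]
    rw [Finset.sum_comm]
    exact Finset.sum_congr rfl fun i _ => Finset.sum_congr rfl fun j _ =>
      Finset.sum_congr rfl fun k _ => by ring
  have h4 : trilin A z x y = ∑ i, ∑ j, ∑ k, A (k, i, j) * x i * y j * z k := by
    rw [trilin, Finset.sum_comm]
    refine Finset.sum_congr rfl fun i _ => ?_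
    rw [Finset.sum_comm]
    exact Finset.sum_congr rfl fun j _ => Finset.sum_congr rfl fun k _ => by ring
  have h5 : trilin A z y x = ∑ i, ∑ j, ∑ k, A (k, j, i) * x i * y j * z k := by
    have : trilin A z y x = ∑ i, ∑ k, ∑ j, A (k, j, i) * x i * y j * z k := by
      rw [trilin, Finset.sum_comm]
      simp_rw [Finset.sum_comm (s := Finset.univ) (t := Finset.univ)
        (f := fun j k => A (j, _, k) * _ * _ * _)]
      rw [Finset.sum_comm]
      simp_rw [Finset.sum_comm (s := Finset.univ) (t := Finset.univ)
        (f := fun j k => A (k, j, _) * _ * _ * _)]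
      refine Finset.sum_congr rfl fun i _ => Finset.sum_congr rfl fun j _ =>
        Finset.sum_congr rfl fun k _ => by ring
    rw [this]
    exact Finset.sum_congr rfl fun i _ => Finset.sum_comm
  rw [inner_contr, h1, h2, h3, h4, h5, trilin]
  simp only [← Finset.sum_add_distrib]
  refine Finset.sum_congr rfl fun i _ => Finset.sum_congr rfl fun j _ =>
    Finset.sum_congr rfl fun k _ => ?_
  simp only [symEntry]; ring

lemma trilin_self (A : Tensor n) (x : Vec n) :
    trilin A x x x = inner ℝ (contr A x x) x / 6 := by
  rw [inner_contr_eq_trilin]; ring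

/-- The six orderings form three pairs exchanged by swapping the two contracted indices, and both of
these carry the same vector `x`. -/
lemma delta_eq (A : Tensor n) (x : Vec n) : delta A x = (1 / 2 : ℝ) • contr A x x := by
  have key : ∀ k, contr A x x k = 2 * delta A x k := by
    intro k
    have : contr A x x k = ∑ i, ∑ j, (A (i, j, k) + A (i, k, j) + A (k, i, j)) * x i * x j
        + ∑ i, ∑ j, (A (j, i, k) + A (j, k, i) + A (k, j, i)) * x i * x j := by
      rw [contr_apply]
      simp only [← Finset.sum_add_distrib]
      refine Finset.sum_congr rfl fun i _ => Finset.sum_congr rfl fun j _ => ?_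
      simp only [symEntry]; ring
    rw [this, Finset.sum_comm (f := fun i j => (A (j, i, k) + A (j, k, i) + A (k, j, i)) * x i * x j),
      two_mul]
    simp only [delta]
    congr 1
    refine Finset.sum_congr rfl fun i _ => Finset.sum_congr rfl fun j _ => by ring
  ext k
  simp [key]

/-- This trace is how `u` enters the problem: it is the Gaussian mean of the quadratic form `contr A
x`. Each placement of the repeated index occurs in two of the six orderings, hence the factor `2`.
-/
lemma sum_inner_contr_single (A : Tensor n) (x : Vec n) :
    ∑ i, inner ℝ (contr A x (EuclideanSpace.single i 1)) (EuclideanSpace.single i (1 : ℝ))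
      = 2 * inner ℝ (traceVec A) x := by
  have h : ∀ i, inner ℝ (contr A x (EuclideanSpace.single i 1)) (EuclideanSpace.single i (1 : ℝ))
      = ∑ j, symEntry A j i i * x j := by
    intro i
    rw [EuclideanSpace.inner_single_right, contr_apply]
    simp
  simp only [h]
  rw [Finset.sum_comm]
  simp only [traceVec, PiLp.inner_apply, RCLike.inner_apply, conj_trivial, Finset.mul_sum]
  refine Finset.sum_congr rfl fun i _ => Finset.sum_congr rfl fun j _ => ?_
  simp only [symEntry]; ring

end

/-! ### Closed form of the Gaussian smoothing -/

section

variable {n : ℕ}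

lemma inner_contr_add (A : Tensor n) (x y : Vec n) :
    inner ℝ (contr A (x + y) (x + y)) (x + y) = inner ℝ (contr A x x) x
      + 3 * inner ℝ (contr A x x) y + 3 * inner ℝ (contr A x y) y + inner ℝ (contr A y y) y := by
  simp only [map_add, LinearMap.add_apply, inner_add_left, inner_add_right]
  rw [contr_comm A y x, inner_contr_right_comm A x y x]
  have : inner ℝ (contr A y y) x = inner ℝ (contr A x y) y := by
    rw [inner_contr_right_comm, contr_comm]
  rw [this]; ring

lemma norm_add_pow_four (x y : Vec n) :
    ‖x + y‖ ^ 4 = (‖x‖ ^ 2 + 2 * inner ℝ x y + ‖y‖ ^ 2) ^ 2 := by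
  rw [← norm_add_sq_real]; ring

lemma trilin_inputTensor (v : Vec n) (A : Tensor n) (x : Vec n) :
    trilin (inputTensor v A) x x x = tau n * inner ℝ v x ^ 3 + inner ℝ (contr A x x) x / 6 := by
  rw [← trilin_self]
  have h : inner ℝ v x = ∑ i, v i * x i := by
    simp [PiLp.inner_apply, mul_comm]
  have h3 : inner ℝ v x ^ 3 = ∑ i, ∑ j, ∑ k, (v i * x i) * ((v j * x j) * (v k * x k)) := by
    simp only [← Finset.mul_sum, ← Finset.sum_mul, h]; ring
  rw [h3]
  simp only [trilin, inputTensor, Finset.mul_sum, ← Finset.sum_add_distrib]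
  refine Finset.sum_congr rfl fun i _ => Finset.sum_congr rfl fun j _ =>
    Finset.sum_congr rfl fun k _ => by ring

lemma fr_eq (v : Vec n) (A : Tensor n) (x : Vec n) :
    fr v A x = tau n * inner ℝ v x ^ 3 + inner ℝ (contr A x x) x / 6
      - 3 * tau n / 4 * ‖x‖ ^ 4 := by
  rw [fr, trilin_inputTensor]

lemma fr_add (v : Vec n) (A : Tensor n) (x y : Vec n) (t : ℝ) :
    fr v A (x + t • y) = fr v A x
      + t * (3 * tau n * inner ℝ v x ^ 2 * inner ℝ v y + inner ℝ (contr A x x) y / 2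
        - 3 * tau n * ‖x‖ ^ 2 * inner ℝ x y)
      + t ^ 2 * (3 * tau n * inner ℝ v x * inner ℝ v y ^ 2 + inner ℝ (contr A x y) y / 2
        - 3 * tau n / 4 * (2 * ‖x‖ ^ 2 * ‖y‖ ^ 2 + 4 * inner ℝ x y ^ 2))
      + t ^ 3 * (tau n * inner ℝ v y ^ 3 + inner ℝ (contr A y y) y / 6
        - 3 * tau n * inner ℝ x y * ‖y‖ ^ 2)
      + t ^ 4 * (- (3 * tau n / 4) * ‖y‖ ^ 4) := by
  rw [fr_eq, fr_eq, inner_contr_add, norm_add_pow_four]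
  simp only [map_smul, LinearMap.smul_apply, inner_smul_left, inner_smul_right, inner_add_right,
    norm_smul, conj_trivial, Real.norm_eq_abs, mul_pow, sq_abs]
  ring

lemma abs_trilin_le (A : Tensor n) (x : Vec n) :
    |trilin A x x x| ≤ (∑ i, ∑ j, ∑ k, |A (i, j, k)|) * ‖x‖ ^ 3 := by
  have hx : ∀ i, |x i| ≤ ‖x‖ := fun i => by simpa using PiLp.norm_apply_le x i
  simp only [trilin, Finset.sum_mul]
  refine (Finset.abs_sum_le_sum_abs _ _).trans (Finset.sum_le_sum fun i _ => ?_)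
  refine (Finset.abs_sum_le_sum_abs _ _).trans (Finset.sum_le_sum fun j _ => ?_)
  refine (Finset.abs_sum_le_sum_abs _ _).trans (Finset.sum_le_sum fun k _ => ?_)
  rw [abs_mul, abs_mul, abs_mul, pow_succ, pow_two, mul_assoc, mul_assoc, ← mul_assoc (|x i|)]
  have := hx i; have := hx j; have := hx k
  gcongr

lemma continuous_fr (v : Vec n) (A : Tensor n) : Continuous (fr v A) := by
  unfold fr trilin
  fun_prop

lemma integrable_norm_pow_stdGaussian (k : ℕ) :
    Integrable (fun y : Vec n => ‖y‖ ^ k) (stdGaussian (Vec n)) := by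
  rcases Nat.eq_zero_or_pos k with rfl | hk
  · simp
  · exact (IsGaussian.memLp_id (stdGaussian (Vec n)) (k : ENNReal)
      (ENNReal.natCast_ne_top k)).integrable_norm_pow hk.ne'

lemma integrable_fr (v : Vec n) (A : Tensor n) (t : ℝ) (x : Vec n) :
    Integrable (fun y => fr v A (x + t • y)) (stdGaussian (Vec n)) := by
  have hm : ∀ k : ℕ, k ≠ 0 → Integrable (fun y : Vec n => ‖x + t • y‖ ^ k) (stdGaussian (Vec n)) := by
    intro k hk
    have h1 : MemLp (fun y : Vec n => x + t • y) (k : ENNReal) (stdGaussian (Vec n)) :=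
      (memLp_const x).add ((IsGaussian.memLp_id (stdGaussian (Vec n)) (k : ENNReal)
        (ENNReal.natCast_ne_top k)).const_smul t)
    exact h1.integrable_norm_pow hk
  refine Integrable.mono' (((hm 3 (by norm_num)).const_mul
    (∑ i, ∑ j, ∑ k, |inputTensor v A (i, j, k)|)).add ((hm 4 (by norm_num)).const_mul
      |3 * tau n / 4|)) ?_ (Eventually.of_forall fun y => ?_)
  · exact ((continuous_fr v A).comp (by fun_prop)).aestronglyMeasurable
  · simp only [fr, Real.norm_eq_abs, Pi.add_apply]
    refine (abs_sub _ _).trans (add_le_add (abs_trilin_le _ _) ?_)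
    rw [abs_mul, abs_of_nonneg (by positivity : (0:ℝ) ≤ ‖x + t • y‖ ^ 4)]

lemma map_neg_stdGaussian :
    (stdGaussian (Vec n)).map (fun y => -y) = stdGaussian (Vec n) :=
  stdGaussian_map (LinearIsometryEquiv.neg ℝ (E := Vec n))

lemma integrable_coord_mul (i j : Fin n) :
    Integrable (fun y : Vec n => y i * y j) (stdGaussian (Vec n)) := by
  refine Integrable.mono' (integrable_norm_pow_stdGaussian 2) (by fun_prop)
    (Eventually.of_forall fun y => ?_)
  have hx : ∀ i, |y i| ≤ ‖y‖ := fun i => by simpa using PiLp.norm_apply_le y i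
  rw [Real.norm_eq_abs, abs_mul, pow_two]
  have := hx i; have := hx j
  gcongr

lemma integral_coord_mul (i j : Fin n) :
    ∫ y : Vec n, y i * y j ∂(stdGaussian (Vec n)) = if i = j then 1 else 0 := by
  have h := covarianceBilin_apply (μ := stdGaussian (Vec n))
    (IsGaussian.memLp_id _ 2 (by simp)) (EuclideanSpace.single i 1) (EuclideanSpace.single j 1)
  rw [covarianceBilin_stdGaussian] at h
  simp only [id, integral_id_stdGaussian, sub_zero, EuclideanSpace.inner_single_left] at h
  simp only [map_one, one_mul] at h
  rw [← h]
  change (inner ℝ (EuclideanSpace.single i (1 : ℝ)) (EuclideanSpace.single j (1 : ℝ)) : ℝ) = _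
  simp [EuclideanSpace.inner_single_left]

lemma inner_linearMap_self (L : Vec n →ₗ[ℝ] Vec n) (y : Vec n) :
    inner ℝ (L y) y = ∑ i, ∑ j, (y i * y j) *
      inner ℝ (L (EuclideanSpace.single i 1)) (EuclideanSpace.single j (1 : ℝ)) := by
  have hy : y = ∑ i, y i • EuclideanSpace.single i (1 : ℝ) := by
    simpa using ((EuclideanSpace.basisFun (Fin n) ℝ).sum_repr y).symm
  conv_lhs => rw [hy]
  simp only [map_sum, map_smul, sum_inner, inner_sum, inner_smul_left, inner_smul_right,
    conj_trivial, Finset.mul_sum]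
  rw [Finset.sum_comm]
  exact Finset.sum_congr rfl fun i _ => Finset.sum_congr rfl fun j _ => by ring

lemma integrable_inner_linearMap_self (L : Vec n →ₗ[ℝ] Vec n) :
    Integrable (fun y : Vec n => (inner ℝ (L y) y : ℝ)) (stdGaussian (Vec n)) := by
  simp only [inner_linearMap_self L]
  exact integrable_finsetSum _ fun i _ => integrable_finsetSum _ fun j _ =>
    (integrable_coord_mul i j).mul_const _

lemma integral_inner_linearMap_self (L : Vec n →ₗ[ℝ] Vec n) :
    ∫ y : Vec n, (inner ℝ (L y) y : ℝ) ∂(stdGaussian (Vec n)) =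
      ∑ i, inner ℝ (L (EuclideanSpace.single i 1)) (EuclideanSpace.single i (1 : ℝ)) := by
  simp only [inner_linearMap_self L]
  rw [integral_finsetSum _ fun i _ => integrable_finsetSum _ fun j _ =>
    (integrable_coord_mul i j).mul_const _]
  refine Finset.sum_congr rfl fun i _ => ?_
  rw [integral_finsetSum _ fun j _ => (integrable_coord_mul i j).mul_const _]
  simp [integral_mul_const, integral_coord_mul]

lemma sum_inner_single_mul (p : Vec n) :
    ∑ i, inner ℝ p (EuclideanSpace.single i (1 : ℝ)) ^ 2 = ‖p‖ ^ 2 := by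
  simp [EuclideanSpace.real_norm_sq_eq, EuclideanSpace.inner_single_right]

/-- The terms of `g_r(x, t)` that depend on `x`. -/
def smoothed (v : Vec n) (A : Tensor n) (t : ℝ) (x : Vec n) : ℝ :=
  tau n * inner ℝ v x ^ 3 + inner ℝ (contr A x x) x / 6
    + t ^ 2 * inner ℝ ((3 * tau n) • v + traceVec A) x
    - 3 * tau n / 4 * (‖x‖ ^ 4 + (2 * n + 4) * t ^ 2 * ‖x‖ ^ 2)

/-- Averaging over `y` and `-y` removes the odd powers of `t` from `fr_add`. The coefficient of `t ^
2` is a quadratic form in `y`, whose mean is its trace, and the coefficient of `t ^ 4` does not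
involve `x`; its integral is left unevaluated because only derivatives in `x` and comparisons at
fixed `t` matter. -/
lemma gr_eq {v : Vec n} (hv : ‖v‖ = 1) (A : Tensor n) (t : ℝ) (x : Vec n) :
    gr v A t x = smoothed v A t x
      + t ^ 4 * ∫ y : Vec n, -(3 * tau n / 4) * ‖y‖ ^ 4 ∂(stdGaussian (Vec n)) := by
  set Q : Vec n →ₗ[ℝ] Vec n :=
    (3 * tau n * inner ℝ v x) • ((innerSL ℝ v : Vec n →L[ℝ] ℝ) : Vec n →ₗ[ℝ] ℝ).smulRight v
      + (1 / 2 : ℝ) • contr A x - (3 * tau n / 2 * ‖x‖ ^ 2) • LinearMap.id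
      - (3 * tau n) • ((innerSL ℝ x : Vec n →L[ℝ] ℝ) : Vec n →ₗ[ℝ] ℝ).smulRight x with hQ
  have hQy : ∀ y : Vec n, inner ℝ (Q y) y = 3 * tau n * inner ℝ v x * inner ℝ v y ^ 2
      + inner ℝ (contr A x y) y / 2
      - 3 * tau n / 4 * (2 * ‖x‖ ^ 2 * ‖y‖ ^ 2 + 4 * inner ℝ x y ^ 2) := by
    intro y
    simp only [hQ, LinearMap.sub_apply, LinearMap.add_apply, LinearMap.smul_apply,
      LinearMap.smulRight_apply, LinearMap.id_apply, inner_sub_left, inner_add_left,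
      inner_smul_left, conj_trivial, ContinuousLinearMap.coe_coe, innerSL_apply_apply,
      real_inner_self_eq_norm_sq]
    ring
  have h1 : gr v A t x = ∫ y, (1 / 2 : ℝ) * (fr v A (x + t • y) + fr v A (x + t • (-y)))
      ∂(stdGaussian (Vec n)) := by
    have hneg : ∫ y, fr v A (x + t • (-y)) ∂(stdGaussian (Vec n)) = gr v A t x := by
      rw [gr]
      conv_rhs => rw [← map_neg_stdGaussian]
      rw [integral_map (φ := fun y : Vec n => -y) (f := fun y => fr v A (x + t • y)) (by fun_prop)
        ((continuous_fr v A).comp (by fun_prop)).aestronglyMeasurable]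
    have hint : Integrable (fun y => fr v A (x + t • (-y))) (stdGaussian (Vec n)) := by
      simpa using integrable_fr v A (-t) x
    rw [integral_const_mul, integral_add (integrable_fr v A t x) hint, hneg, gr]
    ring
  have h2 : ∀ y, (1 / 2 : ℝ) * (fr v A (x + t • y) + fr v A (x + t • (-y)))
      = fr v A x + t ^ 2 * inner ℝ (Q y) y + t ^ 4 * (-(3 * tau n / 4) * ‖y‖ ^ 4) := by
    intro y
    rw [hQy, fr_add, fr_add]
    simp only [inner_neg_right, map_neg, LinearMap.neg_apply, inner_neg_left, norm_neg, neg_neg]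
    ring
  have h3 : ∑ i, inner ℝ (Q (EuclideanSpace.single i 1)) (EuclideanSpace.single i (1 : ℝ))
      = inner ℝ ((3 * tau n) • v + traceVec A) x - 3 * tau n / 4 * ((2 * n + 4) * ‖x‖ ^ 2) := by
    simp only [hQy, Finset.sum_sub_distrib, Finset.sum_add_distrib, ← Finset.mul_sum,
      ← Finset.sum_div, sum_inner_contr_single, sum_inner_single_mul, hv]
    rw [inner_add_left, inner_smul_left]
    simp only [one_pow, Finset.sum_const, Finset.card_univ, Fintype.card_fin, PiLp.norm_single,
      norm_one, nsmul_eq_mul, conj_trivial]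
    ring
  rw [h1]
  simp only [h2]
  rw [integral_add, integral_add, integral_const_mul, integral_const_mul,
    integral_inner_linearMap_self, h3, smoothed, fr_eq]
  · simp
    ring
  · exact integrable_const _
  · exact (integrable_inner_linearMap_self Q).const_mul _
  · exact (integrable_const _).add ((integrable_inner_linearMap_self Q).const_mul _)
  · exact ((integrable_norm_pow_stdGaussian 4).const_mul _).const_mul _

end

/-! ### Gradient, Hessian and optimality conditions -/

section

variable {n : ℕ}

/-- The gradient of `g_r(·, t)`. -/
def grad (v : Vec n) (A : Tensor n) (t : ℝ) (x : Vec n) : Vec n :=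
  (3 * tau n * inner ℝ v x ^ 2) • v + (1 / 2 : ℝ) • contr A x x
    + t ^ 2 • ((3 * tau n) • v + traceVec A) - (3 * tau n * (‖x‖ ^ 2 + (n + 2) * t ^ 2)) • x

/-- The Hessian of `g_r(·, t)`. -/
def hess (v : Vec n) (A : Tensor n) (t : ℝ) (x : Vec n) : Vec n →ₗ[ℝ] Vec n :=
  (6 * tau n * inner ℝ v x) • ((innerSL ℝ v : Vec n →L[ℝ] ℝ) : Vec n →ₗ[ℝ] ℝ).smulRight v
    + contr A x - (3 * tau n * (‖x‖ ^ 2 + (n + 2) * t ^ 2)) • LinearMap.id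
    - (6 * tau n) • ((innerSL ℝ x : Vec n →L[ℝ] ℝ) : Vec n →ₗ[ℝ] ℝ).smulRight x

lemma hess_apply (v : Vec n) (A : Tensor n) (t : ℝ) (x w : Vec n) :
    hess v A t x w = (6 * tau n * inner ℝ v x * inner ℝ v w) • v + contr A x w
      - (3 * tau n * (‖x‖ ^ 2 + (n + 2) * t ^ 2)) • w - (6 * tau n * inner ℝ x w) • x := by
  simp [hess, smul_smul]

/-- The function is a quartic polynomial, so its expansion along a line is exact. The gradient, the
second order condition and the midpoint comparison of two maximizers are all read off from it. -/
lemma smoothed_add (v : Vec n) (A : Tensor n) (t : ℝ) (x w : Vec n) (h : ℝ) :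
    smoothed v A t (x + h • w) = smoothed v A t x + h * inner ℝ (grad v A t x) w
      + h ^ 2 * (inner ℝ (hess v A t x w) w / 2)
      + h ^ 3 * (tau n * inner ℝ v w ^ 3 + inner ℝ (contr A w w) w / 6
        - 3 * tau n * inner ℝ x w * ‖w‖ ^ 2)
      + h ^ 4 * (- (3 * tau n / 4) * ‖w‖ ^ 4) := by
  have h2 : ‖x + h • w‖ ^ 2 = ‖x‖ ^ 2 + 2 * h * inner ℝ x w + h ^ 2 * ‖w‖ ^ 2 := by
    rw [norm_add_sq_real, inner_smul_right, norm_smul, mul_pow, Real.norm_eq_abs, sq_abs]; ring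
  have h4 : ‖x + h • w‖ ^ 4 = (‖x‖ ^ 2 + 2 * h * inner ℝ x w + h ^ 2 * ‖w‖ ^ 2) ^ 2 := by
    rw [← h2]; ring
  rw [smoothed, smoothed, h4, h2, inner_contr_add, grad, hess_apply]
  simp only [map_smul, LinearMap.smul_apply, inner_smul_left, inner_smul_right, inner_add_right,
    inner_add_left, inner_sub_left, conj_trivial, real_inner_self_eq_norm_sq]
  ring

lemma grad_add (v : Vec n) (A : Tensor n) (t : ℝ) (x w : Vec n) (h : ℝ) :
    grad v A t (x + h • w) = grad v A t x + h • hess v A t x w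
      + h ^ 2 • ((3 * tau n * inner ℝ v w ^ 2) • v + (1 / 2 : ℝ) • contr A w w
        - (6 * tau n * inner ℝ x w) • w - (3 * tau n * ‖w‖ ^ 2) • x)
      + h ^ 3 • (-(3 * tau n * ‖w‖ ^ 2) • w) := by
  have h2 : ‖x + h • w‖ ^ 2 = ‖x‖ ^ 2 + 2 * h * inner ℝ x w + h ^ 2 * ‖w‖ ^ 2 := by
    rw [norm_add_sq_real, inner_smul_right, norm_smul, mul_pow, Real.norm_eq_abs, sq_abs]; ring
  rw [grad, grad, hess_apply, h2]
  simp only [map_add, map_smul, LinearMap.add_apply, LinearMap.smul_apply, inner_add_right,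
    inner_smul_right]
  rw [contr_comm A w x]
  module

lemma differentiable_inner_contr (A : Tensor n) :
    Differentiable ℝ (fun x : Vec n => (inner ℝ (contr A x x) x : ℝ)) := by
  simp only [inner_contr]
  fun_prop

lemma differentiable_contr (A : Tensor n) :
    Differentiable ℝ (fun x : Vec n => contr A x x) := by
  rw [differentiable_euclidean]
  intro k
  simp only [contr_apply]
  fun_prop

lemma differentiable_smoothed (v : Vec n) (A : Tensor n) (t : ℝ) :
    Differentiable ℝ (smoothed v A t) := by
  have h1 : Differentiable ℝ (fun x : Vec n => (inner ℝ (contr A x x) x : ℝ) / 6) := by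
    simp only [div_eq_mul_inv]
    exact (differentiable_inner_contr A).mul_const _
  have h2 : Differentiable ℝ (fun x : Vec n => ‖x‖ ^ 2) := differentiable_id.norm_sq ℝ
  have h4 : (fun x : Vec n => ‖x‖ ^ 4) = fun x => (‖x‖ ^ 2) ^ 2 := by ext; ring
  have h5 : Differentiable ℝ (fun x : Vec n => ‖x‖ ^ 4) := by rw [h4]; exact h2.pow 2
  have h6 : ∀ w : Vec n, Differentiable ℝ (fun x : Vec n => (inner ℝ w x : ℝ)) :=
    fun w => (differentiable_const w).inner ℝ differentiable_id
  unfold smoothed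
  exact ((((h6 v).pow 3).const_mul _).add h1 |>.add ((h6 _).const_mul _)).sub
    ((h5.add (h2.const_mul _)).const_mul _)

lemma differentiable_grad (v : Vec n) (A : Tensor n) (t : ℝ) :
    Differentiable ℝ (grad v A t) := by
  have h2 : Differentiable ℝ (fun x : Vec n => ‖x‖ ^ 2) := differentiable_id.norm_sq ℝ
  have h6 : Differentiable ℝ (fun x : Vec n => (inner ℝ v x : ℝ)) :=
    (differentiable_const v).inner ℝ differentiable_id
  have e1 : Differentiable ℝ (fun x : Vec n => (3 * tau n * inner ℝ v x ^ 2) • v) :=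
    ((h6.pow 2).const_mul _).smul_const v
  have e2 : Differentiable ℝ (fun x : Vec n => (1 / 2 : ℝ) • contr A x x) :=
    Differentiable.const_smul (differentiable_contr A) (1 / 2 : ℝ)
  have e3 : Differentiable ℝ
      (fun x : Vec n => (3 * tau n * (‖x‖ ^ 2 + (n + 2) * t ^ 2)) • x) :=
    Differentiable.smul ((h2.add_const _).const_mul _) differentiable_id
  have e4 := (e1.add e2).add (differentiable_const (t ^ 2 • ((3 * tau n) • v + traceVec A)))
  exact e4.sub e3

lemma hasDerivAt_quartic {F : Type*} [NormedAddCommGroup F] [NormedSpace ℝ F] (a b c d e : F) :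
    HasDerivAt (fun h : ℝ => a + h • b + h ^ 2 • c + h ^ 3 • d + h ^ 4 • e) b 0 := by
  have h := (((((hasDerivAt_const (0 : ℝ) a).add ((hasDerivAt_id (0 : ℝ)).smul_const b)).add
      ((hasDerivAt_pow 2 (0 : ℝ)).smul_const c)).add ((hasDerivAt_pow 3 (0 : ℝ)).smul_const d)).add
      ((hasDerivAt_pow 4 (0 : ℝ)).smul_const e))
  have e : b = 0 + (1 : ℝ) • b + ((2 : ℕ) * (0 : ℝ) ^ (2 - 1)) • c
      + ((3 : ℕ) * (0 : ℝ) ^ (3 - 1)) • d + ((4 : ℕ) * (0 : ℝ) ^ (4 - 1)) • e := by simp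
  rw [← e] at h
  exact h

lemma hasGradientAt_smoothed (v : Vec n) (A : Tensor n) (t : ℝ) (x : Vec n) :
    HasGradientAt (smoothed v A t) (grad v A t x) x := by
  rw [hasGradientAt_iff_hasFDerivAt]
  have hd := (differentiable_smoothed v A t x).hasFDerivAt
  have key : InnerProductSpace.toDual ℝ (Vec n) (grad v A t x) = fderiv ℝ (smoothed v A t) x := by
    refine ContinuousLinearMap.ext fun w => ?_
    have h2 : HasDerivAt (fun h : ℝ => smoothed v A t (x + h • w))
        (inner ℝ (grad v A t x) w) 0 := by
      simp only [smoothed_add]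
      exact hasDerivAt_quartic (F := ℝ) _ _ _ _ _
    rw [InnerProductSpace.toDual_apply_apply]
    exact h2.unique (hd.hasLineDerivAt w)
  rw [key]
  exact hd

lemma hasFDerivAt_grad (v : Vec n) (A : Tensor n) (t : ℝ) (x : Vec n) :
    ((fderiv ℝ (grad v A t) x : Vec n →L[ℝ] Vec n) : Vec n →ₗ[ℝ] Vec n) = hess v A t x := by
  have hd := (differentiable_grad v A t x).hasFDerivAt
  refine LinearMap.ext fun w => ?_
  have h1 := hd.hasLineDerivAt w
  have h2 : HasDerivAt (fun h : ℝ => grad v A t (x + h • w)) (hess v A t x w) 0 := by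
    simp only [grad_add]
    have := hasDerivAt_quartic (grad v A t x) (hess v A t x w)
      ((3 * tau n * inner ℝ v w ^ 2) • v + (1 / 2 : ℝ) • contr A w w
        - (6 * tau n * inner ℝ x w) • w - (3 * tau n * ‖w‖ ^ 2) • x)
      (-(3 * tau n * ‖w‖ ^ 2) • w) 0
    simpa only [smul_zero, add_zero] using this
  exact (h2.unique h1).symm

lemma gr_eq_fun {v : Vec n} (hv : ‖v‖ = 1) (A : Tensor n) (t : ℝ) :
    gr v A t = fun x => smoothed v A t x
      + t ^ 4 * ∫ y : Vec n, -(3 * tau n / 4) * ‖y‖ ^ 4 ∂(stdGaussian (Vec n)) :=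
  funext (gr_eq hv A t)

lemma gradient_gr {v : Vec n} (hv : ‖v‖ = 1) (A : Tensor n) (t : ℝ) :
    gradient (gr v A t) = grad v A t := by
  ext1 x
  refine HasGradientAt.gradient ?_
  rw [gr_eq_fun hv, hasGradientAt_iff_hasFDerivAt]
  exact (hasGradientAt_smoothed v A t x).hasFDerivAt.add_const _

lemma hessian_gr {v : Vec n} (hv : ‖v‖ = 1) (A : Tensor n) (t : ℝ) (x : Vec n) :
    hessian (gr v A t) x = hess v A t x := by
  rw [hessian, gradient_gr hv, hasFDerivAt_grad]

lemma isLocalMax_gr_iff {v : Vec n} (hv : ‖v‖ = 1) (A : Tensor n) (t : ℝ) (x : Vec n) :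
    IsLocalMax (gr v A t) x ↔ IsLocalMax (smoothed v A t) x := by
  rw [gr_eq_fun hv]
  simp [IsLocalMax, IsMaxFilter]

lemma grad_eq_zero_of_isLocalMax {v : Vec n} {A : Tensor n} {t : ℝ} {x : Vec n}
    (hx : IsLocalMax (smoothed v A t) x) : grad v A t x = 0 := by
  have h := hx.hasFDerivAt_eq_zero (hasGradientAt_smoothed v A t x).hasFDerivAt
  simpa using h

/-- A polynomial without constant and linear term that is nonpositive near `0` has a
nonpositive quadratic coefficient. -/
lemma coeff_two_nonpos_of_eventually {a b c : ℝ}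
    (h : ∀ᶠ s : ℝ in 𝓝 0, s ^ 2 * a + s ^ 3 * b + s ^ 4 * c ≤ 0) : a ≤ 0 := by
  have h1 : Tendsto (fun s : ℝ => a + s * b + s ^ 2 * c) (𝓝[≠] 0) (𝓝 (a + 0 * b + 0 ^ 2 * c)) := by
    refine Tendsto.mono_left (Continuous.tendsto ?_ 0) nhdsWithin_le_nhds
    fun_prop
  have h2 : ∀ᶠ s : ℝ in 𝓝[≠] 0, a + s * b + s ^ 2 * c ≤ 0 := by
    filter_upwards [h.filter_mono nhdsWithin_le_nhds, self_mem_nhdsWithin] with s hs hs0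
    have : 0 < s ^ 2 := by positivity [show s ≠ 0 from hs0]
    nlinarith
  simpa using le_of_tendsto h1 h2

lemma hess_nonpos_of_isLocalMax {v : Vec n} {A : Tensor n} {t : ℝ} {x : Vec n}
    (hx : IsLocalMax (smoothed v A t) x) (w : Vec n) : inner ℝ (hess v A t x w) w ≤ 0 := by
  have h0 := grad_eq_zero_of_isLocalMax hx
  have h1 : Tendsto (fun s : ℝ => x + s • w) (𝓝 0) (𝓝 x) := by
    have : Continuous fun s : ℝ => x + s • w := by fun_prop
    simpa using this.tendsto 0
  have h2 := h1.eventually hx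
  have h3 : inner ℝ (hess v A t x w) w / 2 ≤ 0 := by
    refine coeff_two_nonpos_of_eventually (b := tau n * inner ℝ v w ^ 3
      + inner ℝ (contr A w w) w / 6 - 3 * tau n * inner ℝ x w * ‖w‖ ^ 2)
      (c := - (3 * tau n / 4) * ‖w‖ ^ 4) ?_
    filter_upwards [h2] with s hs
    rw [smoothed_add, h0, inner_zero_left] at hs
    linarith
  linarith

end

/-! ### Splitting along the signal, noise bounds and the Hessian test -/

section

variable {n : ℕ}

/-- The component of `y` orthogonal to the unit vector `v`. -/
def perp (v y : Vec n) : Vec n := y - (inner ℝ v y : ℝ) • v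

lemma perp_add (v y z : Vec n) : perp v (y + z) = perp v y + perp v z := by
  simp only [perp, inner_add_right]; module

lemma perp_sub (v y z : Vec n) : perp v (y - z) = perp v y - perp v z := by
  simp only [perp, inner_sub_right]; module

lemma perp_smul (v y : Vec n) (c : ℝ) : perp v (c • y) = c • perp v y := by
  simp only [perp, inner_smul_right]; module

lemma perp_self {v : Vec n} (hv : ‖v‖ = 1) : perp v v = 0 := by
  simp [perp, hv]

lemma inner_perp {v : Vec n} (hv : ‖v‖ = 1) (y : Vec n) : inner ℝ v (perp v y) = 0 := by
  simp [perp, inner_sub_right, inner_smul_right, hv]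

lemma norm_sq_eq_perp {v : Vec n} (hv : ‖v‖ = 1) (y : Vec n) :
    ‖y‖ ^ 2 = inner ℝ v y ^ 2 + ‖perp v y‖ ^ 2 := by
  have h : y = (inner ℝ v y : ℝ) • v + perp v y := by simp [perp]
  conv_lhs => rw [h]
  rw [norm_add_sq_real, inner_smul_left, inner_perp hv, norm_smul, hv]
  simp

lemma norm_perp_le {v : Vec n} (hv : ‖v‖ = 1) (y : Vec n) : ‖perp v y‖ ≤ ‖y‖ := by
  have := norm_sq_eq_perp hv y
  nlinarith [norm_nonneg (perp v y), norm_nonneg y, sq_nonneg (inner ℝ v y : ℝ)]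

lemma norm_le_abs_inner_add_perp {v : Vec n} (hv : ‖v‖ = 1) (y : Vec n) :
    ‖y‖ ≤ |inner ℝ v y| + ‖perp v y‖ := by
  have h : y = (inner ℝ v y : ℝ) • v + perp v y := by simp [perp]
  conv_lhs => rw [h]
  refine (norm_add_le _ _).trans ?_
  rw [norm_smul, hv, mul_one, Real.norm_eq_abs]

lemma abs_inner_le_norm_of_unit {v : Vec n} (hv : ‖v‖ = 1) (y : Vec n) : |inner ℝ v y| ≤ ‖y‖ := by
  simpa [hv] using abs_real_inner_le_norm v y

/-- The deterministic bounds on signal and noise behind the landscape analysis, in terms of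
`q = n^{1/4}` and `l = log n`. -/
structure NoiseBounds (Λ c K q l : ℝ) (v : Vec n) (A : Tensor n) : Prop where
  norm_v : ‖v‖ = 1
  q_pow : q ^ 4 = n
  tau_eq : tau n = q ^ 3 * l
  norm_contr_le : ∀ x y, ‖contr A x y‖ ≤ Λ * q ^ 2 * ‖x‖ * ‖y‖
  le_sum_contr : ∀ x, c * (q ^ 8 * ‖x‖ ^ 2) ≤ ∑ i, ‖contr A x (EuclideanSpace.single i 1)‖ ^ 2
  le_norm_trace : q ^ 4 ≤ K * ‖traceVec A‖
  norm_trace_le : ‖traceVec A‖ ≤ K * q ^ 4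
  abs_inner_trace_le : |inner ℝ (traceVec A) v| ≤ K * (q ^ 2 * l)
  norm_perp_contr_le : ‖perp v (contr A v (traceVec A))‖ ≤ 16 * q ^ 6

lemma sum_inner_single_sq (p : Vec n) :
    ∑ i, inner ℝ p (EuclideanSpace.single i (1 : ℝ)) ^ 2 = ‖p‖ ^ 2 := sum_inner_single_mul p

section

variable {Λ c K q l t : ℝ} {v : Vec n} {A : Tensor n} {x : Vec n}

lemma perp_grad (hv : ‖v‖ = 1) (hx : grad v A t x = 0) :
    (1 / 2 : ℝ) • perp v (contr A x x) + t ^ 2 • perp v (traceVec A)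
      = (3 * tau n * (‖x‖ ^ 2 + (n + 2) * t ^ 2)) • perp v x := by
  have h : perp v (grad v A t x) = 0 := by rw [hx]; simp [perp]
  rw [grad] at h
  simp only [perp_sub, perp_add, perp_smul, perp_self hv] at h
  rw [sub_eq_zero] at h
  rw [← h]
  module

lemma inner_grad (hv : ‖v‖ = 1) (hx : grad v A t x = 0) :
    3 * tau n * inner ℝ v x ^ 2 + inner ℝ (contr A x x) v / 2
      + t ^ 2 * (3 * tau n + inner ℝ (traceVec A) v)
      = 3 * tau n * (‖x‖ ^ 2 + (n + 2) * t ^ 2) * inner ℝ v x := by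
  have h : inner ℝ v (grad v A t x) = 0 := by rw [hx]; simp
  rw [grad] at h
  simp only [inner_sub_right, inner_add_right, inner_smul_right, real_inner_self_eq_norm_sq,
    hv] at h
  rw [real_inner_comm v, real_inner_comm v]
  linarith

/-- Testing the Hessian on the columns of `contr A x + λ` bounds `‖x‖` by the penalty. -/
lemma sum_sq_contr_le_of_hess_nonpos (hv : ‖v‖ = 1) (hτ : 0 ≤ tau n) {lam : ℝ} (hlam : 0 < lam)
    (hM : ∀ y, ‖contr A x y‖ ≤ lam * ‖y‖)
    (hH : ∀ w, inner ℝ (hess v A t x w) w ≤ 0) :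
    ∑ i, ‖contr A x (EuclideanSpace.single i 1)‖ ^ 2 ≤
      lam * (2 * ‖traceVec A‖ * ‖x‖ + 24 * tau n * ‖x‖ + 24 * tau n * ‖x‖ ^ 2
        + 12 * tau n * (‖x‖ ^ 2 + (n + 2) * t ^ 2) * n) := by
  set e : Fin n → Vec n := fun i => EuclideanSpace.single i (1 : ℝ) with he
  have hen : ∀ i, ‖e i‖ = 1 := fun i => by simp [he]
  -- With `M = contr A x`, the sum of `⟨M w_i, w_i⟩` is `Tr (M³ + 2λM² + λ²M)`. As `|M| ≤ λ`, this
  -- is at least `λ ‖M‖² + λ² Tr M` in Frobenius norm: the shift by `λ` weights the test vectors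
  -- towards the positive part of `M`.
  set w : Fin n → Vec n := fun i => contr A x (e i) + lam • e i with hw
  have hwn : ∀ i, ‖w i‖ ^ 2 ≤ 4 * lam ^ 2 := by
    intro i
    have h1 : ‖w i‖ ≤ 2 * lam := by
      refine (norm_add_le _ _).trans ?_
      rw [norm_smul, hen, Real.norm_eq_abs, abs_of_pos hlam]
      have := hM (e i); rw [hen] at this; linarith
    nlinarith [norm_nonneg (w i)]
  -- The sum is `‖(M + λ) z‖²`, so the rank one terms of the Hessian cost an operator norm and no
  -- factor `n`.
  have hproj : ∀ z : Vec n, ∑ i, inner ℝ z (w i) ^ 2 ≤ 4 * lam ^ 2 * ‖z‖ ^ 2 := by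
    intro z
    have h1 : ∀ i, inner ℝ z (w i) = inner ℝ (contr A x z + lam • z) (e i) := by
      intro i
      rw [hw, inner_add_right, inner_add_left, inner_smul_left, inner_smul_right, ← inner_contr_swap]
      simp
    simp only [h1]
    rw [sum_inner_single_sq]
    have h2 : ‖contr A x z + lam • z‖ ≤ 2 * lam * ‖z‖ := by
      refine (norm_add_le _ _).trans ?_
      rw [norm_smul, Real.norm_eq_abs, abs_of_pos hlam]
      have := hM z; linarith
    calc _ ≤ (2 * lam * ‖z‖) ^ 2 := by gcongr
      _ = _ := by ring
  have hquad : ∀ i, lam * ‖contr A x (e i)‖ ^ 2 + lam ^ 2 * inner ℝ (contr A x (e i)) (e i)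
      ≤ inner ℝ (contr A x (w i)) (w i) := by
    intro i
    have h1 : inner ℝ (contr A x (w i)) (w i)
        = inner ℝ (contr A x (contr A x (e i))) (contr A x (e i))
          + 2 * lam * ‖contr A x (e i)‖ ^ 2 + lam ^ 2 * inner ℝ (contr A x (e i)) (e i) := by
      simp only [hw, map_add, map_smul, inner_add_left, inner_add_right, inner_smul_left,
        inner_smul_right, conj_trivial]
      rw [inner_contr_swap A x (contr A x (e i)) (e i), real_inner_self_eq_norm_sq]
      ring
    have h2 : |inner ℝ (contr A x (contr A x (e i))) (contr A x (e i))|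
        ≤ lam * ‖contr A x (e i)‖ ^ 2 := by
      refine (abs_real_inner_le_norm _ _).trans ?_
      have := hM (contr A x (e i))
      nlinarith [norm_nonneg (contr A x (e i))]
    rw [h1]
    linarith [neg_abs_le (inner ℝ (contr A x (contr A x (e i))) (contr A x (e i)))]
  have hpt : ∀ i, lam * ‖contr A x (e i)‖ ^ 2 + lam ^ 2 * inner ℝ (contr A x (e i)) (e i)
      ≤ 6 * tau n * ‖x‖ * inner ℝ v (w i) ^ 2 + 6 * tau n * inner ℝ x (w i) ^ 2
        + 3 * tau n * (‖x‖ ^ 2 + (n + 2) * t ^ 2) * (4 * lam ^ 2) := by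
    intro i
    have h1 := hH (w i)
    rw [hess_apply] at h1
    simp only [inner_sub_left, inner_add_left, inner_smul_left, conj_trivial,
      real_inner_self_eq_norm_sq] at h1
    have h2 : -(6 * tau n * ‖x‖ * inner ℝ v (w i) ^ 2)
        ≤ 6 * tau n * inner ℝ v x * inner ℝ v (w i) * inner ℝ v (w i) := by
      have h3 := abs_inner_le_norm_of_unit hv x
      have h4 : -‖x‖ ≤ inner ℝ v x := by linarith [neg_abs_le (inner ℝ v x : ℝ)]
      have h5 : 0 ≤ 6 * tau n * inner ℝ v (w i) ^ 2 := by positivity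
      nlinarith
    have h6 : 3 * tau n * (‖x‖ ^ 2 + (n + 2) * t ^ 2) * ‖w i‖ ^ 2
        ≤ 3 * tau n * (‖x‖ ^ 2 + (n + 2) * t ^ 2) * (4 * lam ^ 2) :=
      mul_le_mul_of_nonneg_left (hwn i) (by positivity)
    have := hquad i
    linarith
  have hsum := Finset.sum_le_sum fun i (_ : i ∈ Finset.univ) => hpt i
  simp only [Finset.sum_add_distrib, ← Finset.mul_sum, Finset.sum_const, Finset.card_univ,
    Fintype.card_fin, nsmul_eq_mul] at hsum
  have htr : ∑ i, inner ℝ (contr A x (e i)) (e i) = 2 * inner ℝ (traceVec A) x :=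
    sum_inner_contr_single A x
  rw [htr] at hsum
  have h7 := hproj v
  have h8 := hproj x
  rw [hv] at h7
  have h9 : -(‖traceVec A‖ * ‖x‖) ≤ inner ℝ (traceVec A) x := by
    linarith [neg_abs_le (inner ℝ (traceVec A) x : ℝ), abs_real_inner_le_norm (traceVec A) x]
  have h10 : 6 * tau n * ‖x‖ * ∑ i, inner ℝ v (w i) ^ 2
      ≤ 6 * tau n * ‖x‖ * (4 * lam ^ 2 * 1 ^ 2) := by gcongr
  have h11 : 6 * tau n * ∑ i, inner ℝ x (w i) ^ 2
      ≤ 6 * tau n * (4 * lam ^ 2 * ‖x‖ ^ 2) := by gcongr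
  have h12 : lam ^ 2 * -(‖traceVec A‖ * ‖x‖) ≤ lam ^ 2 * inner ℝ (traceVec A) x := by gcongr
  have h13 : lam * ∑ i, ‖contr A x (e i)‖ ^ 2 ≤ lam * (lam * (2 * ‖traceVec A‖ * ‖x‖
      + 24 * tau n * ‖x‖ + 24 * tau n * ‖x‖ ^ 2
        + 12 * tau n * (‖x‖ ^ 2 + (n + 2) * t ^ 2) * n)) := by
    nlinarith
  exact le_of_mul_le_mul_left h13 hlam

end

end

/-! ### A priori bounds at stationary points and local maximizers -/

section

variable {n : ℕ} {Λ c K q l t : ℝ} {v : Vec n} {A : Tensor n} {x : Vec n}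

lemma NoiseBounds.tau_pos (h : NoiseBounds Λ c K q l v A) (hq : 1 ≤ q) (hl : 1 ≤ l) :
    0 < tau n := by
  rw [h.tau_eq]; positivity

lemma NoiseBounds.norm_perp_le (h : NoiseBounds Λ c K q l v A) (hΛ : 0 < Λ) (hK : 0 < K)
    (hq : 1 ≤ q) (hl : 1 ≤ l) (hx : grad v A t x = 0) :
    ‖perp v x‖ ≤ (Λ + K) / (q * l) := by
  have hv := h.norm_v
  set s : ℝ := (n + 2) * t ^ 2 with hs
  have hs0 : 0 ≤ s := by positivity
  have hτ := h.tau_pos hq hl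
  have h1 := perp_grad hv hx
  have h2 : 3 * tau n * (‖x‖ ^ 2 + s) * ‖perp v x‖ ≤ Λ * q ^ 2 * ‖x‖ ^ 2 + K * s := by
    have e : ‖(3 * tau n * (‖x‖ ^ 2 + s)) • perp v x‖
        = 3 * tau n * (‖x‖ ^ 2 + s) * ‖perp v x‖ := by
      rw [norm_smul, Real.norm_of_nonneg (by positivity)]
    rw [← e, ← h1]
    refine (norm_add_le _ _).trans ?_
    rw [norm_smul, norm_smul, Real.norm_of_nonneg (by norm_num : (0 : ℝ) ≤ 1 / 2),
      Real.norm_of_nonneg (by positivity : 0 ≤ t ^ 2)]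
    have h3 := (TensorPCA.norm_perp_le hv (contr A x x)).trans (h.norm_contr_le x x)
    have h4 := (TensorPCA.norm_perp_le hv (traceVec A)).trans h.norm_trace_le
    rw [h.q_pow] at h4
    have h5 : t ^ 2 * ‖perp v (traceVec A)‖ ≤ t ^ 2 * (K * n) := by gcongr
    have h6 : t ^ 2 * (K * n) ≤ K * s := by
      rw [hs]; nlinarith [mul_nonneg hK.le (sq_nonneg t)]
    nlinarith [norm_nonneg (perp v (contr A x x))]
  rw [h.tau_eq] at h2
  rcases (by positivity : 0 ≤ ‖x‖ ^ 2 + s).eq_or_lt with h0 | h0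
  · have hx0 : ‖x‖ = 0 := by nlinarith [norm_nonneg x]
    have : ‖perp v x‖ ≤ 0 := (TensorPCA.norm_perp_le hv x).trans hx0.le
    exact this.trans (by positivity)
  · rw [le_div_iff₀ (by positivity)]
    have hq2 : 1 ≤ q ^ 2 := one_le_pow₀ hq
    have h3 : q ^ 2 * (‖x‖ ^ 2 + s) * (‖perp v x‖ * (q * l)) ≤
        q ^ 2 * (‖x‖ ^ 2 + s) * (Λ + K) := by
      have h4 : Λ * q ^ 2 * ‖x‖ ^ 2 + K * s ≤ q ^ 2 * (‖x‖ ^ 2 + s) * (Λ + K) := by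
        have : K * s ≤ K * s * q ^ 2 := le_mul_of_one_le_right (by positivity) hq2
        have h5 : 0 ≤ q ^ 2 * s * Λ := by positivity
        have h6 : 0 ≤ q ^ 2 * ‖x‖ ^ 2 * K := by positivity
        nlinarith
      have h7 : 0 ≤ q ^ 3 * l * (‖x‖ ^ 2 + s) * ‖perp v x‖ := by positivity
      nlinarith
    exact le_of_mul_le_mul_left h3 (by positivity)

/-- The Hessian test is applied with `λ = Λ q² ‖x‖`. Against the Frobenius mass `c q⁸ ‖x‖²` only the
penalty, which carries a factor `n = q⁴`, can compete. -/
lemma NoiseBounds.norm_le_of_hess (h : NoiseBounds Λ c K q l v A) (hΛ : 0 < Λ) (hK : 0 < K)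
    (hc : 0 < c) (hq : 1 ≤ q) (hl : 1 ≤ l) (hlq : l ≤ q) (hq2 : 4 * Λ * (K + 12) ≤ c * q)
    (hH : ∀ w, inner ℝ (hess v A t x w) w ≤ 0) :
    ‖x‖ ≤ 72 * Λ / c * (q * l * (‖x‖ ^ 2 + (n + 2) * t ^ 2)) := by
  have hv := h.norm_v
  set s : ℝ := (n + 2) * t ^ 2 with hs
  have hs0 : 0 ≤ s := by positivity
  have hτ := h.tau_pos hq hl
  rcases (norm_nonneg x).eq_or_lt with h0 | h0
  · rw [← h0]; positivity
  have hlam : 0 < Λ * q ^ 2 * ‖x‖ := by positivity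
  have h1 := (h.le_sum_contr x).trans
    (sum_sq_contr_le_of_hess_nonpos hv hτ.le hlam (h.norm_contr_le x) hH)
  rw [← hs, ← h.q_pow, h.tau_eq] at h1
  set r := ‖x‖ with hr
  have hu := h.norm_trace_le
  have h2 : c * (q ^ 8 * r ^ 2) ≤ Λ * q ^ 2 * r * (2 * (K * q ^ 4) * r
      + 24 * (q ^ 3 * l) * r + 36 * (q ^ 3 * l) * (r ^ 2 + s) * q ^ 4) := by
    refine h1.trans (mul_le_mul_of_nonneg_left ?_ hlam.le)
    have e1 : 2 * ‖traceVec A‖ * r ≤ 2 * (K * q ^ 4) * r := by gcongr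
    have e2 : 24 * (q ^ 3 * l) * r ^ 2 ≤ 24 * (q ^ 3 * l) * (r ^ 2 + s) * q ^ 4 := by
      have : (1 : ℝ) ≤ q ^ 4 := one_le_pow₀ hq
      calc 24 * (q ^ 3 * l) * r ^ 2 ≤ 24 * (q ^ 3 * l) * (r ^ 2 + s) := by gcongr; linarith
        _ ≤ _ := le_mul_of_one_le_right (by positivity) this
    linarith
  have h3 : q ^ 7 * r * (c * q * r) ≤ q ^ 7 * r * (Λ * (2 * K * r / q + 24 * l * r / q ^ 2
      + 36 * (q ^ 2 * l) * (r ^ 2 + s))) := by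
    have e : q ^ 7 * r * (Λ * (2 * K * r / q + 24 * l * r / q ^ 2
      + 36 * (q ^ 2 * l) * (r ^ 2 + s))) = Λ * q ^ 2 * r * (2 * (K * q ^ 4) * r
      + 24 * (q ^ 3 * l) * r + 36 * (q ^ 3 * l) * (r ^ 2 + s) * q ^ 4) := by
      field_simp
    rw [e]; linarith
  have h4 := le_of_mul_le_mul_left h3 (by positivity)
  have e1 : 2 * K * r / q ≤ 2 * K * r := div_le_self (by positivity) hq
  have e2 : 24 * l * r / q ^ 2 ≤ 24 * r := by
    rw [div_le_iff₀ (by positivity)]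
    have : l ≤ q ^ 2 := by nlinarith
    nlinarith
  -- The trace and signal terms use up at most half of the left side, which turns the constant `36`
  -- into `72`.
  have h5 : Λ * (2 * K * r + 24 * r) ≤ c * q * r / 2 := by nlinarith
  have h6 : Λ * (2 * K * r / q + 24 * l * r / q ^ 2) ≤ Λ * (2 * K * r + 24 * r) := by gcongr
  have h7 : q * (c * r) ≤ q * (72 * Λ * (q * l * (r ^ 2 + s))) := by nlinarith
  have h8 := le_of_mul_le_mul_left h7 (by positivity)
  rw [div_mul_eq_mul_div, le_div_iff₀ hc]
  linarith

/-- The trace vector has length of order `q⁴`, but its component along `v` is only of order `q² l`.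
-/
lemma NoiseBounds.half_le_perp_trace (h : NoiseBounds Λ c K q l v A) (hK : 0 < K)
    (hq : 1 ≤ q) (hq2 : 2 * K ^ 2 * l ≤ q) :
    q ^ 4 / (2 * K) ≤ ‖perp v (traceVec A)‖ := by
  have h1 := norm_le_abs_inner_add_perp h.norm_v (traceVec A)
  have h2 := h.abs_inner_trace_le
  rw [real_inner_comm] at h2
  have h3 := h.le_norm_trace
  rw [div_le_iff₀ (by positivity)]
  have h4 : K * (K * (q ^ 2 * l)) ≤ q ^ 4 / 2 := by
    have e : q * 1 ≤ q * q := by gcongr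
    have : 2 * K ^ 2 * l ≤ q ^ 2 := by nlinarith
    have : 2 * K ^ 2 * l * q ^ 2 ≤ q ^ 2 * q ^ 2 := by gcongr
    nlinarith
  have h5 : K * ‖traceVec A‖ ≤ K * (K * (q ^ 2 * l) + ‖perp v (traceVec A)‖) := by
    gcongr; linarith
  nlinarith

/-- Without smoothing the gradient and the Hessian vanish at the origin. The cubic coefficient along
`v` is positive because the signal `τ` exceeds the noise bound `Λ q²`, so the function increases in
that direction. -/
lemma NoiseBounds.not_isLocalMax_zero (h : NoiseBounds Λ c K q l v A)
    (hq : 1 ≤ q) (hl : 1 ≤ l) (hqΛ : Λ < q) : ¬ IsLocalMax (smoothed v A 0) (0 : Vec n) := by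
  intro hx
  have hv := h.norm_v
  have hτ := h.tau_pos hq hl
  have h1 : Tendsto (fun s : ℝ => (0 : Vec n) + s • v) (𝓝[>] 0) (𝓝 0) := by
    have : Continuous fun s : ℝ => (0 : Vec n) + s • v := by fun_prop
    simpa using (this.tendsto 0).mono_left nhdsWithin_le_nhds
  have h2 := h1.eventually hx
  set b := tau n + inner ℝ (contr A v v) v / 6 with hb
  have hbpos : 0 < b := by
    have h3 : |inner ℝ (contr A v v) v| ≤ Λ * q ^ 2 := by
      have := (abs_real_inner_le_norm (contr A v v) v).trans
        (mul_le_mul_of_nonneg_right (h.norm_contr_le v v) (norm_nonneg v))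
      simpa [hv] using this
    have h4 : Λ * q ^ 2 < q * q ^ 2 := by gcongr
    have h5 : q ^ 3 ≤ tau n := by rw [h.tau_eq]; exact le_mul_of_one_le_right (by positivity) hl
    have h6 := neg_abs_le (inner ℝ (contr A v v) v : ℝ)
    have : 0 ≤ |inner ℝ (contr A v v) v| := abs_nonneg _
    rw [hb]; nlinarith
  have h3 : ∀ᶠ s : ℝ in 𝓝[>] 0, b - s * (3 * tau n / 4) ≤ 0 := by
    filter_upwards [h2, self_mem_nhdsWithin] with s hs hs0
    rw [smoothed_add, grad_eq_zero_of_isLocalMax hx, hess_apply] at hs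
    simp only [inner_zero_left, inner_zero_right, hv, map_zero, norm_zero,
      real_inner_self_eq_norm_sq, LinearMap.zero_apply] at hs
    have hs0' : (0 : ℝ) < s := hs0
    have h4 : s ^ 3 * (b - s * (3 * tau n / 4)) ≤ 0 := by
      rw [hb]; ring_nf at hs ⊢; simp at hs; linarith
    by_contra hcon
    push Not at hcon
    have : 0 < s ^ 3 * (b - s * (3 * tau n / 4)) := by positivity
    linarith
  have h4 : Tendsto (fun s : ℝ => b - s * (3 * tau n / 4)) (𝓝[>] 0) (𝓝 b) := by
    have : Continuous fun s : ℝ => b - s * (3 * tau n / 4) := by fun_prop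
    simpa using (this.tendsto 0).mono_left nhdsWithin_le_nhds
  exact absurd (le_of_tendsto h4 h3) (not_le.2 hbpos)

end

/-! ### Lower bound on the norm and the scalar equation along the signal -/

section

variable {n : ℕ} {Λ c K q l t : ℝ} {v : Vec n} {A : Tensor n} {x : Vec n}

/-- Multiplying the balance `h` by `l²` and inserting `r ≤ 2 D q l s` repeatedly bounds its right
side by a fixed multiple of `s`. By `hE` this multiple is below `l²`, so only `s = 0` survives. -/
lemma eq_zero_of_small_stationary {D r s : ℝ} (hΛ : 0 < Λ) (hK : 0 < K) (hD : 0 < D)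
    (hq : 1 ≤ q) (hl : 1 ≤ l) (hr : 0 ≤ r) (hs : 0 ≤ s) (hrs : r ≤ 2 * D * (q * l * s))
    (hsq : s * (q ^ 4 * l ^ 4) ≤ 3)
    (h : s ≤ 6 * K * (Λ * q ^ 2 * r ^ 2 + 3 * (q ^ 3 * l) * (r ^ 2 + s) * r))
    (hE : 6 * K * (12 * Λ * D ^ 2 + 216 * D ^ 3 + 18 * D) < l) : s = 0 := by
  have h1 : q ^ 3 * l ^ 3 * r ≤ 6 * D := by
    calc q ^ 3 * l ^ 3 * r ≤ q ^ 3 * l ^ 3 * (2 * D * (q * l * s)) := by gcongr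
      _ = 2 * D * (s * (q ^ 4 * l ^ 4)) := by ring
      _ ≤ 2 * D * 3 := by gcongr
      _ = _ := by ring
  have h2 : q ^ 2 * l ^ 2 * r ^ 2 ≤ 12 * D ^ 2 * s := by
    calc q ^ 2 * l ^ 2 * r ^ 2 = q ^ 2 * l ^ 2 * r * r := by ring
      _ ≤ q ^ 2 * l ^ 2 * r * (2 * D * (q * l * s)) := by gcongr
      _ = q ^ 3 * l ^ 3 * r * (2 * D * s) := by ring
      _ ≤ 6 * D * (2 * D * s) := by gcongr
      _ = _ := by ring
  have h3 : r ^ 2 ≤ 12 * D ^ 2 * s := by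
    have : 1 ≤ q ^ 2 * l ^ 2 := one_le_mul_of_one_le_of_one_le (one_le_pow₀ hq) (one_le_pow₀ hl)
    nlinarith [sq_nonneg r]
  have h4 : q ^ 3 * l ^ 3 * r * (r ^ 2 + s) ≤ 6 * D * (12 * D ^ 2 * s + s) := by gcongr
  have h5 : l ^ 2 * s ≤ 6 * K * (12 * Λ * D ^ 2 + 216 * D ^ 3 + 18 * D) * s := by
    calc l ^ 2 * s ≤ l ^ 2 * (6 * K * (Λ * q ^ 2 * r ^ 2 + 3 * (q ^ 3 * l) * (r ^ 2 + s) * r)) := by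
          gcongr
      _ = 6 * K * (Λ * (q ^ 2 * l ^ 2 * r ^ 2) + 3 * (q ^ 3 * l ^ 3 * r * (r ^ 2 + s))) := by ring
      _ ≤ 6 * K * (Λ * (12 * D ^ 2 * s) + 3 * (6 * D * (12 * D ^ 2 * s + s))) := by gcongr
      _ = _ := by ring
  by_contra hne
  have hspos : 0 < s := lt_of_le_of_ne hs (Ne.symm hne)
  have := le_of_mul_le_mul_right h5 hspos
  nlinarith

/-- By `norm_le_of_hess`, a shorter `x` satisfies `‖x‖ = O(q l s)`. Noise and penalty at such a
point cannot balance `t² u⊥` unless `t = 0` and `x = 0`, and the origin is not a maximizer. -/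
lemma NoiseBounds.le_norm_of_isLocalMax (h : NoiseBounds Λ c K q l v A) (hΛ : 0 < Λ) (hK : 0 < K)
    (hc : 0 < c) (hq : 1 ≤ q) (hl : 1 ≤ l) (hlq : l ≤ q) (hq2 : 4 * Λ * (K + 12) ≤ c * q)
    (hq3 : 2 * K ^ 2 * l ≤ q) (hqΛ : Λ < q) (ht : t ^ 2 * (q ^ 8 * l ^ 4) ≤ 1)
    (hE : 6 * K * (12 * Λ * (72 * Λ / c) ^ 2 + 216 * (72 * Λ / c) ^ 3 + 18 * (72 * Λ / c)) < l)
    (hx : IsLocalMax (smoothed v A t) x) :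
    1 / (2 * (72 * Λ / c) * (q * l)) ≤ ‖x‖ := by
  set D := 72 * Λ / c with hD
  have hDpos : 0 < D := by positivity
  have hv := h.norm_v
  have hg := grad_eq_zero_of_isLocalMax hx
  have h1 := h.norm_le_of_hess hΛ hK hc hq hl hlq hq2 (hess_nonpos_of_isLocalMax hx)
  have h2 := perp_grad hv hg
  rw [← hD] at h1
  set s : ℝ := (n + 2) * t ^ 2 with hs
  have hs0 : 0 ≤ s := by positivity
  by_contra hlt
  push Not at hlt
  rw [lt_div_iff₀ (by positivity)] at hlt
  have hs3 : s ≤ 3 * (q ^ 4 * t ^ 2) := by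
    have : (1 : ℝ) ≤ q ^ 4 := one_le_pow₀ hq
    rw [hs, ← h.q_pow]
    nlinarith [sq_nonneg t]
  -- Below the claimed bound, `D q l ‖x‖²` is at most `‖x‖ / 2` and is absorbed.
  have hrs : ‖x‖ ≤ 2 * D * (q * l * s) := by nlinarith [norm_nonneg x]
  have hsq : s * (q ^ 4 * l ^ 4) ≤ 3 := by
    calc s * (q ^ 4 * l ^ 4) ≤ 3 * (q ^ 4 * t ^ 2) * (q ^ 4 * l ^ 4) := by gcongr
      _ = 3 * (t ^ 2 * (q ^ 8 * l ^ 4)) := by ring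
      _ ≤ _ := by linarith
  have hmain : s ≤ 6 * K * (Λ * q ^ 2 * ‖x‖ ^ 2
      + 3 * (q ^ 3 * l) * (‖x‖ ^ 2 + s) * ‖x‖) := by
    have e1 : t ^ 2 * ‖perp v (traceVec A)‖ ≤ 1 / 2 * (Λ * q ^ 2 * ‖x‖ * ‖x‖)
        + 3 * (q ^ 3 * l) * (‖x‖ ^ 2 + s) * ‖x‖ := by
      have e : t ^ 2 • perp v (traceVec A) = (3 * tau n * (‖x‖ ^ 2 + s)) • perp v x
          - (1 / 2 : ℝ) • perp v (contr A x x) := by rw [← h2]; module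
      have hn : t ^ 2 * ‖perp v (traceVec A)‖ = ‖t ^ 2 • perp v (traceVec A)‖ := by
        rw [norm_smul, Real.norm_of_nonneg (by positivity)]
      rw [hn, e]
      refine (norm_sub_le _ _).trans ?_
      have hτ := h.tau_pos hq hl
      rw [norm_smul, norm_smul, Real.norm_of_nonneg (by norm_num : (0 : ℝ) ≤ 1 / 2),
        Real.norm_of_nonneg (by positivity), h.tau_eq, add_comm]
      have e3 := (TensorPCA.norm_perp_le hv (contr A x x)).trans (h.norm_contr_le x x)
      have e4 := TensorPCA.norm_perp_le hv x
      gcongr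
    have e2 := h.half_le_perp_trace hK hq hq3
    have e3 : s ≤ 6 * K * (t ^ 2 * ‖perp v (traceVec A)‖) := by
      calc s ≤ 3 * (q ^ 4 * t ^ 2) := hs3
        _ = 6 * K * (t ^ 2 * (q ^ 4 / (2 * K))) := by field_simp; ring
        _ ≤ _ := by gcongr
    refine e3.trans (mul_le_mul_of_nonneg_left (e1.trans ?_) (by positivity))
    have : 0 ≤ Λ * q ^ 2 * ‖x‖ ^ 2 := by positivity
    nlinarith
  have hs0' := eq_zero_of_small_stationary hΛ hK hDpos hq hl (norm_nonneg x) hs0 hrs hsq hmain hE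
  have hx0 : x = 0 := by
    rw [hs0'] at hrs
    simpa using hrs
  have ht0 : t = 0 := by
    have : (n : ℝ) + 2 ≠ 0 := by positivity
    rw [hs] at hs0'
    simpa [this] using hs0'
  rw [hx0, ht0] at hx
  exact h.not_isLocalMax_zero hq hl hqΛ hx

/-- Here `a = ⟨v, x⟩`, `p = ‖x⊥‖`, and `h` is the stationarity equation along `v` divided by `3τ`,
with noise `e` and smoothing drift `w`. For `a ≥ 1 / 2` the left side is at most `(1 + 1/3 + 1) a²`,
the right side at least `a³`. -/
lemma le_of_cubic_relation {a p s η e w : ℝ} (hη : 0 < η) (hη1 : 4 * η ≤ 1)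
    (hΛη : Λ * η ≤ 1) (hp0 : 0 ≤ p) (hp : p ≤ 1 / 2) (hs : 0 ≤ s) (hw : w ≤ 2 * η ^ 3)
    (he : |e| ≤ Λ * η * (a ^ 2 + p ^ 2) / 6) (ha : 1 / 2 ≤ a)
    (h : a ^ 2 + e + w = (a ^ 2 + p ^ 2 + s) * a) : a ≤ 7 / 3 := by
  have h1 : Λ * η * (a ^ 2 + p ^ 2) ≤ 1 * (a ^ 2 + p ^ 2) := by gcongr
  have h2 : p ^ 2 ≤ a ^ 2 := by gcongr; linarith
  have h3 : 2 * η ^ 3 ≤ a ^ 2 := by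
    have : η ^ 3 ≤ (1 / 4) ^ 3 := by gcongr; linarith
    nlinarith
  have h4 := le_abs_self e
  have h5 : 0 ≤ (p ^ 2 + s) * a := by positivity
  have h6 : a ^ 2 * a ≤ a ^ 2 * (7 / 3) := by nlinarith
  exact le_of_mul_le_mul_left h6 (by positivity)

/-- For `a < 1 / 2` the cubic term takes at most half of `a²`; the rest must be matched by the
perturbations. -/
lemma half_sq_le_of_cubic_relation {a p s e w : ℝ} (hs : 0 ≤ s) (ha : a < 1 / 2)
    (h : a ^ 2 + e + w = (a ^ 2 + p ^ 2 + s) * a) :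
    a ^ 2 / 2 ≤ (p ^ 2 + s) * |a| + |w| + |e| := by
  have h1 := neg_abs_le e
  have h2 := neg_abs_le w
  have h3 : (p ^ 2 + s) * a ≤ (p ^ 2 + s) * |a| := by gcongr; exact le_abs_self a
  have h4 : a ^ 2 * a ≤ a ^ 2 * (1 / 2) := by gcongr
  nlinarith

/-- If `|a| > η`, powers of `η` can be traded for `|a|`, so that all perturbations are `O(η²) |a|`
apart from a fraction of `a²`. Dividing by `|a|` gives `|a| = O(η²)`, which is less than `η`. -/
lemma abs_le_of_cubic_relation {a p s η e w C : ℝ} (hη : 0 < η) (hΛ : 0 < Λ) (hC : 0 < C)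
    (hΛη : Λ * η ≤ 1) (hp0 : 0 ≤ p) (hp : p ≤ C * η) (hs : 0 ≤ s) (hs3 : s ≤ 3 * η ^ 2)
    (hw : |w| ≤ 2 * η ^ 3) (he : |e| ≤ Λ * η * (a ^ 2 + p ^ 2) / 6)
    (hη1 : 4 * (C ^ 2 + 3 + (2 + Λ * C ^ 2)) * η ≤ 1) (ha : a < 1 / 2)
    (h : a ^ 2 + e + w = (a ^ 2 + p ^ 2 + s) * a) : |a| ≤ η := by
  have h1 := half_sq_le_of_cubic_relation hs ha h
  by_contra hcon
  push Not at hcon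
  have hp2 : p ^ 2 ≤ C ^ 2 * η ^ 2 := by rw [← mul_pow]; gcongr
  have h2 : Λ * η * a ^ 2 ≤ 1 * a ^ 2 := by gcongr
  have h3 : Λ * η * p ^ 2 ≤ Λ * C ^ 2 * η ^ 2 * |a| := by
    calc Λ * η * p ^ 2 ≤ Λ * |a| * (C ^ 2 * η ^ 2) := by gcongr
      _ = _ := by ring
  have h4 : 2 * η ^ 3 ≤ 2 * η ^ 2 * |a| := by
    calc 2 * η ^ 3 = 2 * η ^ 2 * η := by ring
      _ ≤ _ := by gcongr
  have h5 : (p ^ 2 + s) * |a| ≤ (C ^ 2 * η ^ 2 + 3 * η ^ 2) * |a| := by gcongr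
  have hapos : 0 < |a| := hη.trans hcon
  have h6 : |a| * |a| ≤ |a| * (4 * (C ^ 2 + 3 + (2 + Λ * C ^ 2)) * η * η) := by
    have : 0 ≤ Λ * C ^ 2 * η ^ 2 * |a| := by positivity
    have e : a ^ 2 = |a| * |a| := by rw [← pow_two, sq_abs]
    have h7 : 0 ≤ a ^ 2 := sq_nonneg a
    nlinarith
  have h8 := le_of_mul_le_mul_left h6 hapos
  have h9 : 4 * (C ^ 2 + 3 + (2 + Λ * C ^ 2)) * η * η ≤ 1 * η := by gcongr
  linarith

lemma abs_le_of_half_sq_le {a θ C C' : ℝ} (hθ : 0 < θ) (hC : 0 ≤ C) (hC' : 0 ≤ C')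
    (h : a ^ 2 / 2 ≤ C * θ * |a| + C' * θ ^ 2) : |a| ≤ (2 * C + 2 * C' + 1) * θ := by
  by_contra hcon
  push Not at hcon
  have h1 : θ ≤ |a| := by
    have : 0 ≤ (2 * C + 2 * C') * θ := by positivity
    linarith
  have h2 : C' * θ ^ 2 ≤ C' * θ * |a| := by
    calc C' * θ ^ 2 = C' * θ * θ := by ring
      _ ≤ _ := by gcongr
  have e : a ^ 2 = |a| * |a| := by rw [← pow_two, sq_abs]
  have h3 : |a| * |a| ≤ |a| * ((2 * C + 2 * C') * θ) := by nlinarith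
  have h4 := le_of_mul_le_mul_left h3 (hθ.trans_le h1)
  linarith

end

/-! ### Small smoothing: good and bad local maximizers -/

section

variable {n : ℕ} {Λ c K q l t : ℝ} {v : Vec n} {A : Tensor n} {x : Vec n}

/-- A threshold for `log n`, and for `n^{1/4} / log n`, past which every local maximizer at small
smoothing is good or bad. -/
def smallSmoothingThreshold (Λ c K : ℝ) : ℝ :=
  4 + Λ + 4 * Λ * (K + 12) / c + 2 * K ^ 2
    + 6 * K * (12 * Λ * (72 * Λ / c) ^ 2 + 216 * (72 * Λ / c) ^ 3 + 18 * (72 * Λ / c))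
    + 4 * ((Λ + K) ^ 2 + 3 + (2 + Λ * (Λ + K) ^ 2)) + K

/-- The implied constant of the dichotomy between good and bad local maximizers. -/
def smallSmoothingConst (Λ c K : ℝ) : ℝ :=
  4 + 2 * (72 * Λ / c) + (1 + (Λ + K)) + (1 + Λ * (1 + (Λ + K)) + (1 + (Λ + K)) ^ 2 + 3)
    + (2 * ((Λ + K) ^ 2 + 3) + 2 * (2 + K * (1 + (Λ + K)) ^ 2) + 1)

set_option maxHeartbeats 1000000 in
-- The value of `a = ⟨v, x⟩` separates the cases: `a ≥ 1 / 2` gives a good point, and otherwise `a`,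
-- like `x⊥`, is `O(1/(q l))`, while the Hessian supplies the matching lower bound on the norm.
theorem NoiseBounds.good_or_bad (h : NoiseBounds Λ c K q l v A) (hΛ : 0 < Λ) (hK : 0 < K)
    (hc : 0 < c) (hl : smallSmoothingThreshold Λ c K < l)
    (hlq : smallSmoothingThreshold Λ c K * l < q) (ht : t ^ 2 * (q ^ 8 * l ^ 4) ≤ 1)
    (hx : IsLocalMax (smoothed v A t) x) :
    IsGood (smallSmoothingConst Λ c K) v x ∨
      (1 / smallSmoothingConst Λ c K * (1 / (q * l)) ≤ ‖x‖ ∧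
        ‖x‖ ≤ smallSmoothingConst Λ c K * (1 / (q * l)) ∧
        inner ℝ v x ≤ smallSmoothingConst Λ c K * (1 / (q ^ 2 * l)) ∧
        (|inner ℝ (delta A x) v| ≤ K * q * ‖x‖ ^ 2 →
          |inner ℝ v x| ≤ smallSmoothingConst Λ c K * (1 / (q ^ 2 * l)))) := by
  set M := smallSmoothingConst Λ c K with hM
  set B := smallSmoothingThreshold Λ c K with hB
  set D := 72 * Λ / c with hD
  set C := Λ + K with hC
  have hDpos : 0 < D := by positivity
  have hCpos : 0 < C := by positivity
  have hBs : 4 ≤ B ∧ Λ ≤ B ∧ 4 * Λ * (K + 12) / c ≤ B ∧ 2 * K ^ 2 ≤ B ∧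
      6 * K * (12 * Λ * D ^ 2 + 216 * D ^ 3 + 18 * D) ≤ B ∧
      4 * (C ^ 2 + 3 + (2 + Λ * C ^ 2)) ≤ B ∧ K ≤ B := by
    have p1 : 0 < 4 * Λ * (K + 12) / c := by positivity
    have p2 : 0 < 6 * K * (12 * Λ * D ^ 2 + 216 * D ^ 3 + 18 * D) := by positivity
    have p3 : 0 < 4 * (C ^ 2 + 3 + (2 + Λ * C ^ 2)) := by positivity
    have p4 : 0 < 2 * K ^ 2 := by positivity
    rw [hB, smallSmoothingThreshold, ← hD, ← hC]
    refine ⟨?_, ?_, ?_, ?_, ?_, ?_, ?_⟩ <;> linarith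
  obtain ⟨b1, b2, b3, b4, b5, b6, b7⟩ := hBs
  have hMs : 4 ≤ M ∧ 2 * D ≤ M ∧ 1 + C ≤ M ∧ 1 + Λ * (1 + C) + (1 + C) ^ 2 + 3 ≤ M ∧
      2 * (C ^ 2 + 3) + 2 * (2 + K * (1 + C) ^ 2) + 1 ≤ M := by
    have p1 : 0 < 1 + Λ * (1 + C) + (1 + C) ^ 2 + 3 := by positivity
    have p2 : 0 < 2 * (C ^ 2 + 3) + 2 * (2 + K * (1 + C) ^ 2) + 1 := by positivity
    rw [hM, smallSmoothingConst, ← hD, ← hC]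
    refine ⟨?_, ?_, ?_, ?_, ?_⟩ <;> linarith
  obtain ⟨m1, m2, m3, m4, m5⟩ := hMs
  clear_value M B D C
  have hl1 : 1 ≤ l := by linarith only [b1, hl]
  have hBq : B < q := by nlinarith only [hl1, hlq, b1]
  have hlq' : l ≤ q := by nlinarith only [hl1, hlq, b1]
  have hq1 : 1 ≤ q := by linarith only [hBq, b1]
  have hv := h.norm_v
  have hτ := h.tau_pos hq1 hl1
  have hg := grad_eq_zero_of_isLocalMax hx
  have hlow := h.le_norm_of_isLocalMax hΛ hK hc hq1 hl1 hlq'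
    (by rw [div_le_iff₀ hc] at b3; nlinarith only [b3, hBq, hc])
    (by nlinarith only [b4, hlq, hl1]) (by linarith only [b2, hBq]) ht
    (by rw [← hD]; linarith only [b5, hl]) hx
  rw [← hD] at hlow
  have hp := h.norm_perp_le hΛ hK hq1 hl1 hg
  rw [← hC] at hp
  have hin := inner_grad hv hg
  have hH := hess_nonpos_of_isLocalMax hx v
  have hr2 := norm_sq_eq_perp hv x
  have hr1 := norm_le_abs_inner_add_perp hv x
  -- `η` is the scale of the norm of bad points and `θ` the scale of their correlation with `v`.
  -- Second order quantities are `O(η²)`, and `η² ≤ θ`.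
  set η : ℝ := 1 / (q * l) with hη
  set θ : ℝ := 1 / (q ^ 2 * l) with hθ
  set s : ℝ := (n + 2) * t ^ 2 with hs
  set a : ℝ := inner ℝ v x with ha
  set p : ℝ := ‖perp v x‖ with hpdef
  set r : ℝ := ‖x‖ with hr
  have hqlpos : 0 < q * l := by positivity
  have hηpos : 0 < η := by positivity
  have hθpos : 0 < θ := by positivity
  have hp0 : 0 ≤ p := norm_nonneg _
  have hr0 : 0 ≤ r := norm_nonneg _
  have hs0 : 0 ≤ s := by positivity
  have hpη : p ≤ C * η := by rw [hη, mul_one_div]; exact hp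
  have hBη : B * η ≤ 1 := by
    rw [hη, mul_one_div, div_le_one hqlpos]; nlinarith only [hlq, hBq, hl1, hq1, b1]
  have hη1 : η ≤ 1 := by nlinarith only [hBη, b1, hηpos]
  have hηθ : η ^ 2 ≤ θ := by
    rw [hη, hθ, div_pow, one_pow]
    apply one_div_le_one_div_of_le (by positivity)
    rw [mul_pow]; gcongr; nlinarith only [hl1]
  have ht3 : t ^ 2 ≤ η ^ 3 := by
    rw [hη, div_pow, one_pow, le_div_iff₀ (by positivity)]
    refine le_trans ?_ ht
    gcongr
    calc (q * l) ^ 3 = q ^ 3 * l ^ 3 := by ring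
      _ ≤ q ^ 8 * l ^ 4 := mul_le_mul (pow_le_pow_right₀ hq1 (by norm_num))
          (pow_le_pow_right₀ hl1 (by norm_num)) (by positivity) (by positivity)
  have htθ : t ^ 2 ≤ θ ^ 2 := by
    rw [hθ, div_pow, one_pow, le_div_iff₀ (by positivity)]
    refine le_trans ?_ ht
    gcongr
    calc (q ^ 2 * l) ^ 2 = q ^ 4 * l ^ 2 := by ring
      _ ≤ q ^ 8 * l ^ 4 := mul_le_mul (pow_le_pow_right₀ hq1 (by norm_num))
          (pow_le_pow_right₀ hl1 (by norm_num)) (by positivity) (by positivity)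
  have hsη : s ≤ 3 * η ^ 2 := by
    have e1 : s ≤ 3 * (q ^ 4 * t ^ 2) := by
      have : (1 : ℝ) ≤ q ^ 4 := one_le_pow₀ hq1
      rw [hs, ← h.q_pow]
      nlinarith only [this, sq_nonneg t]
    have e2 : q ^ 4 * t ^ 2 ≤ η ^ 2 := by
      rw [hη, div_pow, one_pow, le_div_iff₀ (by positivity)]
      refine le_trans ?_ ht
      calc q ^ 4 * t ^ 2 * (q * l) ^ 2 = t ^ 2 * (q ^ 6 * l ^ 2) := by ring
        _ ≤ t ^ 2 * (q ^ 8 * l ^ 4) := mul_le_mul_of_nonneg_left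
          (mul_le_mul (pow_le_pow_right₀ hq1 (by norm_num))
            (pow_le_pow_right₀ hl1 (by norm_num)) (by positivity) (by positivity)) (sq_nonneg t)
    linarith only [e1, e2]
  -- Noise and smoothing drift along `v`, divided by `3τ`; the stationarity equation becomes the
  -- scalar relation `hrel`.
  set e : ℝ := inner ℝ (contr A x x) v / 2 / (3 * tau n) with he
  set w : ℝ := t ^ 2 * (1 + inner ℝ (traceVec A) v / (3 * tau n)) with hw
  have hrel : a ^ 2 + e + w = (a ^ 2 + p ^ 2 + s) * a := by
    rw [← hr2, he, hw]
    field_simp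
    linarith only [hin]
  have hwle : |w| ≤ 2 * t ^ 2 := by
    have e1 : |inner ℝ (traceVec A) v / (3 * tau n)| ≤ 1 := by
      rw [abs_div, abs_of_pos (by positivity : 0 < 3 * tau n), div_le_one (by positivity),
        h.tau_eq]
      refine h.abs_inner_trace_le.trans ?_
      have : K * (q ^ 2 * l) ≤ q * (q ^ 2 * l) := by gcongr; linarith only [b7, hBq]
      have : 0 ≤ q ^ 3 * l := by positivity
      nlinarith only [this, ‹K * (q ^ 2 * l) ≤ q * (q ^ 2 * l)›]
    rw [hw, abs_mul, abs_of_nonneg (sq_nonneg t), mul_comm 2]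
    gcongr
    refine (abs_add_le _ _).trans ?_
    rw [abs_one]; linarith only [e1]
  have hΛη : Λ * η ≤ 1 := le_trans (by gcongr) hBη
  have hele : |e| ≤ Λ * η * (a ^ 2 + p ^ 2) / 6 := by
    rw [he, abs_div, abs_div, abs_of_pos (by positivity : 0 < 3 * tau n), abs_two, ← hr2]
    have e1 := (abs_real_inner_le_norm (contr A x x) v).trans
        (mul_le_mul_of_nonneg_right (h.norm_contr_le x x) (norm_nonneg v))
    rw [hv, mul_one] at e1
    rw [div_le_iff₀ (by positivity), h.tau_eq]
    have e2 : Λ * η * r ^ 2 / 6 * (3 * (q ^ 3 * l)) = Λ * q ^ 2 * r * r / 2 := by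
      rw [hη]; field_simp; ring
    rw [e2]; linarith only [e1]
  have hp12 : p ≤ 1 / 2 := by
    have : 4 * (C * η) ≤ B * η := by
      have : 4 * C ≤ B := by nlinarith only [b6, hCpos, sq_nonneg (C - 1), mul_pos hΛ (pow_pos hCpos 2)]
      nlinarith only [this, hηpos]
    linarith only [this, hpη, hBη]
  rcases le_or_gt (1 / 2) a with ha2 | ha2
  · left
    have h4η : 4 * η ≤ 1 := le_trans (by gcongr) hBη
    have ha3 := le_of_cubic_relation hηpos h4η hΛη hp0 hp12 hs0
      ((le_abs_self w).trans (hwle.trans (by gcongr))) hele ha2 hrel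
    have ha4 : a ≤ r := (le_abs_self a).trans (abs_inner_le_norm_of_unit hv x)
    have hM2 : 1 / M ≤ 1 / 2 := one_div_le_one_div_of_le (by norm_num) (by linarith only [m1])
    rw [abs_of_pos (by linarith only [ha2])] at hr1
    refine ⟨?_, ?_, ?_, ?_⟩ <;> simp only [← hr, ← ha] <;> linarith only [ha2, ha3, ha4, hM2, hr1, hp12, m1]
  · right
    have haη := abs_le_of_cubic_relation hηpos hΛ hCpos hΛη hp0 hpη hs0 hsη
      (hwle.trans (by gcongr)) hele (le_trans (by gcongr) hBη) ha2 hrel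
    have hrη : r ≤ (1 + C) * η := by linarith only [hr1, haη, hpη]
    have hr2η : r ^ 2 ≤ (1 + C) ^ 2 * η ^ 2 := by rw [← mul_pow]; gcongr
    refine ⟨?_, ?_, ?_, ?_⟩
    · refine le_trans ?_ hlow
      rw [hη, one_div_mul_one_div]
      apply one_div_le_one_div_of_le (by positivity)
      gcongr
    · exact hrη.trans (by gcongr)
    -- The second order condition along `v` reads `6τ a ≤ 6τ a² +` noise `+` penalty, with right
    -- side `O(τ η²)`. It bounds `a` from above only, but needs no regularity of the noise.
    · rw [hess_apply] at hH
      simp only [inner_sub_left, inner_add_left, inner_smul_left, conj_trivial,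
        real_inner_self_eq_norm_sq, hv, real_inner_comm v x] at hH
      rw [← ha, ← hr, ← hs] at hH
      have e1 : |inner ℝ (contr A x v) v| ≤ Λ * q ^ 2 * r := by
        have := (abs_real_inner_le_norm (contr A x v) v).trans
          (mul_le_mul_of_nonneg_right (h.norm_contr_le x v) (norm_nonneg v))
        rwa [hv, mul_one, mul_one] at this
      have e2 := neg_abs_le (inner ℝ (contr A x v) v : ℝ)
      have e3 : Λ * q ^ 2 * r = tau n * (Λ * (η * r)) := by
        rw [h.tau_eq, hη]; field_simp
      have e4 : tau n * (6 * a) ≤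
          tau n * (6 * a ^ 2 + Λ * (η * r) + 3 * (r ^ 2 + s)) := by
        have ha' : (inner ℝ x v : ℝ) = a := real_inner_comm _ _
        rw [e3] at e1
        nlinarith only [hH, e1, e2, ha']
      have e5 := le_of_mul_le_mul_left e4 hτ
      have e6 : a ^ 2 ≤ η ^ 2 := by rw [← sq_abs]; gcongr
      have e7 : Λ * (η * r) ≤ Λ * (1 + C) * η ^ 2 := by
        calc Λ * (η * r) ≤ Λ * (η * ((1 + C) * η)) := by gcongr
          _ = _ := by ring
      have e8 : 0 ≤ Λ * (1 + C) * η ^ 2 := by positivity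
      have e9 : 0 ≤ (1 + C) ^ 2 * η ^ 2 := by positivity
      calc a ≤ (1 + Λ * (1 + C) + (1 + C) ^ 2 + 3) * η ^ 2 := by nlinarith only [e5, e6, e7, hr2η, hsη, e8, e9]
        _ ≤ M * θ := by gcongr
    -- Regularity replaces the operator bound `Λ q²` for the noise along `v` by `K q`. This gain
    -- makes `e` of size `O(θ²)` instead of `O(η³)`, and the quadratic inequality for `a` then gives
    -- `O(θ)` on both sides.
    · intro hreg
      have e1 : |e| ≤ K * (1 + C) ^ 2 * θ ^ 2 := by
        have e2 : inner ℝ (contr A x x) v / 2 = inner ℝ (delta A x) v := by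
          rw [delta_eq, inner_smul_left]; simp; ring
        rw [he, e2, abs_div, abs_of_pos (by positivity : 0 < 3 * tau n)]
        calc |inner ℝ (delta A x) v| / (3 * tau n) ≤ K * q * r ^ 2 / (3 * tau n) := by gcongr
          _ = K * r ^ 2 * θ / 3 := by rw [h.tau_eq, hθ]; field_simp
          _ ≤ K * ((1 + C) ^ 2 * θ) * θ / 3 := by
            have : r ^ 2 ≤ (1 + C) ^ 2 * θ := hr2η.trans (by gcongr)
            gcongr
          _ ≤ K * ((1 + C) ^ 2 * θ) * θ := div_le_self (by positivity) (by norm_num)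
          _ = _ := by ring
      have h1 := half_sq_le_of_cubic_relation hs0 ha2 hrel
      have e3 : (p ^ 2 + s) * |a| ≤ (C ^ 2 + 3) * θ * |a| := by
        have e4 : p ^ 2 ≤ C ^ 2 * η ^ 2 := by rw [← mul_pow]; gcongr
        have e5 : p ^ 2 + s ≤ (C ^ 2 + 3) * η ^ 2 := by linarith only [e4, hsη]
        have : p ^ 2 + s ≤ (C ^ 2 + 3) * θ := e5.trans (by gcongr)
        gcongr
      have h2 : a ^ 2 / 2 ≤ (C ^ 2 + 3) * θ * |a| + (2 + K * (1 + C) ^ 2) * θ ^ 2 := by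
        nlinarith only [h1, e1, e3, hwle, htθ]
      exact (abs_le_of_half_sq_le hθpos (by positivity) (by positivity) h2).trans (by gcongr)

end

/-! ### The top eigenvector of the Hessian at `x†` -/

section

variable {n : ℕ} {Λ c K q l t : ℝ} {v : Vec n} {A : Tensor n} {x : Vec n}

lemma hess_isSymmetric (v : Vec n) (A : Tensor n) (t : ℝ) (x : Vec n) :
    (hess v A t x).IsSymmetric := by
  intro y z
  rw [hess_apply, hess_apply]
  simp only [inner_sub_left, inner_sub_right, inner_add_left, inner_add_right, inner_smul_left,
    inner_smul_right, conj_trivial]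
  rw [inner_contr_swap A x y z, real_inner_comm v y, real_inner_comm y x]
  ring

/-- The Rayleigh quotients of a symmetric operator are at most its largest eigenvalue. -/
lemma inner_le_of_forall_hasEigenvalue_le {T : Vec n →ₗ[ℝ] Vec n} (hT : T.IsSymmetric) {μ : ℝ}
    (hμ : ∀ μ' : ℝ, Module.End.HasEigenvalue T μ' → μ' ≤ μ) (y : Vec n) :
    inner ℝ (T y) y ≤ μ * ‖y‖ ^ 2 := by
  have hn : Module.finrank ℝ (Vec n) = n := by simp
  set b := hT.eigenvectorBasis hn with hb
  have h1 : inner ℝ (T y) y = ∑ i, hT.eigenvalues hn i * inner ℝ (b i) y ^ 2 := by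
    rw [← b.sum_inner_mul_inner]
    refine Finset.sum_congr rfl fun i _ => ?_
    rw [hT y (b i), hb, hT.apply_eigenvectorBasis hn i, inner_smul_right, real_inner_comm y]
    simp; ring
  rw [h1, ← b.sum_sq_inner_right, Finset.mul_sum]
  refine Finset.sum_le_sum fun i _ => ?_
  exact mul_le_mul_of_nonneg_right (hμ _ (hT.hasEigenvalue_eigenvalues hn i)) (sq_nonneg _)

lemma sin_angle_mul_norm {v : Vec n} (hv : ‖v‖ = 1) (b : Vec n) :
    Real.sin (InnerProductGeometry.angle b v) * ‖b‖ = ‖perp v b‖ := by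
  have h := InnerProductGeometry.sin_angle_mul_norm_mul_norm b v
  rw [hv, mul_one] at h
  rw [h, real_inner_self_eq_norm_sq, real_inner_self_eq_norm_sq, hv, real_inner_comm,
    norm_sq_eq_perp hv b]
  rw [show (inner ℝ v b ^ 2 + ‖perp v b‖ ^ 2) * 1 ^ 2 - inner ℝ v b * inner ℝ v b
    = ‖perp v b‖ ^ 2 by ring, Real.sqrt_sq (norm_nonneg _)]

/-- A top eigenvector is close to a unit vector `v` when `T v` is nearly parallel to `v` and the
Rayleigh quotient at `v` exceeds those on the complement of `v` by a gap. -/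
lemma sin_angle_le_of_gap {T : Vec n →ₗ[ℝ] Vec n} (hT : T.IsSymmetric) {v b : Vec n}
    (hv : ‖v‖ = 1) (hb : IsTopEigenvector T b) {gap lam ρ : ℝ} (hgap : 0 < gap)
    (h1 : lam + gap ≤ inner ℝ (T v) v) (hρ : 0 < ρ)
    (h2 : ∀ y, inner ℝ v y = 0 → inner ℝ (T y) y ≤ lam * ‖y‖ ^ 2)
    (h3 : ρ * ‖perp v (T v)‖ ≤ gap) :
    Real.sin (InnerProductGeometry.angle b v) ≤ 1 / ρ := by
  obtain ⟨μ, hμ, hmax⟩ := hb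
  have hb0 : 0 < ‖b‖ := norm_pos_iff.2 hμ.2
  have hTb : T b = μ • b := hμ.apply_eq_smul
  have hμv := inner_le_of_forall_hasEigenvalue_le hT hmax v
  rw [hv] at hμv
  have hperp := inner_perp hv b
  set p := perp v b with hp
  have hdec : b = (inner ℝ v b : ℝ) • v + p := by simp [hp, perp]
  -- `⟨T b, p⟩` is computed from the eigenvalue equation and from the splitting of `b` along `v`.
  -- Thus `μ ‖p‖²` is a cross term plus `⟨T p, p⟩`, while `μ ≥ ⟨T v, v⟩ ≥ lam + gap`.
  have e1 : inner ℝ (T b) p = μ * ‖p‖ ^ 2 := by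
    rw [hTb, inner_smul_left, hdec, inner_add_left, inner_smul_left, hperp,
      real_inner_self_eq_norm_sq]
    simp
  have e2 : inner ℝ (T b) p = inner ℝ v b * inner ℝ (perp v (T v)) p + inner ℝ (T p) p := by
    conv_lhs => rw [hdec]
    rw [map_add, map_smul, inner_add_left, inner_smul_left, perp, inner_sub_left,
      inner_smul_left, hperp]
    simp
  have e3 := h2 p hperp
  have e4 : |inner ℝ v b * inner ℝ (perp v (T v)) p| ≤ ‖b‖ * (‖perp v (T v)‖ * ‖p‖) := by
    rw [abs_mul]
    exact mul_le_mul (abs_inner_le_norm_of_unit hv b) (abs_real_inner_le_norm _ _)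
      (abs_nonneg _) (norm_nonneg _)
  have e5 : gap * ‖p‖ ^ 2 ≤ ‖b‖ * (‖perp v (T v)‖ * ‖p‖) := by
    have := le_abs_self (inner ℝ v b * inner ℝ (perp v (T v)) p)
    nlinarith [sq_nonneg ‖p‖]
  have e6 : ρ * ‖p‖ ≤ ‖b‖ := by
    rcases (norm_nonneg p).eq_or_lt with h0 | h0
    · rw [← h0]; simp
    · have e7 : gap * ‖p‖ ≤ ‖b‖ * ‖perp v (T v)‖ := by
        refine le_of_mul_le_mul_right ?_ h0
        nlinarith
      have e8 : gap * (ρ * ‖p‖) ≤ gap * ‖b‖ := by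
        calc gap * (ρ * ‖p‖) = ρ * (gap * ‖p‖) := by ring
          _ ≤ ρ * (‖b‖ * ‖perp v (T v)‖) := by gcongr
          _ = ‖b‖ * (ρ * ‖perp v (T v)‖) := by ring
          _ ≤ ‖b‖ * gap := by gcongr
          _ = _ := by ring
      exact le_of_mul_le_mul_left e8 hgap
  have e9 := sin_angle_mul_norm hv b
  rw [← hp] at e9
  rw [le_div_iff₀ hρ]
  refine le_of_mul_le_mul_right ?_ hb0
  calc Real.sin (InnerProductGeometry.angle b v) * ρ * ‖b‖
      = ρ * (Real.sin (InnerProductGeometry.angle b v) * ‖b‖) := by ring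
    _ ≤ 1 * ‖b‖ := by rw [e9]; linarith

lemma NoiseBounds.inner_xDagger (h : NoiseBounds Λ c K q l v A) :
    inner ℝ v (xDagger v A)
      = (3 * tau n * ((n : ℝ) + 2))⁻¹ * (3 * tau n + inner ℝ (traceVec A) v) := by
  rw [xDagger, inner_smul_right, inner_add_right, inner_smul_right, real_inner_self_eq_norm_sq,
    h.norm_v, real_inner_comm]
  simp

lemma NoiseBounds.norm_xDagger_le (h : NoiseBounds Λ c K q l v A) (hq : 1 ≤ q) (hl : 1 ≤ l) :
    ‖xDagger v A‖ ≤ (3 * tau n * ((n : ℝ) + 2))⁻¹ * (3 * tau n + K * q ^ 4) := by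
  have hτ := h.tau_pos hq hl
  rw [xDagger, norm_smul, Real.norm_of_nonneg (by positivity)]
  gcongr
  refine (norm_add_le _ _).trans (add_le_add ?_ h.norm_trace_le)
  rw [norm_smul, h.norm_v, Real.norm_of_nonneg (by positivity), mul_one]

lemma NoiseBounds.norm_perp_xDagger_le (h : NoiseBounds Λ c K q l v A) (hq : 1 ≤ q)
    (hl : 1 ≤ l) :
    ‖perp v (xDagger v A)‖ ≤ (3 * tau n * ((n : ℝ) + 2))⁻¹ * (K * q ^ 4) := by
  have hτ := h.tau_pos hq hl
  rw [xDagger, perp_smul, norm_smul, Real.norm_of_nonneg (by positivity), perp_add, perp_smul,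
    perp_self h.norm_v, smul_zero, zero_add]
  gcongr
  exact (TensorPCA.norm_perp_le h.norm_v _).trans h.norm_trace_le

lemma NoiseBounds.norm_perp_contr_xDagger_le (h : NoiseBounds Λ c K q l v A) (hq : 1 ≤ q)
    (hl : 1 ≤ l) :
    ‖perp v (contr A (xDagger v A) v)‖
      ≤ (3 * tau n * ((n : ℝ) + 2))⁻¹ * (3 * tau n * (Λ * q ^ 2) + 16 * q ^ 6) := by
  have hτ := h.tau_pos hq hl
  rw [contr_comm, xDagger, map_smul, map_add, map_smul, perp_smul, norm_smul,
    Real.norm_of_nonneg (by positivity), perp_add, perp_smul]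
  gcongr
  refine (norm_add_le _ _).trans (add_le_add ?_ h.norm_perp_contr_le)
  rw [norm_smul, Real.norm_of_nonneg (by positivity)]
  gcongr
  refine (TensorPCA.norm_perp_le h.norm_v _).trans ?_
  simpa [h.norm_v] using h.norm_contr_le v v

/-- A threshold for `log n` and `n^{1/4} / log n` past which the top eigenvector is close to the
signal. -/
def eigenvectorThreshold (Λ K : ℝ) : ℝ := 8 + 24 * K + 24 * Λ + 8 * Λ * K

/-- This is the gap condition multiplied by `3τ (n + 2)`. The right side has leading term `18 τ² =
18 q⁶ l²`, the left side `16 q⁶ l²`, and the remaining terms together stay below `2 q⁶ l²`. Hence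
the constant `16` in `NoiseBounds` must lie below `18`, and an operator norm bound with unspecified
constant would not do. -/
lemma gap_numeric {τ : ℝ} (hΛ : 0 < Λ) (hK : 0 < K)
    (hl : eigenvectorThreshold Λ K < l) (hlq : eigenvectorThreshold Λ K * l < q)
    (hτ : τ = q ^ 3 * l) :
    l ^ 2 * (3 * τ * (Λ * q ^ 2) + 16 * q ^ 6 + 12 * τ * K) + 1 ≤
      6 * τ * (3 * τ - K * (q ^ 2 * l)) - 2 * (Λ * q ^ 2) * (3 * τ + K * q ^ 4)
        - 12 * τ * (4 * τ) / q ^ 4 := by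
  have hB : 8 ≤ eigenvectorThreshold Λ K ∧ 24 * K ≤ eigenvectorThreshold Λ K ∧
      24 * Λ ≤ eigenvectorThreshold Λ K ∧ 8 * Λ * K ≤ eigenvectorThreshold Λ K := by
    have : 0 < Λ * K := by positivity
    rw [eigenvectorThreshold]
    refine ⟨?_, ?_, ?_, ?_⟩ <;> nlinarith
  obtain ⟨b1, b2, b3, b4⟩ := hB
  set B := eigenvectorThreshold Λ K
  clear_value B
  have hl8 : 8 < l := by linarith
  have hq8 : 8 * l < q := by nlinarith
  have hq1 : 1 < q := by linarith
  have hK' : 24 * K * l ≤ q := by nlinarith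
  have hΛ' : 24 * Λ * l ≤ q := by nlinarith
  have hΛK : 8 * (Λ * K) ≤ l ^ 2 := by nlinarith
  subst hτ
  have t0 : 12 * (q ^ 3 * l) * (4 * (q ^ 3 * l)) / q ^ 4 = 48 * (q ^ 2 * l ^ 2) := by
    field_simp; ring
  rw [t0]
  have hq5 : 0 < q ^ 5 * l ^ 2 := by positivity
  have t1 : 24 * (K * (q ^ 5 * l ^ 2)) ≤ q ^ 6 * l ^ 2 := by
    have : 24 * K ≤ q := by nlinarith
    nlinarith
  have t2 : 24 * (Λ * (q ^ 5 * l)) ≤ q ^ 6 * l ^ 2 := by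
    have : 24 * Λ ≤ q * l := by nlinarith
    have h5 : 0 < q ^ 5 * l := by positivity
    nlinarith
  have t3 : 8 * (Λ * K * q ^ 6) ≤ q ^ 6 * l ^ 2 := by
    have h5 : 0 < q ^ 6 := by positivity
    nlinarith
  have t4 : 24 * (Λ * (q ^ 5 * l ^ 3)) ≤ q ^ 6 * l ^ 2 := by nlinarith
  have hq2 : 1 ≤ q ^ 2 := one_le_pow₀ hq1.le
  have t5 : 24 * (K * (q ^ 3 * l ^ 3)) ≤ q ^ 6 * l ^ 2 := by
    have h5 : q ^ 3 * l ^ 3 ≤ q ^ 5 * l ^ 3 := by gcongr <;> first | exact hq1.le | norm_num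
    have h6 : 24 * (K * (q ^ 5 * l ^ 3)) ≤ q ^ 6 * l ^ 2 := by nlinarith
    have : K * (q ^ 3 * l ^ 3) ≤ K * (q ^ 5 * l ^ 3) := by gcongr
    linarith
  have t6 : 512 * (q ^ 2 * l ^ 2) ≤ q ^ 6 * l ^ 2 := by
    have h5 : 64 ≤ q := by linarith
    have h6 : (64 : ℝ) ^ 4 ≤ q ^ 4 := by gcongr
    have h7 : 0 < q ^ 2 * l ^ 2 := by positivity
    nlinarith
  have t7 : 8 ≤ q ^ 6 * l ^ 2 := by
    have : (1:ℝ) ≤ q ^ 6 := one_le_pow₀ hq1.le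
    nlinarith
  linarith

/-- Since `⟨v, x†⟩` is about `1/n`, the signal curvature is about `6 l / q`, whereas the noise
matrix at `x†` has norm `O(1/(q l))`. -/
theorem NoiseBounds.sin_angle_le (h : NoiseBounds Λ c K q l v A) (hΛ : 0 < Λ) (hK : 0 < K)
    (hl : eigenvectorThreshold Λ K < l) (hlq : eigenvectorThreshold Λ K * l < q) {b : Vec n}
    (hb : IsTopEigenvector (hess v A t (xDagger v A)) b) :
    Real.sin (InnerProductGeometry.angle b v) ≤ 1 / l ^ 2 := by
  have hv := h.norm_v
  have hB : 8 + 24 * K ≤ eigenvectorThreshold Λ K := by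
    have : 0 < Λ * K := by positivity
    rw [eigenvectorThreshold]; nlinarith
  have hl1 : 1 ≤ l := by linarith
  have hqK : 8 + 24 * K ≤ q := by nlinarith
  have hq1 : 1 ≤ q := by linarith
  have hτ := h.tau_pos hq1 hl1
  have hnum := gap_numeric hΛ hK hl hlq h.tau_eq
  set X := xDagger v A with hX
  set τ := tau n with hτdef
  set D : ℝ := 3 * τ * ((n : ℝ) + 2) with hD
  have hDpos : 0 < D := by positivity
  have ha := h.inner_xDagger
  have hR := h.norm_xDagger_le hq1 hl1
  have hpX := h.norm_perp_xDagger_le hq1 hl1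
  have hpc := h.norm_perp_contr_xDagger_le hq1 hl1
  rw [← hX, ← hτdef, ← hD] at ha hR hpX hpc
  set a : ℝ := inner ℝ v X with hadef
  have huv := h.abs_inner_trace_le
  have hDa : D * a = 3 * τ + inner ℝ (traceVec A) v := by rw [ha]; field_simp
  have hKτ : K * (q ^ 2 * l) ≤ τ := by
    rw [hτdef, h.tau_eq]
    have : 0 < q ^ 2 * l := by positivity
    nlinarith only [this, hqK, hK]
  have hDa1 : 3 * τ - K * (q ^ 2 * l) ≤ D * a := by
    linarith only [hDa, neg_abs_le (inner ℝ (traceVec A) v : ℝ), huv]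
  have hDa2 : D * a ≤ 4 * τ := by
    linarith only [hDa, le_abs_self (inner ℝ (traceVec A) v : ℝ), huv, hKτ]
  have ha0 : 0 ≤ a := by
    refine le_of_mul_le_mul_left ?_ hDpos
    linarith only [hDa1, hKτ, hτ]
  have ha2 : a ≤ 2 / q ^ 4 := by
    rw [le_div_iff₀ (by positivity)]
    have : D * (a * q ^ 4) ≤ D * 2 := by
      have e : D = 3 * τ * (q ^ 4 + 2) := by rw [hD, h.q_pow]
      have e2 : D * a * q ^ 4 ≤ 4 * τ * q ^ 4 := by gcongr
      have e3 : 0 < τ * q ^ 4 := by positivity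
      calc D * (a * q ^ 4) = D * a * q ^ 4 := by ring
        _ ≤ D * 2 := by rw [e] at e2 ⊢; nlinarith only [e2, e3, hτ]
    exact le_of_mul_le_mul_left this hDpos
  -- `lam` bounds the Rayleigh quotients orthogonal to `v`. The smoothing acts as a multiple of the
  -- identity, so `t` enters `lam` but not `gap`.
  set lam : ℝ := Λ * q ^ 2 * ‖X‖ - 3 * τ * (‖X‖ ^ 2 + (n + 2) * t ^ 2) with hlam
  set gap : ℝ := 6 * τ * a - 2 * (Λ * q ^ 2 * ‖X‖) - 6 * τ * a ^ 2 with hgap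
  have hDR : D * ‖X‖ ≤ 3 * τ + K * q ^ 4 := by
    calc D * ‖X‖ ≤ D * (D⁻¹ * (3 * τ + K * q ^ 4)) := by gcongr
      _ = _ := by field_simp
  have hDgap : 6 * τ * (3 * τ - K * (q ^ 2 * l)) - 2 * (Λ * q ^ 2) * (3 * τ + K * q ^ 4)
        - 12 * τ * (4 * τ) / q ^ 4 ≤ D * gap := by
    have e1 : 6 * τ * (3 * τ - K * (q ^ 2 * l)) ≤ 6 * τ * (D * a) := by gcongr
    have e2 : 2 * (Λ * q ^ 2) * (D * ‖X‖) ≤ 2 * (Λ * q ^ 2) * (3 * τ + K * q ^ 4) := by gcongr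
    have e3 : 6 * τ * (a * (D * a)) ≤ 6 * τ * (2 / q ^ 4 * (4 * τ)) := by
      have : 0 ≤ D * a := by positivity
      gcongr
    have e4 : 6 * τ * (2 / q ^ 4 * (4 * τ)) = 12 * τ * (4 * τ) / q ^ 4 := by ring
    rw [hgap]
    linarith only [e1, e2, e3, e4]
  have hperp : perp v (hess v A t X v) = perp v (contr A X v) - (6 * τ * a) • perp v X := by
    rw [hess_apply, perp_sub, perp_sub, perp_add, perp_smul, perp_smul, perp_smul,
      perp_self hv, real_inner_comm v X, ← hadef]
    module
  have hDperp : D * ‖perp v (hess v A t X v)‖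
      ≤ 3 * τ * (Λ * q ^ 2) + 16 * q ^ 6 + 12 * τ * K := by
    have e1 : ‖perp v (hess v A t X v)‖ ≤ ‖perp v (contr A X v)‖ + 6 * τ * a * ‖perp v X‖ := by
      rw [hperp]
      refine (norm_sub_le _ _).trans ?_
      rw [norm_smul, Real.norm_of_nonneg (by positivity)]
    have e2 : D * ‖perp v (contr A X v)‖ ≤ 3 * τ * (Λ * q ^ 2) + 16 * q ^ 6 := by
      calc _ ≤ D * (D⁻¹ * (3 * τ * (Λ * q ^ 2) + 16 * q ^ 6)) := by gcongr
        _ = _ := by field_simp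
    have e3 : D * ‖perp v X‖ ≤ K * q ^ 4 := by
      calc _ ≤ D * (D⁻¹ * (K * q ^ 4)) := by gcongr
        _ = _ := by field_simp
    have e4 : 6 * τ * a * (D * ‖perp v X‖) ≤ 6 * τ * (2 / q ^ 4) * (K * q ^ 4) := by gcongr
    have e5 : 6 * τ * (2 / q ^ 4) * (K * q ^ 4) = 12 * τ * K := by field_simp; ring
    have e6 : D * ‖perp v (hess v A t X v)‖
        ≤ D * (‖perp v (contr A X v)‖ + 6 * τ * a * ‖perp v X‖) := by gcongr
    linarith only [e2, e4, e5, e6]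
  have hDle : l ^ 2 * (D * ‖perp v (hess v A t X v)‖) + 1 ≤ D * gap := by
    have : l ^ 2 * (D * ‖perp v (hess v A t X v)‖)
        ≤ l ^ 2 * (3 * τ * (Λ * q ^ 2) + 16 * q ^ 6 + 12 * τ * K) := by gcongr
    linarith only [this, hnum, hDgap]
  have hgappos : 0 < gap := by
    have : 0 < D * gap := by
      have : 0 ≤ l ^ 2 * (D * ‖perp v (hess v A t X v)‖) := by positivity
      linarith only [this, hDle]
    exact (mul_pos_iff_of_pos_left hDpos).1 this
  have hcontr : ∀ y, |inner ℝ (contr A X y) y| ≤ Λ * q ^ 2 * ‖X‖ * ‖y‖ ^ 2 := by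
    intro y
    refine (abs_real_inner_le_norm _ _).trans ?_
    have := mul_le_mul_of_nonneg_right (h.norm_contr_le X y) (norm_nonneg y)
    linarith only [this]
  refine sin_angle_le_of_gap (hess_isSymmetric v A t X) hv hb (lam := lam) hgappos ?_
    (by positivity) ?_ ?_
  · have e1 := neg_abs_le (inner ℝ (contr A X v) v : ℝ)
    have e2 := hcontr v
    rw [hess_apply]
    simp only [inner_sub_left, inner_add_left, inner_smul_left, conj_trivial,
      real_inner_self_eq_norm_sq, hv, real_inner_comm v X]
    rw [← hadef]
    rw [hv] at e2
    rw [hlam, hgap]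
    linarith only [e1, e2]
  · intro y hy
    have e1 := le_abs_self (inner ℝ (contr A X y) y : ℝ)
    have e2 := hcontr y
    rw [hess_apply]
    simp only [inner_sub_left, inner_add_left, inner_smul_left, conj_trivial,
      real_inner_self_eq_norm_sq, hy]
    rw [hlam]
    have e3 : 0 ≤ 6 * τ * (inner ℝ X y * inner ℝ X y) := by
      have := mul_self_nonneg (inner ℝ X y : ℝ)
      positivity
    linarith only [e1, e2, e3]
  · refine le_of_mul_le_mul_left ?_ hDpos
    linarith only [hDle]

end

/-! ### The size of `x†` and continuation from infinite smoothing -/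

section

variable {n : ℕ} {Λ c K q l t : ℝ} {v : Vec n} {A : Tensor n} {x : Vec n}

lemma NoiseBounds.inner_xDagger_mem (h : NoiseBounds Λ c K q l v A) (hq : 1 ≤ q) (hl : 1 ≤ l)
    (hKq : K ≤ q) : 0 ≤ inner ℝ v (xDagger v A) ∧ inner ℝ v (xDagger v A) ≤ 2 / q ^ 4 := by
  have hτ := h.tau_pos hq hl
  have hu := h.abs_inner_trace_le
  have hKτ : K * (q ^ 2 * l) ≤ tau n := by
    rw [h.tau_eq]
    have : K * (q ^ 2 * l) ≤ q * (q ^ 2 * l) := by gcongr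
    linarith
  obtain ⟨h1, h2⟩ := abs_le.1 hu
  rw [h.inner_xDagger, inv_mul_eq_div]
  refine ⟨div_nonneg (by linarith) (by positivity), ?_⟩
  rw [div_le_div_iff₀ (by positivity) (by positivity), ← h.q_pow]
  have hq4 : 0 < tau n * q ^ 4 := by positivity
  calc (3 * tau n + inner ℝ (traceVec A) v) * q ^ 4 ≤ (4 * tau n) * q ^ 4 := by
        gcongr; linarith
    _ ≤ 2 * (3 * tau n * (q ^ 4 + 2)) := by linarith

lemma NoiseBounds.norm_xDagger_le_div (h : NoiseBounds Λ c K q l v A) (hK : 0 < K) (hq : 1 ≤ q)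
    (hl : 1 ≤ l) (hlq : l ≤ q) : ‖xDagger v A‖ ≤ (K + 1) / (q ^ 3 * l) := by
  have hτ := h.tau_pos hq hl
  refine (h.norm_xDagger_le hq hl).trans ?_
  rw [inv_mul_eq_div, div_le_div_iff₀ (by positivity) (by positivity), ← h.q_pow, ← h.tau_eq]
  have e : tau n ≤ q ^ 4 := by
    rw [h.tau_eq]
    calc q ^ 3 * l ≤ q ^ 3 * q := by gcongr
      _ = _ := by ring
  have h1 : 0 < tau n * (K * q ^ 4) := by positivity
  have h2 : tau n * tau n ≤ tau n * q ^ 4 := by gcongr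
  have h3 : 0 < tau n * K := by positivity
  nlinarith

/-- The part of `u` orthogonal to `v` alone already gives this length. -/
lemma NoiseBounds.le_norm_xDagger (h : NoiseBounds Λ c K q l v A) (hK : 0 < K) (hq : 1 ≤ q)
    (hl : 1 ≤ l) (hq2 : 2 * K ^ 2 * l ≤ q) : 1 / (18 * K * (q ^ 3 * l)) ≤ ‖xDagger v A‖ := by
  have hτ := h.tau_pos hq hl
  refine le_trans ?_ (TensorPCA.norm_perp_le h.norm_v _)
  have h1 := h.half_le_perp_trace hK hq hq2
  rw [xDagger, perp_smul, norm_smul, Real.norm_of_nonneg (by positivity), perp_add, perp_smul,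
    perp_self h.norm_v, smul_zero, zero_add, ← h.tau_eq]
  refine le_trans ?_ (mul_le_mul_of_nonneg_left h1 (by positivity))
  rw [inv_mul_eq_div, div_div, div_le_div_iff₀ (by positivity) (by positivity), ← h.q_pow]
  have e : (1 : ℝ) ≤ q ^ 4 := one_le_pow₀ hq
  have e2 : 0 < tau n * K := by positivity
  nlinarith

/-- The region around `x†` in which the maximizer of `g_r(·, t)` is followed. -/
def box (v X : Vec n) (ρ α : ℝ) : Set (Vec n) :=
  {x | ‖perp v (x - X)‖ ≤ ρ ∧ |inner ℝ v (x - X)| ≤ α}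

lemma continuous_perp_sub (v X : Vec n) : Continuous fun x : Vec n => perp v (x - X) := by
  unfold perp; fun_prop

lemma continuous_inner_sub (v X : Vec n) :
    Continuous fun x : Vec n => (inner ℝ v (x - X) : ℝ) := by
  fun_prop

lemma norm_sub_le_of_mem_box {X : Vec n} {ρ α : ℝ} (hv : ‖v‖ = 1) (hx : x ∈ box v X ρ α) :
    ‖x - X‖ ≤ α + ρ :=
  (norm_le_abs_inner_add_perp hv _).trans (add_le_add hx.2 hx.1)

lemma isCompact_box (hv : ‖v‖ = 1) (X : Vec n) (ρ α : ℝ) : IsCompact (box v X ρ α) := by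
  refine Metric.isCompact_of_isClosed_isBounded ?_ ?_
  · exact (isClosed_le (continuous_perp_sub v X).norm continuous_const).inter
      (isClosed_le (continuous_inner_sub v X).abs continuous_const)
  · refine (Metric.isBounded_closedBall (x := X) (r := α + ρ)).subset fun x hx => ?_
    rw [mem_closedBall_iff_norm]
    exact norm_sub_le_of_mem_box hv hx

lemma box_mem_nhds {X : Vec n} {ρ α : ℝ} (h1 : ‖perp v (x - X)‖ < ρ)
    (h2 : |inner ℝ v (x - X)| < α) : box v X ρ α ∈ 𝓝 x := by
  have e1 := (continuous_perp_sub v X).norm.continuousAt.eventually_lt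
    (continuousAt_const (y := ρ)) h1
  have e2 := (continuous_inner_sub v X).abs.continuousAt.eventually_lt
    (continuousAt_const (y := α)) h2
  filter_upwards [e1, e2] with y hy1 hy2 using ⟨hy1.le, hy2.le⟩

lemma midpoint_mem_box {X y : Vec n} {ρ α : ℝ} (hx : x ∈ box v X ρ α) (hy : y ∈ box v X ρ α) :
    (1 / 2 : ℝ) • (x + y) ∈ box v X ρ α := by
  have e : (1 / 2 : ℝ) • (x + y) - X = (1 / 2 : ℝ) • ((x - X) + (y - X)) := by module
  constructor
  · rw [e, perp_smul, perp_add, norm_smul, Real.norm_of_nonneg (by norm_num)]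
    have := (norm_add_le (perp v (x - X)) (perp v (y - X))).trans (add_le_add hx.1 hy.1)
    linarith
  · rw [e, inner_smul_right, inner_add_right, abs_mul, abs_of_nonneg (by norm_num)]
    have := (abs_add_le (inner ℝ v (x - X) : ℝ) (inner ℝ v (y - X))).trans (add_le_add hx.2 hy.2)
    linarith

lemma continuous_smoothed (v : Vec n) (A : Tensor n) :
    Continuous fun p : ℝ × Vec n => smoothed v A p.1 p.2 := by
  have h := (differentiable_inner_contr A).continuous.comp (continuous_snd (X := ℝ))
  unfold smoothed
  simp only [div_eq_mul_inv]
  have h' : Continuous fun p : ℝ × Vec n =>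
    (inner ℝ (contr A p.2 p.2) p.2 : ℝ) := h
  fun_prop

lemma continuous_grad (v : Vec n) (A : Tensor n) :
    Continuous fun p : ℝ × Vec n => grad v A p.1 p.2 := by
  have h : Continuous fun p : ℝ × Vec n => contr A p.2 p.2 :=
    (differentiable_contr A).continuous.comp (continuous_snd (X := ℝ))
  unfold grad
  fun_prop

/-- Two maximizers coincide where the Hessian is negative at their midpoint. -/
lemma eq_of_isMaxOn_of_hess_neg {S : Set (Vec n)} {x y : Vec n}
    (hτ : 0 ≤ tau n)
    (hS : (1 / 2 : ℝ) • (x + y) ∈ S)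
    (hH : ∀ w, w ≠ 0 → inner ℝ (hess v A t ((1 / 2 : ℝ) • (x + y)) w) w < 0)
    (hx : IsMaxOn (smoothed v A t) S x) (hy : IsMaxOn (smoothed v A t) S y) : x = y := by
  set m := (1 / 2 : ℝ) • (x + y) with hm
  set d := (1 / 2 : ℝ) • (x - y) with hd
  by_contra hne
  have hd0 : d ≠ 0 := by
    rw [hd]
    exact smul_ne_zero (by norm_num) (sub_ne_zero.2 hne)
  have e1 : x = m + (1 : ℝ) • d := by rw [hm, hd]; module
  have e2 : y = m + (-1 : ℝ) • d := by rw [hm, hd]; module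
  -- Adding the expansions at `m + d` and `m - d` cancels the odd terms; the even ones are negative,
  -- so the midpoint would beat the average of the two maxima.
  have h1 := smoothed_add v A t m d 1
  have h2 := smoothed_add v A t m d (-1)
  rw [← e1] at h1
  rw [← e2] at h2
  have h3 : smoothed v A t m ≤ smoothed v A t x := hx hS
  have h4 : smoothed v A t m ≤ smoothed v A t y := hy hS
  have h5 := hH d hd0
  have h6 : 0 ≤ tau n * ‖d‖ ^ 4 := by positivity
  nlinarith

/-- Completing the square: the part depending on `s` is a multiple of `-s² ‖x - x†‖²` up to a
constant, which pulls maximizers to `x†` as `s` grows. -/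
lemma smoothed_sub (hn : (3 * tau n * ((n : ℝ) + 2)) ≠ 0) (s : ℝ) (x : Vec n) :
    smoothed v A s (xDagger v A) - smoothed v A s x =
      smoothed v A 0 (xDagger v A) - smoothed v A 0 x
        + 3 * tau n * (n + 2) * s ^ 2 / 2 * ‖x - xDagger v A‖ ^ 2 := by
  have e : (3 * tau n) • v + traceVec A = (3 * tau n * ((n : ℝ) + 2)) • xDagger v A := by
    rw [xDagger, smul_smul, mul_inv_cancel₀ hn, one_smul]
  simp only [smoothed, e, inner_smul_left, conj_trivial, real_inner_self_eq_norm_sq]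
  rw [norm_sub_sq_real, real_inner_comm x (xDagger v A)]
  ring

/-- The same completion of the square for the gradient expresses the displacement from `x†` as the
unsmoothed gradient divided by the strength of the smoothing. -/
lemma smul_sub_xDagger_of_grad (hn : (3 * tau n * ((n : ℝ) + 2)) ≠ 0) (hx : grad v A t x = 0) :
    (3 * tau n * (n + 2) * t ^ 2) • (x - xDagger v A)
      = (3 * tau n * inner ℝ v x ^ 2) • v + delta A x - (3 * tau n * ‖x‖ ^ 2) • x := by
  have e : (3 * tau n) • v + traceVec A = (3 * tau n * ((n : ℝ) + 2)) • xDagger v A := by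
    rw [xDagger, smul_smul, mul_inv_cancel₀ hn, one_smul]
  rw [grad, e, ← delta_eq] at hx
  rw [← sub_eq_zero, ← neg_eq_zero, ← hx]
  module

/-- Following the unique maximizer over a compact region from `t = ∞`: if stationary paths stay in
the interior, so does the maximizer. -/
theorem maximizer_mem_interior (hv : ‖v‖ = 1) (hτ : 0 < tau n) {ρ α t₁ : ℝ} (hρ : 0 < ρ)
    (hα : 0 < α) (ht₁ : 0 < t₁)
    (hH : ∀ t, t₁ ≤ t → ∀ x ∈ box v (xDagger v A) ρ α, ∀ w, w ≠ 0 →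
      inner ℝ (hess v A t x w) w < 0)
    (hint : ∀ t₀ y, IsHomotopyPath v A t₀ y → t₁ ≤ t₀ → y t₀ ∈ box v (xDagger v A) ρ α →
      ‖perp v (y t₀ - xDagger v A)‖ < ρ ∧ |inner ℝ v (y t₀ - xDagger v A)| < α) :
    ∀ t, t₁ ≤ t → ∃ x ∈ box v (xDagger v A) ρ α, IsLocalMax (gr v A t) x := by
  set X := xDagger v A with hX
  set S := box v X ρ α with hS
  have hcomp : IsCompact S := isCompact_box hv X ρ α
  have hXS : X ∈ S := by simp [hS, box, perp, hρ.le, hα.le]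
  have hn : (3 * tau n * ((n : ℝ) + 2)) ≠ 0 := by positivity
  have hcont := continuous_smoothed v A
  have hexists : ∀ t : ℝ, ∃ x ∈ S, IsMaxOn (smoothed v A t) S x := fun t =>
    hcomp.exists_isMaxOn ⟨X, hXS⟩ (differentiable_smoothed v A t).continuous.continuousOn
  choose y hyS hymax using hexists
  have hunique : ∀ t, t₁ ≤ t → ∀ x ∈ S, IsMaxOn (smoothed v A t) S x → x = y t := by
    intro t ht x hx hmax
    have hm := midpoint_mem_box hx (hyS t)
    exact eq_of_isMaxOn_of_hess_neg hτ.le hm (hH t ht _ hm) hmax (hymax t)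
  have hycont : ContinuousOn y (Set.Ici t₁) := by
    intro t ht
    refine hcomp.tendsto_nhds_of_unique_mapClusterPt (Eventually.of_forall hyS) fun x hx hcl => ?_
    refine hunique t ht x hx fun z hz => ?_
    -- By joint continuity a cluster value of `y` at `t` still maximizes over the box, and the
    -- maximizer is unique.
    obtain ⟨U, hU, hUx⟩ := mapClusterPt_iff_ultrafilter.1 hcl
    have hUt : Tendsto (fun s : ℝ => s) U (𝓝 t) :=
      tendsto_id.mono_left (hU.trans nhdsWithin_le_nhds)
    have h1 := (hcont.tendsto (t, x)).comp (hUt.prodMk_nhds hUx)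
    have h2 := (hcont.tendsto (t, z)).comp (hUt.prodMk_nhds (tendsto_const_nhds (x := z)))
    exact le_of_tendsto_of_tendsto' h2 h1 fun s => hymax s hz
  have hylim : Tendsto y atTop (𝓝 X) := by
    obtain ⟨H, hHb⟩ := hcomp.exists_bound_of_continuousOn
      (differentiable_smoothed v A 0).continuous.continuousOn
    have hb : ∀ s : ℝ, 0 < s →
        ‖y s - X‖ ≤ √(2 * (2 * H) / (3 * tau n * (n + 2)) * (s⁻¹ * s⁻¹)) := by
      intro s hs
      -- Comparison with the value at `X`: the quadratic term of `smoothed_sub` is at most the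
      -- oscillation `2 * H` of the unsmoothed function on the box.
      refine Real.le_sqrt_of_sq_le ?_
      have h1 : smoothed v A s X ≤ smoothed v A s (y s) := hymax s hXS
      have h2 := smoothed_sub (v := v) (A := A) hn s (y s)
      have h3 := (abs_le.1 (hHb (y s) (hyS s))).2
      have h4 := (abs_le.1 (hHb X hXS)).1
      rw [← hX] at h2
      rw [div_mul_eq_mul_div, le_div_iff₀ (by positivity), ← mul_inv, ← div_eq_mul_inv,
        le_div_iff₀ (by positivity)]
      nlinarith
    rw [tendsto_iff_norm_sub_tendsto_zero]
    refine squeeze_zero' (Eventually.of_forall fun _ => norm_nonneg _)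
      ((eventually_gt_atTop 0).mono hb) ?_
    have h5 := ((tendsto_inv_atTop_zero (𝕜 := ℝ)).mul (tendsto_inv_atTop_zero (𝕜 := ℝ))).const_mul
      (2 * (2 * H) / (3 * tau n * (n + 2)))
    simpa using h5.sqrt
  have hlocal : ∀ t, ‖perp v (y t - X)‖ < ρ → |inner ℝ v (y t - X)| < α →
      IsLocalMax (smoothed v A t) (y t) := fun t h1 h2 =>
    (hymax t).isLocalMax (box_mem_nhds h1 h2)
  have hinterior : ∀ t, t₁ ≤ t → ‖perp v (y t - X)‖ < ρ ∧ |inner ℝ v (y t - X)| < α := by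
    by_contra hcon
    push Not at hcon
    -- The times at which the maximizer lies on the boundary of the box. This set is compact, and
    -- its last element will start a homotopy path.
    set N : Set ℝ := {t | t₁ ≤ t ∧ ¬ (‖perp v (y t - X)‖ < ρ ∧ |inner ℝ v (y t - X)| < α)} with hN
    have hNne : N.Nonempty := by
      obtain ⟨t, ht, h⟩ := hcon
      exact ⟨t, ht, fun h' => absurd h'.2 (not_lt.2 (h h'.1))⟩
    have hc1 : ContinuousOn (fun t => ‖perp v (y t - X)‖) (Set.Ici t₁) :=
      (continuous_perp_sub v X).norm.comp_continuousOn hycont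
    have hc2 : ContinuousOn (fun t => |(inner ℝ v (y t - X) : ℝ)|) (Set.Ici t₁) :=
      (continuous_inner_sub v X).abs.comp_continuousOn hycont
    have hNeq : N = {t ∈ Set.Ici t₁ | ρ ≤ ‖perp v (y t - X)‖} ∪
        {t ∈ Set.Ici t₁ | α ≤ |(inner ℝ v (y t - X) : ℝ)|} := by
      ext t
      simp only [hN, Set.mem_ofPred_eq, Set.mem_union, Set.mem_Ici, not_and_or, not_lt]
      tauto
    have hNclosed : IsClosed N := by
      rw [hNeq]
      exact (isClosed_Ici.isClosed_le continuousOn_const hc1).union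
        (isClosed_Ici.isClosed_le continuousOn_const hc2)
    have hev : ∀ᶠ t in atTop, ‖perp v (y t - X)‖ < ρ ∧ |inner ℝ v (y t - X)| < α := by
      have e1 : Tendsto (fun t => ‖perp v (y t - X)‖) atTop (𝓝 0) := by
        have h := ((continuous_perp_sub v X).norm.tendsto X).comp hylim
        rwa [sub_self, show perp v (0 : Vec n) = 0 by simp [perp], norm_zero] at h
      have e2 : Tendsto (fun t => |(inner ℝ v (y t - X) : ℝ)|) atTop (𝓝 0) := by
        have h := ((continuous_inner_sub v X).abs.tendsto X).comp hylim
        rwa [sub_self, inner_zero_right, abs_zero] at h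
      exact (e1.eventually_lt_const hρ).and (e2.eventually_lt_const hα)
    obtain ⟨b, hb⟩ := eventually_atTop.1 hev
    have hNsub : N ⊆ Set.Icc t₁ b := fun t ht =>
      ⟨ht.1, not_lt.1 fun hbt => ht.2 (hb t hbt.le)⟩
    have hNcomp : IsCompact N := isCompact_Icc.of_isClosed_subset hNclosed hNsub
    have hmem := hNcomp.sSup_mem hNne
    set t₀ := sSup N with ht₀
    have hgt : ∀ t, t₀ < t → grad v A t (y t) = 0 := by
      intro t ht
      have : t ∉ N := fun h => absurd (le_csSup hNcomp.bddAbove h) (not_le.2 ht)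
      have h' : ‖perp v (y t - X)‖ < ρ ∧ |inner ℝ v (y t - X)| < α := by
        by_contra h''
        exact this ⟨hmem.1.trans ht.le, h''⟩
      exact grad_eq_zero_of_isLocalMax (hlocal t h'.1 h'.2)
    have hge : ∀ t, t₀ ≤ t → grad v A t (y t) = 0 := by
      intro t ht
      rcases ht.eq_or_lt with rfl | ht
      -- At `t₀` itself the maximizer is on the boundary and need not be a local maximum, so the
      -- gradient vanishes there only as a limit from the right.
      · have h1 : Tendsto y (𝓝[>] t₀) (𝓝 (y t₀)) :=
          (hycont t₀ hmem.1).mono_left (nhdsWithin_mono _ fun s hs =>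
            hmem.1.trans (le_of_lt hs))
        have h2 : Tendsto (fun s : ℝ => s) (𝓝[>] t₀) (𝓝 t₀) := nhdsWithin_le_nhds
        have h3 := ((continuous_grad v A).tendsto (t₀, y t₀)).comp (h2.prodMk_nhds h1)
        refine tendsto_nhds_unique h3 (tendsto_const_nhds.congr' ?_)
        filter_upwards [self_mem_nhdsWithin] with s hs
        exact (hgt s hs).symm
      · exact hgt t ht
    have hpath : IsHomotopyPath v A t₀ y := by
      refine ⟨ht₁.le.trans hmem.1, hycont.mono (Set.Ici_subset_Ici.2 hmem.1), hylim, fun t ht => ?_⟩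
      rw [gradient_gr hv]
      exact hge t ht
    exact hmem.2 (hint t₀ y hpath hmem.1 (hyS t₀))
  intro t ht
  refine ⟨y t, hyS t, ?_⟩
  rw [isLocalMax_gr_iff hv]
  exact hlocal t (hinterior t ht).1 (hinterior t ht).2

end

/-! ### Large smoothing: the maximizer stays near `x†` -/

section

variable {n : ℕ} {Λ c K q l t : ℝ} {v : Vec n} {A : Tensor n} {x : Vec n}

/-- A threshold for `log n` and `n^{1/4} / log n` past which the maximizer at smoothing `4 / n` or
more stays close to its limit. -/
def largeSmoothingThreshold (Λ K : ℝ) : ℝ := 4 + Λ * (K + 1) + 2 * K ^ 2 + 18 * K + 9 * (K + 1) ^ 2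

/-- For `t ≥ 4 / n` the smoothing contributes curvature at least `48 l / q`, against at most `18 l /
q` from the signal and `3 l / q` from the noise. -/
lemma NoiseBounds.hess_neg_of_mem_box (h : NoiseBounds Λ c K q l v A) (hΛ : 0 < Λ)
    (hq : 1 ≤ q) (hl : 1 ≤ l) (hr : ‖x‖ ≤ 3 * (K + 1) / (q ^ 3 * l)) (hΛl : Λ * (K + 1) ≤ l)
    (ha : |inner ℝ v x| ≤ 3 / q ^ 4) (ht : 4 / (n : ℝ) ≤ t) {w : Vec n} (hw : w ≠ 0) :
    inner ℝ (hess v A t x w) w < 0 := by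
  have hτ := h.tau_pos hq hl
  have hw0 : 0 < ‖w‖ ^ 2 := by positivity
  rw [hess_apply]
  simp only [inner_sub_left, inner_add_left, inner_smul_left, conj_trivial,
    real_inner_self_eq_norm_sq]
  have e1 : 6 * tau n * inner ℝ v x * inner ℝ v w * inner ℝ v w
      ≤ 18 * l / q * ‖w‖ ^ 2 := by
    have h1 : inner ℝ v w * inner ℝ v w ≤ ‖w‖ ^ 2 := by
      rw [← abs_mul_abs_self, ← pow_two]
      have := abs_inner_le_norm_of_unit h.norm_v w
      gcongr
    have h2 : 6 * tau n * inner ℝ v x ≤ 18 * l / q := by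
      calc 6 * tau n * inner ℝ v x ≤ 6 * tau n * (3 / q ^ 4) := by
            gcongr; exact (le_abs_self _).trans ha
        _ = 18 * l / q := by rw [h.tau_eq]; field_simp; ring
    calc _ = 6 * tau n * inner ℝ v x * (inner ℝ v w * inner ℝ v w) := by ring
      _ ≤ 18 * l / q * (inner ℝ v w * inner ℝ v w) :=
        mul_le_mul_of_nonneg_right h2 (mul_self_nonneg _)
      _ ≤ _ := by gcongr
  have e2 : inner ℝ (contr A x w) w ≤ 3 * l / q * ‖w‖ ^ 2 := by
    have h1 := (real_inner_le_norm (contr A x w) w).trans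
      (mul_le_mul_of_nonneg_right (h.norm_contr_le x w) (norm_nonneg w))
    have h2 : Λ * q ^ 2 * ‖x‖ ≤ 3 * l / q := by
      calc Λ * q ^ 2 * ‖x‖ ≤ Λ * q ^ 2 * (3 * (K + 1) / (q ^ 3 * l)) := by gcongr
        _ = 3 * (Λ * (K + 1)) / l / q := by field_simp
        _ ≤ 3 * l / 1 / q := by gcongr
        _ = _ := by ring
    calc _ ≤ Λ * q ^ 2 * ‖x‖ * ‖w‖ * ‖w‖ := h1
      _ = Λ * q ^ 2 * ‖x‖ * ‖w‖ ^ 2 := by ring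
      _ ≤ _ := by gcongr
  have e3 : 48 * l / q ≤ 3 * tau n * (‖x‖ ^ 2 + (n + 2) * t ^ 2) := by
    have h1 : 16 / q ^ 4 ≤ (n + 2) * t ^ 2 := by
      have : (4 / (n : ℝ)) ^ 2 ≤ t ^ 2 := by gcongr
      rw [← h.q_pow] at this ⊢
      calc 16 / q ^ 4 = q ^ 4 * (4 / q ^ 4) ^ 2 := by field_simp; norm_num
        _ ≤ (q ^ 4 + 2) * t ^ 2 := by gcongr; linarith
    calc 48 * l / q = 3 * tau n * (16 / q ^ 4) := by rw [h.tau_eq]; field_simp; norm_num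
      _ ≤ _ := by gcongr; nlinarith [sq_nonneg ‖x‖]
  have e4 : 0 ≤ 6 * tau n * inner ℝ x w * inner ℝ x w := by
    have := mul_self_nonneg (inner ℝ x w : ℝ)
    rw [mul_assoc]; positivity
  have e5 : 48 * l / q * ‖w‖ ^ 2
      ≤ 3 * tau n * (‖x‖ ^ 2 + (n + 2) * t ^ 2) * ‖w‖ ^ 2 := by gcongr
  have e6 : 0 < l / q * ‖w‖ ^ 2 := by positivity
  have e7 : 18 * l / q * ‖w‖ ^ 2 + 3 * l / q * ‖w‖ ^ 2 - 48 * l / q * ‖w‖ ^ 2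
      = -27 * (l / q * ‖w‖ ^ 2) := by ring
  linarith

/-- The displacement equation has coefficient `E ≥ 48 l / q`, and its right side has constants below
`48`: `9/2 + 9` across `v` and `27 + 1 + 9` along `v`. Regularity is needed along `v`, where noise
of order `l / q⁵` is tolerated and the operator bound gives only `1 / (q⁴ l)`. -/
lemma NoiseBounds.sub_xDagger_lt_of_grad (h : NoiseBounds Λ c K q l v A) (hΛ : 0 < Λ) (hK : 0 < K)
    (hq : 1 ≤ q) (hl : 1 ≤ l) (hr : ‖x‖ ≤ 3 * (K + 1) / (q ^ 3 * l)) (hΛl : Λ * (K + 1) ≤ l)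
    (hq9 : 9 * (K + 1) ^ 2 ≤ q) (hl9 : 9 * (K + 1) ^ 2 ≤ l)
    (ha : |inner ℝ v x| ≤ 3 / q ^ 4) (ht : 4 / (n : ℝ) ≤ t) (hx : grad v A t x = 0)
    (hreg : |inner ℝ (delta A x) v| ≤ K * q * ‖x‖ ^ 2) :
    ‖perp v (x - xDagger v A)‖ < (K + 1) / (q ^ 3 * l ^ 2) ∧
      |inner ℝ v (x - xDagger v A)| < 1 / q ^ 4 := by
  have hv := h.norm_v
  have hτ := h.tau_pos hq hl
  have hmain := smul_sub_xDagger_of_grad (v := v) (A := A) (x := x) (t := t) (by positivity) hx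
  set E : ℝ := 3 * tau n * (n + 2) * t ^ 2 with hE
  have hElow : 48 * l / q ≤ E := by
    have h1 : 16 / q ^ 4 ≤ (n + 2) * t ^ 2 := by
      have : (4 / (n : ℝ)) ^ 2 ≤ t ^ 2 := by gcongr
      rw [← h.q_pow] at this ⊢
      calc 16 / q ^ 4 = q ^ 4 * (4 / q ^ 4) ^ 2 := by field_simp; norm_num
        _ ≤ (q ^ 4 + 2) * t ^ 2 := by gcongr; linarith
    calc 48 * l / q = 3 * tau n * (16 / q ^ 4) := by rw [h.tau_eq]; field_simp; norm_num
      _ ≤ 3 * tau n * ((n + 2) * t ^ 2) := by gcongr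
      _ = E := by rw [hE]; ring
  have hEpos : 0 < E := lt_of_lt_of_le (by positivity) hElow
  set J := K + 1 with hJ
  have hJ1 : 1 < J := by linarith
  have hr2 : ‖x‖ ^ 2 ≤ (3 * J / (q ^ 3 * l)) ^ 2 := by gcongr
  constructor
  · refine lt_of_mul_lt_mul_left ?_ hEpos.le
    have e1 : E * ‖perp v (x - xDagger v A)‖ = ‖perp v (E • (x - xDagger v A))‖ := by
      rw [perp_smul, norm_smul, Real.norm_of_nonneg hEpos.le]
    have e2 : ‖delta A x‖ ≤ Λ * q ^ 2 * ‖x‖ ^ 2 / 2 := by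
      rw [delta_eq, norm_smul, Real.norm_of_nonneg (by norm_num)]
      have := h.norm_contr_le x x
      linarith
    rw [e1, hmain, perp_sub, perp_add, perp_smul, perp_smul, perp_self hv, smul_zero, zero_add]
    have e3 : ‖perp v (delta A x) - (3 * tau n * ‖x‖ ^ 2) • perp v x‖
        ≤ Λ * q ^ 2 * ‖x‖ ^ 2 / 2 + 3 * tau n * ‖x‖ ^ 2 * ‖x‖ := by
      refine (norm_sub_le _ _).trans (add_le_add ((TensorPCA.norm_perp_le hv _).trans e2) ?_)
      rw [norm_smul, Real.norm_of_nonneg (by positivity)]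
      gcongr
      exact TensorPCA.norm_perp_le hv _
    refine e3.trans_lt (lt_of_lt_of_le ?_ (mul_le_mul_of_nonneg_right hElow (by positivity)))
    have e4 : Λ * q ^ 2 * ‖x‖ ^ 2 / 2 ≤ 9 / 2 * (J / (q ^ 4 * l)) := by
      calc Λ * q ^ 2 * ‖x‖ ^ 2 / 2 ≤ Λ * q ^ 2 * (3 * J / (q ^ 3 * l)) ^ 2 / 2 := by gcongr
        _ = 9 / 2 * ((Λ * J) / l * (J / (q ^ 4 * l))) := by field_simp; norm_num
        _ ≤ 9 / 2 * (1 * (J / (q ^ 4 * l))) := by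
          gcongr
          rw [div_le_one (by positivity)]; exact hΛl
        _ = _ := by ring
    have e5 : 3 * tau n * ‖x‖ ^ 2 * ‖x‖ ≤ 9 * (J / (q ^ 4 * l)) := by
      calc 3 * tau n * ‖x‖ ^ 2 * ‖x‖
          ≤ 3 * tau n * (3 * J / (q ^ 3 * l)) ^ 2 * (3 * J / (q ^ 3 * l)) := by gcongr
        _ = 9 * (9 * J ^ 2 / (q ^ 2 * l) * (J / (q ^ 4 * l))) := by
          rw [h.tau_eq]; field_simp; norm_num
        _ ≤ 9 * (1 * (J / (q ^ 4 * l))) := by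
          gcongr
          rw [div_le_one (by positivity)]
          nlinarith [one_le_pow₀ hq (n := 2)]
        _ = _ := by ring
    have e6 : 48 * l / q * (J / (q ^ 3 * l ^ 2)) = 48 * (J / (q ^ 4 * l)) := by field_simp
    have e7 : 0 < J / (q ^ 4 * l) := by positivity
    linarith
  · refine lt_of_mul_lt_mul_left ?_ hEpos.le
    have e1 : E * |inner ℝ v (x - xDagger v A)| = |inner ℝ v (E • (x - xDagger v A))| := by
      rw [inner_smul_right, abs_mul, abs_of_pos hEpos]
    rw [e1, hmain, inner_sub_right, inner_add_right, inner_smul_right, inner_smul_right,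
      real_inner_self_eq_norm_sq, hv, real_inner_comm]
    have e3 : |3 * tau n * inner ℝ x v ^ 2 * 1 ^ 2 + inner ℝ v (delta A x)
        - 3 * tau n * ‖x‖ ^ 2 * inner ℝ x v|
        ≤ 3 * tau n * (3 / q ^ 4) ^ 2 + K * q * ‖x‖ ^ 2 + 3 * tau n * ‖x‖ ^ 2 * (3 / q ^ 4) := by
      rw [real_inner_comm] at ha hreg
      refine (abs_sub _ _).trans (add_le_add ((abs_add_le _ _).trans (add_le_add ?_ hreg)) ?_)
      · rw [one_pow, mul_one, abs_mul, abs_of_pos (by positivity), abs_pow]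
        gcongr
      · rw [abs_mul, abs_of_nonneg (by positivity)]
        gcongr
    refine e3.trans_lt (lt_of_lt_of_le ?_ (mul_le_mul_of_nonneg_right hElow (by positivity)))
    have e4 : 3 * tau n * (3 / q ^ 4) ^ 2 = 27 * (l / q ^ 5) := by
      rw [h.tau_eq]; field_simp; norm_num
    have e5 : K * q * ‖x‖ ^ 2 ≤ l / q ^ 5 := by
      calc K * q * ‖x‖ ^ 2 ≤ K * q * (3 * J / (q ^ 3 * l)) ^ 2 := by gcongr
        _ = (9 * J ^ 2 * K) / l ^ 3 * (l / q ^ 5) := by field_simp; norm_num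
        _ ≤ 1 * (l / q ^ 5) := by
          gcongr
          rw [div_le_one (by positivity)]
          have h1 : K ≤ l := by nlinarith
          have h2 : 9 * J ^ 2 * K ≤ l * l := by gcongr
          nlinarith
        _ = _ := one_mul _
    have e6 : 3 * tau n * ‖x‖ ^ 2 * (3 / q ^ 4) ≤ 9 * (l / q ^ 5) := by
      calc 3 * tau n * ‖x‖ ^ 2 * (3 / q ^ 4)
          ≤ 3 * tau n * (3 * J / (q ^ 3 * l)) ^ 2 * (3 / q ^ 4) := by gcongr
        _ = 9 * (9 * J ^ 2 / (q ^ 2 * l ^ 2) * (l / q ^ 5)) := by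
          rw [h.tau_eq]; field_simp; norm_num
        _ ≤ 9 * (1 * (l / q ^ 5)) := by
          gcongr
          rw [div_le_one (by positivity)]
          have h1 : 1 ≤ q * l ^ 2 := one_le_mul_of_one_le_of_one_le hq (one_le_pow₀ hl)
          nlinarith
        _ = _ := by ring
    have e7 : 48 * l / q * (1 / q ^ 4) = 48 * (l / q ^ 5) := by field_simp
    have e8 : 0 < l / q ^ 5 := by positivity
    linarith

theorem NoiseBounds.exists_isLocalMax (h : NoiseBounds Λ c K q l v A) (hΛ : 0 < Λ) (hK : 0 < K)
    (hl : largeSmoothingThreshold Λ K < l) (hlq : largeSmoothingThreshold Λ K * l < q)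
    (hreg : ∀ t₀ y, IsHomotopyPath v A t₀ y → ∀ t, t₀ ≤ t →
      |inner ℝ (delta A (y t)) v| ≤ K * q * ‖y t‖ ^ 2)
    (ht : 4 / (n : ℝ) ≤ t) :
    ∃ x, IsLocalMax (gr v A t) x ∧
      ‖x - xDagger v A‖ ≤ (18 * K * (l / q) + 18 * K * (K + 1) * (1 / l)) * ‖xDagger v A‖ := by
  set J := K + 1 with hJ
  have hB : 4 ≤ largeSmoothingThreshold Λ K ∧ Λ * J ≤ largeSmoothingThreshold Λ K ∧
      2 * K ^ 2 ≤ largeSmoothingThreshold Λ K ∧ 18 * K ≤ largeSmoothingThreshold Λ K ∧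
      9 * J ^ 2 ≤ largeSmoothingThreshold Λ K := by
    have p1 : 0 < Λ * J := by positivity
    have p2 : 0 < 2 * K ^ 2 := by positivity
    have p3 : 0 < 9 * J ^ 2 := by positivity
    rw [largeSmoothingThreshold, ← hJ]
    refine ⟨?_, ?_, ?_, ?_, ?_⟩ <;> linarith
  obtain ⟨b1, b2, b3, b4, b5⟩ := hB
  set B := largeSmoothingThreshold Λ K
  clear_value B
  have hl1 : 1 ≤ l := by linarith only [hl, b1]
  have hBq : B < q := by nlinarith only [hl1, hlq, b1]
  have hlq' : l ≤ q := by nlinarith only [hl1, hlq, b1]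
  have hq1 : 1 ≤ q := by linarith only [hBq, b1]
  have hv := h.norm_v
  have hn : (0 : ℝ) < n := by rw [← h.q_pow]; positivity
  have h2K : 2 * K ^ 2 * l ≤ q := by nlinarith only [b3, hlq, hl1]
  have h18 : 18 * K * l ≤ q := by nlinarith only [b4, hlq, hl1]
  have hR1 := h.norm_xDagger_le_div hK hq1 hl1 hlq'
  have hR2 := h.le_norm_xDagger hK hq1 hl1 h2K
  have haX := h.inner_xDagger_mem hq1 hl1 (by linarith only [b4, hBq, hK])
  set X := xDagger v A with hX
  -- Across `v` the radius is smaller than `‖x†‖` by a factor of order `1 / l`. Along `v` the radius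
  -- `1 / q⁴` is of the order allowed for `⟨v, x†⟩`, below `‖x†‖` by a factor of order `l / q`.
  -- These are the two summands of the relative error.
  set ρ := J / (q ^ 3 * l ^ 2) with hρ
  have hρpos : 0 < ρ := by positivity
  have hq4 : 1 / q ^ 4 ≤ J / (q ^ 3 * l) := by
    rw [div_le_div_iff₀ (by positivity) (by positivity)]
    have : q ^ 3 * l ≤ q ^ 3 * q := by gcongr
    have h4 : 0 < K * q ^ 4 := by positivity
    rw [hJ]
    nlinarith only [this, h4]
  have hρle : ρ ≤ J / (q ^ 3 * l) := by
    rw [hρ]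
    gcongr
    nlinarith only [hl1]
  have hbox : ∀ x ∈ box v X ρ (1 / q ^ 4), ‖x‖ ≤ 3 * J / (q ^ 3 * l) ∧
      |inner ℝ v x| ≤ 3 / q ^ 4 := by
    intro x hx
    constructor
    · have e1 := norm_sub_le_of_mem_box hv hx
      have e2 : ‖x‖ ≤ ‖x - X‖ + ‖X‖ := by simpa using norm_add_le (x - X) X
      have e3 : 3 * J / (q ^ 3 * l) = 3 * (J / (q ^ 3 * l)) := by ring
      linarith only [e1, e2, e3, hR1, hq4, hρle]
    · have e1 := hx.2
      have e2 : inner ℝ v x = inner ℝ v (x - X) + inner ℝ v X := by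
        rw [← inner_add_right, sub_add_cancel]
      rw [e2]
      refine (abs_add_le _ _).trans ?_
      rw [abs_of_nonneg haX.1]
      have e3 : 3 / q ^ 4 = 1 / q ^ 4 + 2 / q ^ 4 := by ring
      linarith only [e1, e3, haX.2]
  obtain ⟨x, hxS, hxmax⟩ := maximizer_mem_interior (A := A) hv (h.tau_pos hq1 hl1) hρpos
    (α := 1 / q ^ 4) (by positivity) (t₁ := 4 / (n : ℝ)) (by positivity)
    (fun t ht x hx w hw => h.hess_neg_of_mem_box hΛ hq1 hl1 (hbox x hx).1
      (b2.trans hl.le) (hbox x hx).2 ht hw)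
    (fun t₀ y hy ht₀ hyS => by
      have hg := hy.2.2.2 t₀ le_rfl
      rw [gradient_gr hv] at hg
      exact h.sub_xDagger_lt_of_grad hΛ hK hq1 hl1 (hbox _ hyS).1 (b2.trans hl.le)
        (b5.trans hBq.le) (b5.trans hl.le) (hbox _ hyS).2 ht₀ hg (hreg t₀ y hy t₀ le_rfl)) t ht
  refine ⟨x, hxmax, (norm_sub_le_of_mem_box hv hxS).trans ?_⟩
  have e1 : 1 / q ^ 4 + ρ
      = (18 * K * (l / q) + 18 * K * J * (1 / l)) * (1 / (18 * K * (q ^ 3 * l))) := by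
    rw [hρ]; field_simp
  rw [e1]
  gcongr

end

/-! ### Nets and multilinear operator bounds -/

section

variable {n : ℕ}

/-- A volume comparison bounds `1`-separated subsets of the ball of radius `2` by `5 ^ n` points,
and one of greatest size must cover the ball. -/
lemma exists_maximal_separated (n : ℕ) : ∃ s : Finset (Vec n), s.card ≤ 5 ^ n ∧
    (∀ c ∈ s, ‖c‖ ≤ 2) ∧ ∀ x : Vec n, ‖x‖ ≤ 2 → ∃ c ∈ s, ‖x - c‖ ≤ 1 := by
  classical
  let P : ℕ → Prop := fun k => ∃ s : Finset (Vec n), (∀ c ∈ s, ‖c‖ ≤ 2) ∧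
    (∀ c ∈ s, ∀ d ∈ s, c ≠ d → 1 ≤ ‖c - d‖) ∧ s.card = k
  have hle : ∀ k, P k → k ≤ 5 ^ n := by
    rintro k ⟨s, h1, h2, rfl⟩
    simpa using Besicovitch.card_le_of_separated s h1 h2
  have h0 : P 0 := ⟨∅, by simp, by simp, rfl⟩
  obtain ⟨s, h1, h2, h3⟩ : P (Nat.findGreatest P (5 ^ n)) :=
    Nat.findGreatest_spec (Nat.zero_le _) h0
  refine ⟨s, h3 ▸ Nat.findGreatest_le _, h1, fun x hx => ?_⟩
  by_contra hcon
  push Not at hcon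
  have hxs : x ∉ s := fun hxs => by
    have := hcon x hxs
    simp at this
    linarith
  have hP : P (s.card + 1) := by
    refine ⟨insert x s, ?_, ?_, Finset.card_insert_of_notMem hxs⟩
    · intro c hc
      rcases Finset.mem_insert.1 hc with rfl | hc
      · exact hx
      · exact h1 c hc
    · intro c hc d hd hcd
      rcases Finset.mem_insert.1 hc with rfl | hc' <;> rcases Finset.mem_insert.1 hd with rfl | hd'
      · exact absurd rfl hcd
      · exact (hcon d hd').le
      · rw [norm_sub_rev]; exact (hcon c hc').le
      · exact h2 c hc' d hd' hcd
  have := Nat.le_findGreatest (hle _ hP) hP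
  omega

/-- A `1/2`-net of the unit ball. -/
lemma exists_half_net (n : ℕ) : ∃ s : Finset (Vec n), s.card ≤ 5 ^ n ∧
    (∀ c ∈ s, ‖c‖ ≤ 1) ∧ ∀ x : Vec n, ‖x‖ ≤ 1 → ∃ c ∈ s, ‖x - c‖ ≤ 1 / 2 := by
  classical
  obtain ⟨s, h1, h2, h3⟩ := exists_maximal_separated n
  refine ⟨s.image fun c => (1 / 2 : ℝ) • c, Finset.card_image_le.trans h1, ?_, fun x hx => ?_⟩
  · intro c hc
    obtain ⟨d, hd, rfl⟩ := Finset.mem_image.1 hc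
    rw [norm_smul, Real.norm_of_nonneg (by norm_num)]
    linarith [h2 d hd]
  · obtain ⟨c, hc, hxc⟩ := h3 ((2 : ℝ) • x) (by
      rw [norm_smul, Real.norm_of_nonneg (by norm_num)]; linarith)
    refine ⟨(1 / 2 : ℝ) • c, Finset.mem_image_of_mem _ hc, ?_⟩
    have e : x - (1 / 2 : ℝ) • c = (1 / 2 : ℝ) • ((2 : ℝ) • x - c) := by module
    rw [e, norm_smul, Real.norm_of_nonneg (by norm_num)]
    linarith

/-- The remainder, rescaled by `2 ^ k`, lies in the unit ball again; approximating it by the half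
net costs another factor `5 ^ n`. -/
lemma exists_net (n k : ℕ) : ∃ s : Finset (Vec n), s.card ≤ (5 ^ n) ^ k ∧
    ∀ x : Vec n, ‖x‖ ≤ 1 → ∃ c ∈ s, ‖x - c‖ ≤ (1 / 2) ^ k := by
  classical
  induction k with
  | zero => exact ⟨{0}, by simp, fun x hx => ⟨0, by simp, by simpa using hx⟩⟩
  | succ k ih =>
    obtain ⟨s, h1, h2⟩ := ih
    obtain ⟨s', h1', -, h2'⟩ := exists_half_net n
    refine ⟨(s ×ˢ s').image fun p => p.1 + ((1 / 2 : ℝ) ^ k) • p.2, ?_, fun x hx => ?_⟩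
    · refine Finset.card_image_le.trans ?_
      rw [Finset.card_product, pow_succ]
      gcongr
    · obtain ⟨c, hc, hxc⟩ := h2 x hx
      obtain ⟨d, hd, hxd⟩ := h2' ((2 : ℝ) ^ k • (x - c)) (by
        rw [norm_smul, Real.norm_of_nonneg (by positivity)]
        calc (2 : ℝ) ^ k * ‖x - c‖ ≤ 2 ^ k * (1 / 2) ^ k := by gcongr
          _ = 1 := by rw [← mul_pow]; norm_num)
      refine ⟨_, Finset.mem_image_of_mem _ (Finset.mk_mem_product hc hd), ?_⟩
      have e0 : (1 / 2 : ℝ) ^ k * 2 ^ k = 1 := by rw [← mul_pow]; norm_num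
      have e : x - (c + ((1 / 2 : ℝ) ^ k) • d) = (1 / 2 : ℝ) ^ k • ((2 : ℝ) ^ k • (x - c) - d) := by
        rw [smul_sub, smul_smul, e0, one_smul]; module
      simp only
      rw [e, norm_smul, Real.norm_of_nonneg (by positivity), pow_succ]
      gcongr

/-- Absorption: approximating by net points gives `‖F‖ ≤ T + ‖F‖ / 2`. -/
lemma abs_le_of_half_net {s : Finset (Vec n)}
    (hs : ∀ x : Vec n, ‖x‖ ≤ 1 → ∃ c ∈ s, ‖x - c‖ ≤ 1 / 2) (f : Vec n →ₗ[ℝ] ℝ) {T : ℝ}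
    (hT : 0 ≤ T) (hf : ∀ c ∈ s, |f c| ≤ T) {x : Vec n} (hx : ‖x‖ ≤ 1) : |f x| ≤ 2 * T := by
  set F := LinearMap.toContinuousLinearMap f with hF
  have hFf : ∀ y, F y = f y := fun y => rfl
  have hb : ∀ y : Vec n, ‖y‖ ≤ 1 → |f y| ≤ T + ‖F‖ * (1 / 2) := by
    intro y hy
    obtain ⟨c, hc, hyc⟩ := hs y hy
    have e : f y = f c + F (y - c) := by rw [hFf, map_sub]; ring
    rw [e]
    refine (abs_add_le _ _).trans (add_le_add (hf c hc) ?_)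
    rw [← Real.norm_eq_abs]
    exact (F.le_opNorm _).trans (by gcongr)
  have hn : ‖F‖ ≤ T + ‖F‖ * (1 / 2) := by
    refine F.opNorm_le_of_unit_norm (by positivity) fun y hy => ?_
    rw [Real.norm_eq_abs]
    exact hb y hy.le
  have := hb x hx
  linarith

lemma abs_inner_contr_le_of_half_net {s : Finset (Vec n)}
    (hs : ∀ x : Vec n, ‖x‖ ≤ 1 → ∃ c ∈ s, ‖x - c‖ ≤ 1 / 2) {A : Tensor n} {T : ℝ} (hT : 0 ≤ T)
    (h : ∀ x ∈ s, ∀ y ∈ s, ∀ z ∈ s, |inner ℝ (contr A x y) z| ≤ T) {x y z : Vec n}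
    (hx : ‖x‖ ≤ 1) (hy : ‖y‖ ≤ 1) (hz : ‖z‖ ≤ 1) : |inner ℝ (contr A x y) z| ≤ 8 * T := by
  have h1 : ∀ x ∈ s, ∀ y ∈ s, ∀ z : Vec n, ‖z‖ ≤ 1 → |inner ℝ (contr A x y) z| ≤ 2 * T :=
    fun x hx y hy z hz => abs_le_of_half_net hs
      ((innerSL ℝ (contr A x y) : Vec n →L[ℝ] ℝ) : Vec n →ₗ[ℝ] ℝ) hT (h x hx y hy) hz
  have h2 : ∀ x ∈ s, ∀ y z : Vec n, ‖y‖ ≤ 1 → ‖z‖ ≤ 1 →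
      |inner ℝ (contr A x y) z| ≤ 2 * (2 * T) := by
    intro x hx y z hy hz
    rw [inner_contr_right_comm]
    refine abs_le_of_half_net hs
      ((innerSL ℝ (contr A x z) : Vec n →L[ℝ] ℝ) : Vec n →ₗ[ℝ] ℝ) (by positivity)
      (fun c hc => ?_) hy
    have := h1 x hx c hc z hz
    rw [inner_contr_right_comm] at this
    exact this
  have h3 : |inner ℝ (contr A x y) z| ≤ 2 * (2 * (2 * T)) := by
    have e : ∀ w : Vec n, inner ℝ (contr A w y) z = inner ℝ (contr A y z) w := fun w => by
      rw [contr_comm, inner_contr_right_comm]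
    rw [e]
    refine abs_le_of_half_net hs
      ((innerSL ℝ (contr A y z) : Vec n →L[ℝ] ℝ) : Vec n →ₗ[ℝ] ℝ) (by positivity)
      (fun c hc => ?_) hx
    have := h2 c hc y z hy hz
    rw [e] at this
    exact this
  linarith

lemma norm_contr_le_of_unit {A : Tensor n} {T : ℝ} (hT : 0 ≤ T)
    (h : ∀ x y z : Vec n, ‖x‖ ≤ 1 → ‖y‖ ≤ 1 → ‖z‖ ≤ 1 → |inner ℝ (contr A x y) z| ≤ T)
    (x y : Vec n) : ‖contr A x y‖ ≤ T * ‖x‖ * ‖y‖ := by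
  have hunit : ∀ w : Vec n, ‖(‖w‖⁻¹ : ℝ) • w‖ ≤ 1 := by
    intro w
    rw [norm_smul, norm_inv, norm_norm]
    exact inv_mul_le_one
  have hback : ∀ w : Vec n, w = ‖w‖ • ((‖w‖⁻¹ : ℝ) • w) := by
    intro w
    rcases eq_or_ne w 0 with rfl | hw
    · simp
    · rw [smul_smul, mul_inv_cancel₀ (norm_ne_zero_iff.2 hw), one_smul]
  have h1 : ∀ x y : Vec n, ‖x‖ ≤ 1 → ‖y‖ ≤ 1 → ‖contr A x y‖ ≤ T := by
    intro x y hx hy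
    set w := contr A x y with hw
    rcases eq_or_ne w 0 with h0 | h0
    · rw [h0, norm_zero]; exact hT
    · have h2 := h x y ((‖w‖⁻¹ : ℝ) • w) hx hy (hunit w)
      rw [← hw, inner_smul_right, real_inner_self_eq_norm_sq, pow_two, ← mul_assoc,
        inv_mul_cancel₀ (norm_ne_zero_iff.2 h0), one_mul, abs_norm] at h2
      exact h2
  have e : contr A x y
      = ‖y‖ • ‖x‖ • contr A ((‖x‖⁻¹ : ℝ) • x) ((‖y‖⁻¹ : ℝ) • y) := by
    conv_lhs => rw [hback x, hback y]
    simp only [map_smul, LinearMap.smul_apply]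
    module
  have := h1 _ _ (hunit x) (hunit y)
  rw [e, norm_smul, norm_smul, norm_norm, norm_norm]
  calc _ ≤ ‖y‖ * (‖x‖ * T) := by gcongr
    _ = _ := by ring

end

/-! ### Gaussian tails and small ball estimates -/

section

section Gaussian

variable {E : Type*} [NormedAddCommGroup E] [InnerProductSpace ℝ E] [FiniteDimensional ℝ E]
  [MeasurableSpace E] [BorelSpace E]

lemma variance_inner_stdGaussian (c : E) :
    Var[fun a : E => (inner ℝ c a : ℝ); stdGaussian E] = ‖c‖ ^ 2 := by
  have := variance_dual_stdGaussian (innerSL ℝ c)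
  rw [innerSL_apply_norm] at this
  exact this

lemma map_inner_stdGaussian (c : E) :
    (stdGaussian E).map (fun a => (inner ℝ c a : ℝ)) = gaussianReal 0 (‖c‖ ^ 2).toNNReal := by
  have h : HasGaussianLaw (fun a : E => (inner ℝ c a : ℝ)) (stdGaussian E) :=
    (IsGaussian.hasGaussianLaw_id (μ := stdGaussian E)).map_fun (innerSL ℝ c)
  rw [h.map_eq_gaussianReal, variance_inner_stdGaussian]
  congr 1
  exact integral_strongDual_stdGaussian (innerSL ℝ c)

lemma lintegral_exp_inner_stdGaussian (c : E) :
    ∫⁻ a, ENNReal.ofReal (Real.exp (inner ℝ c a)) ∂(stdGaussian E)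
      = ENNReal.ofReal (Real.exp (‖c‖ ^ 2 / 2)) := by
  have h1 : ∫⁻ a, ENNReal.ofReal (Real.exp (inner ℝ c a)) ∂(stdGaussian E)
      = ∫⁻ y, ENNReal.ofReal (Real.exp y) ∂(gaussianReal 0 (‖c‖ ^ 2).toNNReal) := by
    rw [← map_inner_stdGaussian, lintegral_map (by fun_prop) (by fun_prop)]
  have h2 := mgf_id_gaussianReal (μ := 0) (v := (‖c‖ ^ 2).toNNReal)
  have h3 := congrFun h2 1
  simp only [mgf, id, one_mul, mul_one, zero_add, one_pow,
    Real.coe_toNNReal _ (sq_nonneg ‖c‖)] at h3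
  rw [h1, ← ofReal_integral_eq_lintegral_ofReal, h3]
  · simpa using integrable_exp_mul_gaussianReal (μ := 0) (v := (‖c‖ ^ 2).toNNReal) 1
  · exact Eventually.of_forall fun y => (Real.exp_pos y).le

/-- Chernoff bound for a linear functional of a standard Gaussian vector. -/
lemma stdGaussian_inner_ge_le (c : E) {σ T : ℝ} (hσ : 0 < σ) (hc : ‖c‖ ≤ σ) (hT : 0 ≤ T) :
    stdGaussian E {a | T ≤ inner ℝ c a} ≤ ENNReal.ofReal (Real.exp (-(T ^ 2 / (2 * σ ^ 2)))) := by
  -- The optimal exponent in the Chernoff bound.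
  set s := T / σ ^ 2 with hs
  have hs0 : 0 ≤ s := by positivity
  have h1 := mul_meas_ge_le_lintegral (μ := stdGaussian E)
    (f := fun a => ENNReal.ofReal (Real.exp (inner ℝ (s • c) a))) (by fun_prop)
    (ENNReal.ofReal (Real.exp (s * T)))
  rw [lintegral_exp_inner_stdGaussian] at h1
  have h2 : {a : E | T ≤ inner ℝ c a} ⊆ {a | ENNReal.ofReal (Real.exp (s * T))
      ≤ ENNReal.ofReal (Real.exp (inner ℝ (s • c) a))} := by
    intro a ha
    refine ENNReal.ofReal_le_ofReal (Real.exp_le_exp.2 ?_)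
    rw [inner_smul_left]
    exact mul_le_mul_of_nonneg_left ha hs0
  have h3 : ENNReal.ofReal (Real.exp (s * T)) * stdGaussian E {a | T ≤ inner ℝ c a}
      ≤ ENNReal.ofReal (Real.exp (‖s • c‖ ^ 2 / 2)) := le_trans (by gcongr) h1
  rw [mul_comm, ← ENNReal.le_div_iff_mul_le (by simp [Real.exp_pos]) (by simp),
    ← ENNReal.ofReal_div_of_pos (Real.exp_pos _), ← Real.exp_sub] at h3
  refine h3.trans (ENNReal.ofReal_le_ofReal (Real.exp_le_exp.2 ?_))
  have h4 : ‖s • c‖ ^ 2 ≤ s ^ 2 * σ ^ 2 := by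
    rw [norm_smul, Real.norm_of_nonneg hs0, mul_pow]; gcongr
  have h5 : s ^ 2 * σ ^ 2 / 2 - s * T = -(T ^ 2 / (2 * σ ^ 2)) := by
    rw [hs]; field_simp; ring
  linarith

lemma stdGaussian_abs_inner_ge_le (c : E) {σ T : ℝ} (hσ : 0 < σ) (hc : ‖c‖ ≤ σ) (hT : 0 ≤ T) :
    stdGaussian E {a | T ≤ |inner ℝ c a|}
      ≤ 2 * ENNReal.ofReal (Real.exp (-(T ^ 2 / (2 * σ ^ 2)))) := by
  have h1 : {a : E | T ≤ |inner ℝ c a|} ⊆ {a | T ≤ inner ℝ c a} ∪ {a | T ≤ inner ℝ (-c) a} := by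
    intro a ha
    rcases le_abs.1 (show T ≤ |inner ℝ c a| from ha) with h | h
    · exact Or.inl h
    · right
      simpa using h
  refine (measure_mono h1).trans ((measure_union_le _ _).trans ?_)
  rw [two_mul]
  exact add_le_add (stdGaussian_inner_ge_le c hσ hc hT)
    (stdGaussian_inner_ge_le (-c) hσ (by rwa [norm_neg]) hT)

end Gaussian

lemma integral_exp_sq_gaussianReal {θ : ℝ} (hθ : θ < 1) :
    ∫ x, Real.exp (θ * x ^ 2 / 2) ∂(gaussianReal 0 1) = (√(1 - θ))⁻¹ := by
  rw [integral_gaussianReal_eq_integral_smul (by norm_num)]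
  have h1 : ∀ x : ℝ, gaussianPDFReal 0 1 x • Real.exp (θ * x ^ 2 / 2)
      = (√(2 * Real.pi))⁻¹ * Real.exp (-((1 - θ) / 2) * x ^ 2) := by
    intro x
    rw [gaussianPDFReal, smul_eq_mul, mul_assoc, ← Real.exp_add]
    simp only [NNReal.coe_one, mul_one, sub_zero]
    congr 2
    ring
  simp only [h1]
  rw [integral_const_mul, integral_gaussian, ← Real.sqrt_inv, ← Real.sqrt_mul (by positivity),
    ← Real.sqrt_inv]
  congr 1
  have : (1 - θ) ≠ 0 := by linarith
  field_simp

lemma integral_exp_norm_sq_stdGaussian {ι : Type*} [Fintype ι] {θ : ℝ} (hθ : θ < 1) :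
    ∫ g, Real.exp (θ * ‖g‖ ^ 2 / 2) ∂(stdGaussian (EuclideanSpace ℝ ι))
      = (√(1 - θ))⁻¹ ^ Fintype.card ι := by
  rw [← map_pi_eq_stdGaussian, integral_map (by fun_prop) (by fun_prop)]
  have h1 : ∀ x : ι → ℝ, Real.exp (θ * ‖WithLp.toLp 2 x‖ ^ 2 / 2)
      = ∏ i, Real.exp (θ * x i ^ 2 / 2) := by
    intro x
    rw [← Real.exp_sum, EuclideanSpace.real_norm_sq_eq, Finset.mul_sum, Finset.sum_div]
  simp only [h1]
  rw [integral_fintype_prod_eq_prod (fun _ x => Real.exp (θ * x ^ 2 / 2))]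
  simp [integral_exp_sq_gaussianReal hθ]

lemma lintegral_exp_norm_sq_stdGaussian {ι : Type*} [Fintype ι] {θ : ℝ} (hθ : θ < 1) :
    ∫⁻ g, ENNReal.ofReal (Real.exp (θ * ‖g‖ ^ 2 / 2)) ∂(stdGaussian (EuclideanSpace ℝ ι))
      = ENNReal.ofReal ((√(1 - θ))⁻¹ ^ Fintype.card ι) := by
  rw [← ofReal_integral_eq_lintegral_ofReal, integral_exp_norm_sq_stdGaussian hθ]
  · refine Integrable.of_integral_ne_zero ?_
    rw [integral_exp_norm_sq_stdGaussian hθ]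
    have : 0 < 1 - θ := by linarith
    positivity
  · exact Eventually.of_forall fun y => (Real.exp_pos _).le

/-- A vector all of whose linear functionals are subgaussian with variance proxy `c` has squared
norm at most `3/2 c n` up to exponentially small probability. -/
lemma measure_norm_sq_ge_le_of_subgaussian {Ω : Type*} [MeasurableSpace Ω] {μ : Measure Ω}
    [SFinite μ] {n : ℕ} {X : Ω → Vec n} (hX : Measurable X) {c : ℝ} (hc : 0 < c)
    (h : ∀ g : Vec n, ∫⁻ ω, ENNReal.ofReal (Real.exp (inner ℝ (X ω) g)) ∂μ
      ≤ ENNReal.ofReal (Real.exp (c * ‖g‖ ^ 2 / 2))) :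
    μ {ω | 3 / 2 * c * n ≤ ‖X ω‖ ^ 2}
      ≤ ENNReal.ofReal (((√(1 - 1 / 4))⁻¹ * Real.exp (-(3 / 16))) ^ n) := by
  set s := √(1 / (4 * c)) with hs
  have hs2 : s ^ 2 = 1 / (4 * c) := Real.sq_sqrt (by positivity)
  -- The exponential of a square is a Gaussian average of exponentials of linear functionals.
  -- Exchanging the integrals brings in the hypothesis, and `s² c = 1 / 4 < 1` keeps the remaining
  -- integral finite.
  have h1 : ∫⁻ ω, ENNReal.ofReal (Real.exp (s ^ 2 * ‖X ω‖ ^ 2 / 2)) ∂μ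
      ≤ ENNReal.ofReal ((√(1 - 1 / 4))⁻¹ ^ n) := by
    have e1 : ∀ ω, ENNReal.ofReal (Real.exp (s ^ 2 * ‖X ω‖ ^ 2 / 2))
        = ∫⁻ g, ENNReal.ofReal (Real.exp (inner ℝ (s • X ω) g)) ∂(stdGaussian (Vec n)) := by
      intro ω
      rw [lintegral_exp_inner_stdGaussian, norm_smul, mul_pow, Real.norm_eq_abs, sq_abs]
    simp only [e1]
    rw [lintegral_lintegral_swap]
    · calc _ ≤ ∫⁻ g, ENNReal.ofReal (Real.exp (1 / 4 * ‖g‖ ^ 2 / 2)) ∂(stdGaussian (Vec n)) := by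
            refine lintegral_mono fun g => ?_
            have e2 : ∀ ω, inner ℝ (s • X ω) g = inner ℝ (X ω) (s • g) := fun ω => by
              rw [inner_smul_left, inner_smul_right]; simp
            simp only [e2]
            refine (h (s • g)).trans (le_of_eq ?_)
            congr 2
            rw [norm_smul, mul_pow, Real.norm_eq_abs, sq_abs, hs2]
            field_simp
        _ = _ := by rw [lintegral_exp_norm_sq_stdGaussian (by norm_num), Fintype.card_fin]
    · have : Measurable fun p : Ω × Vec n => (inner ℝ (s • X p.1) p.2 : ℝ) := by fun_prop
      exact (by fun_prop : Measurable fun p : Ω × Vec n =>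
        ENNReal.ofReal (Real.exp (inner ℝ (s • X p.1) p.2))).aemeasurable
  have h2 := mul_meas_ge_le_lintegral (μ := μ)
    (f := fun ω => ENNReal.ofReal (Real.exp (s ^ 2 * ‖X ω‖ ^ 2 / 2))) (by fun_prop)
    (ENNReal.ofReal (Real.exp (3 / 16 * n)))
  have h3 : {ω | 3 / 2 * c * n ≤ ‖X ω‖ ^ 2} ⊆ {ω | ENNReal.ofReal (Real.exp (3 / 16 * n))
      ≤ ENNReal.ofReal (Real.exp (s ^ 2 * ‖X ω‖ ^ 2 / 2))} := by
    intro ω hω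
    refine ENNReal.ofReal_le_ofReal (Real.exp_le_exp.2 ?_)
    have hω' : 3 / 2 * c * n ≤ ‖X ω‖ ^ 2 := hω
    rw [hs2]
    calc (3 : ℝ) / 16 * n = 1 / (4 * c) * (3 / 2 * c * n) / 2 := by field_simp; ring
      _ ≤ _ := by gcongr
  have h4 : ENNReal.ofReal (Real.exp (3 / 16 * n)) * μ {ω | 3 / 2 * c * n ≤ ‖X ω‖ ^ 2}
      ≤ ENNReal.ofReal ((√(1 - 1 / 4))⁻¹ ^ n) := le_trans (by gcongr) (h2.trans h1)
  rw [mul_comm, ← ENNReal.le_div_iff_mul_le (by simp [Real.exp_pos]) (by simp),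
    ← ENNReal.ofReal_div_of_pos (Real.exp_pos _)] at h4
  refine h4.trans (le_of_eq ?_)
  congr 1
  rw [mul_pow, ← Real.exp_nat_mul, div_eq_mul_inv, ← Real.exp_neg]
  congr 2
  ring

/-- Small ball estimate for a Gaussian vector with covariance at least `6`. -/
lemma stdGaussian_norm_sq_le_le {E : Type*} [NormedAddCommGroup E] [InnerProductSpace ℝ E]
    [FiniteDimensional ℝ E] [MeasurableSpace E] [BorelSpace E] {ι : Type*} [Fintype ι]
    (Ψ : EuclideanSpace ℝ ι →ₗ[ℝ] E) (Y : E → EuclideanSpace ℝ ι) (hY : Measurable Y)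
    (hYΨ : ∀ a R, inner ℝ (Y a) R = inner ℝ a (Ψ R)) (hΨ : ∀ R, 6 * ‖R‖ ^ 2 ≤ ‖Ψ R‖ ^ 2) (m : ℝ) :
    stdGaussian E {a | ‖Y a‖ ^ 2 ≤ m}
      ≤ ENNReal.ofReal (Real.exp (m / 2) * (√(1 - -6))⁻¹ ^ Fintype.card ι) := by
  -- `exp (-‖Y‖² / 2)` is the characteristic function of an auxiliary Gaussian `R` at `Y`.
  -- Exchanging the integrals replaces `‖Y‖` by `‖Ψ R‖`, and `hΨ` leaves the mean of `exp (-3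
  -- ‖R‖²)`, a power of `7^{-1/2}`.
  have h1 : ∫ a, Real.exp (-(‖Y a‖ ^ 2 / 2)) ∂(stdGaussian E) ≤ (√(1 - -6))⁻¹ ^ Fintype.card ι := by
    have hint : Integrable (fun p : E × EuclideanSpace ℝ ι =>
        Complex.exp ((inner ℝ p.2 (Y p.1) : ℝ) * Complex.I))
        ((stdGaussian E).prod (stdGaussian (EuclideanSpace ℝ ι))) := by
      refine Integrable.mono' (integrable_const (1 : ℝ)) ?_ (Eventually.of_forall fun p => ?_)
      · have : Measurable fun p : E × EuclideanSpace ℝ ι => (inner ℝ p.2 (Y p.1) : ℝ) := by fun_prop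
        exact (by fun_prop : Measurable fun p : E × EuclideanSpace ℝ ι =>
          Complex.exp ((inner ℝ p.2 (Y p.1) : ℝ) * Complex.I)).aestronglyMeasurable
      · rw [Complex.norm_exp_ofReal_mul_I]
    have e1 : ∀ a, (Real.exp (-(‖Y a‖ ^ 2 / 2)) : ℂ)
        = ∫ R, Complex.exp ((inner ℝ R (Y a) : ℝ) * Complex.I)
          ∂(stdGaussian (EuclideanSpace ℝ ι)) := by
      intro a
      rw [← charFun_apply, charFun_stdGaussian, Complex.ofReal_exp]
      congr 1
      push_cast
      ring
    have e2 : ∀ R, ∫ a, Complex.exp ((inner ℝ R (Y a) : ℝ) * Complex.I) ∂(stdGaussian E)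
        = (Real.exp (-(‖Ψ R‖ ^ 2 / 2)) : ℂ) := by
      intro R
      have e3 : ∀ a, (inner ℝ R (Y a) : ℝ) = inner ℝ a (Ψ R) := fun a => by
        rw [real_inner_comm, hYΨ]
      simp only [e3]
      rw [← charFun_apply, charFun_stdGaussian, Complex.ofReal_exp]
      congr 1
      push_cast
      ring
    have e4 : ((∫ a, Real.exp (-(‖Y a‖ ^ 2 / 2)) ∂(stdGaussian E) : ℝ) : ℂ)
        = ((∫ R, Real.exp (-(‖Ψ R‖ ^ 2 / 2)) ∂(stdGaussian (EuclideanSpace ℝ ι)) : ℝ) : ℂ) := by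
      rw [← integral_complex_ofReal, ← integral_complex_ofReal]
      simp only [e1]
      rw [integral_integral_swap hint]
      simp only [e2]
    have e5 := Complex.ofReal_injective e4
    rw [e5, ← integral_exp_norm_sq_stdGaussian (θ := -6) (by norm_num)]
    refine integral_mono_of_nonneg (Eventually.of_forall fun R => (Real.exp_pos _).le) ?_
      (Eventually.of_forall fun R => Real.exp_le_exp.2 ?_)
    · refine Integrable.of_integral_ne_zero ?_
      rw [integral_exp_norm_sq_stdGaussian (by norm_num)]
      positivity
    · linarith [hΨ R]
  have h2 := mul_meas_ge_le_lintegral (μ := stdGaussian E)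
    (f := fun a => ENNReal.ofReal (Real.exp (-(‖Y a‖ ^ 2 / 2)))) (by fun_prop)
    (ENNReal.ofReal (Real.exp (-(m / 2))))
  have hint' : Integrable (fun a => Real.exp (-(‖Y a‖ ^ 2 / 2))) (stdGaussian E) := by
    refine Integrable.mono' (integrable_const (1 : ℝ)) (by fun_prop)
      (Eventually.of_forall fun a => ?_)
    rw [Real.norm_of_nonneg (Real.exp_pos _).le]
    exact Real.exp_le_one_iff.2 (by have := sq_nonneg ‖Y a‖; linarith)
  rw [← ofReal_integral_eq_lintegral_ofReal hint'
    (Eventually.of_forall fun a => (Real.exp_pos _).le)] at h2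
  have h3 : {a | ‖Y a‖ ^ 2 ≤ m} ⊆ {a | ENNReal.ofReal (Real.exp (-(m / 2)))
      ≤ ENNReal.ofReal (Real.exp (-(‖Y a‖ ^ 2 / 2)))} := by
    intro a ha
    have ha' : ‖Y a‖ ^ 2 ≤ m := ha
    exact ENNReal.ofReal_le_ofReal (Real.exp_le_exp.2 (by linarith))
  have h4 : ENNReal.ofReal (Real.exp (-(m / 2))) * stdGaussian E {a | ‖Y a‖ ^ 2 ≤ m}
      ≤ ENNReal.ofReal ((√(1 - -6))⁻¹ ^ Fintype.card ι) :=
    le_trans (by gcongr) (h2.trans (ENNReal.ofReal_le_ofReal h1))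
  rw [mul_comm, ← ENNReal.le_div_iff_mul_le (by simp [Real.exp_pos]) (by simp),
    ← ENNReal.ofReal_div_of_pos (Real.exp_pos _)] at h4
  refine h4.trans (le_of_eq ?_)
  congr 1
  rw [Real.exp_neg, div_inv_eq_mul, mul_comm]

end

/-! ### Operator norm of the noise and covariance of its contractions -/

section

variable {n : ℕ}

/-- Third order tensors with the Frobenius inner product. -/
abbrev TensorSpace (n : ℕ) : Type := EuclideanSpace ℝ (Fin n × Fin n × Fin n)

lemma noiseMeasure_eq (P : Tensor n → Prop) :
    noiseMeasure n {A | P A} = stdGaussian (TensorSpace n) {a | P a.ofLp} := by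
  rw [← map_pi_eq_stdGaussian]
  have h := (MeasurableEquiv.toLp 2 (Tensor n)).map_apply (μ := noiseMeasure n) {a | P a.ofLp}
  exact h.symm

/-- The tensor `x ⊗ y ⊗ z`. -/
def rankOne (x y z : Vec n) : TensorSpace n :=
  WithLp.toLp 2 fun p => x p.1 * y p.2.1 * z p.2.2

lemma norm_rankOne (x y z : Vec n) : ‖rankOne x y z‖ = ‖x‖ * ‖y‖ * ‖z‖ := by
  rw [← sq_eq_sq₀ (norm_nonneg _) (by positivity), mul_pow, mul_pow]
  simp only [EuclideanSpace.real_norm_sq_eq, rankOne, Fintype.sum_prod_type, mul_pow,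
    ← Finset.mul_sum, ← Finset.sum_mul]

lemma inner_rankOne (x y z : Vec n) (a : TensorSpace n) :
    inner ℝ (rankOne x y z) a = trilin a.ofLp x y z := by
  simp only [PiLp.inner_apply, rankOne, trilin, Fintype.sum_prod_type, RCLike.inner_apply,
    conj_trivial]
  refine Finset.sum_congr rfl fun i _ => Finset.sum_congr rfl fun j _ =>
    Finset.sum_congr rfl fun k _ => by ring

/-- The tensor representing `A ↦ ⟨contr A x y, z⟩`. -/
def symCoeff (x y z : Vec n) : TensorSpace n :=
  rankOne x y z + rankOne x z y + rankOne y x z + rankOne y z x + rankOne z x y + rankOne z y x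

lemma inner_symCoeff (x y z : Vec n) (a : TensorSpace n) :
    inner ℝ (symCoeff x y z) a = inner ℝ (contr a.ofLp x y) z := by
  simp only [symCoeff, inner_add_left, inner_rankOne]
  rw [inner_contr_eq_trilin]

lemma norm_symCoeff_le (x y z : Vec n) : ‖symCoeff x y z‖ ≤ 6 * (‖x‖ * ‖y‖ * ‖z‖) := by
  have h := norm_add_le (rankOne x y z + rankOne x z y + rankOne y x z + rankOne y z x
    + rankOne z x y) (rankOne z y x)
  have h1 := norm_add_le (rankOne x y z + rankOne x z y + rankOne y x z + rankOne y z x)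
    (rankOne z x y)
  have h2 := norm_add_le (rankOne x y z + rankOne x z y + rankOne y x z) (rankOne y z x)
  have h3 := norm_add_le (rankOne x y z + rankOne x z y) (rankOne y x z)
  have h4 := norm_add_le (rankOne x y z) (rankOne x z y)
  simp only [norm_rankOne] at h h1 h2 h3 h4
  rw [symCoeff]
  linarith

/-- The map `a ↦ contr a` is additive in the tensor. -/
lemma contr_sub_smul (a b : TensorSpace n) (s : ℝ) (x y : Vec n) :
    contr (a - s • b).ofLp x y = contr a.ofLp x y - s • contr b.ofLp x y := by
  refine ext_inner_right ℝ fun z => ?_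
  rw [inner_sub_left, inner_smul_left, ← inner_symCoeff, ← inner_symCoeff, ← inner_symCoeff,
    inner_sub_right, inner_smul_right]
  simp

/-- Measure bound for the operator bound on all contractions. -/
lemma stdGaussian_contr_large_le (n : ℕ) :
    stdGaussian (TensorSpace n) {a | ¬ ∀ x y : Vec n, ‖contr a.ofLp x y‖
      ≤ 192 * √n * ‖x‖ * ‖y‖} ≤ ENNReal.ofReal (2 * (1 / 2) ^ n) := by
  obtain ⟨s, hcard, hs1, hs⟩ := exists_half_net n
  -- Passing from the net to the ball costs a factor `8`, whence `192`. The tail exponent is `T² /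
  -- (2 · 6²) = 8 n`, and `e^{-8n}` beats the `125 ^ n` triples of net points.
  set T : ℝ := 24 * √n with hT
  have hT0 : 0 ≤ T := by positivity
  set S := s ×ˢ s ×ˢ s with hS
  have hsub : {a : TensorSpace n | ¬ ∀ x y : Vec n, ‖contr a.ofLp x y‖ ≤ 192 * √n * ‖x‖ * ‖y‖}
      ⊆ ⋃ p ∈ S, {a | T ≤ |inner ℝ (symCoeff p.1 p.2.1 p.2.2) a|} := by
    intro a ha
    by_contra hcon
    simp only [Set.mem_iUnion, not_exists, Set.mem_ofPred_eq, not_le] at hcon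
    refine ha ?_
    have h1 : ∀ x ∈ s, ∀ y ∈ s, ∀ z ∈ s, |inner ℝ (contr a.ofLp x y) z| ≤ T := by
      intro x hx y hy z hz
      have := hcon (x, y, z) (Finset.mk_mem_product hx (Finset.mk_mem_product hy hz))
      rw [inner_symCoeff] at this
      exact this.le
    have h2 := norm_contr_le_of_unit (A := a.ofLp) (T := 8 * T) (by positivity)
      fun x y z hx hy hz => abs_inner_contr_le_of_half_net hs hT0 h1 hx hy hz
    intro x y
    have := h2 x y
    rw [hT] at this
    linarith
  refine (measure_mono hsub).trans ((measure_biUnion_finset_le _ _).trans ?_)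
  have hterm : ∀ p ∈ S, stdGaussian (TensorSpace n)
      {a | T ≤ |inner ℝ (symCoeff p.1 p.2.1 p.2.2) a|}
      ≤ ENNReal.ofReal (2 * Real.exp (-(8 * n))) := by
    intro p hp
    simp only [hS, Finset.mem_product] at hp
    have hσ : ‖symCoeff p.1 p.2.1 p.2.2‖ ≤ 6 := by
      refine (norm_symCoeff_le _ _ _).trans ?_
      have h1 := hs1 _ hp.1
      have h2 := hs1 _ hp.2.1
      have h3 := hs1 _ hp.2.2
      calc 6 * (‖p.1‖ * ‖p.2.1‖ * ‖p.2.2‖) ≤ 6 * (1 * 1 * 1) := by gcongr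
        _ = 6 := by norm_num
    refine (stdGaussian_abs_inner_ge_le _ (by norm_num) hσ hT0).trans (le_of_eq ?_)
    rw [ENNReal.ofReal_mul (by norm_num)]
    congr 2
    · simp
    · rw [hT, mul_pow, Real.sq_sqrt (by positivity)]
      ring_nf
  refine (Finset.sum_le_sum hterm).trans ?_
  rw [Finset.sum_const, nsmul_eq_mul, ← ENNReal.ofReal_natCast, ← ENNReal.ofReal_mul (by positivity)]
  refine ENNReal.ofReal_le_ofReal ?_
  have hc : (S.card : ℝ) ≤ 125 ^ n := by
    have h1 : S.card ≤ 5 ^ n * (5 ^ n * 5 ^ n) := by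
      rw [hS, Finset.card_product, Finset.card_product]; gcongr
    have h2 : (5 : ℕ) ^ n * (5 ^ n * 5 ^ n) = 125 ^ n := by
      rw [← mul_pow, ← mul_pow]; norm_num
    rw [h2] at h1
    exact_mod_cast h1
  have he : Real.exp (-(8 * n)) ≤ (1 / 250) ^ n := by
    have h1 : (250 : ℝ) ≤ Real.exp 8 := by
      have h2 : (2 : ℝ) ≤ Real.exp 1 := by have := Real.add_one_le_exp 1; linarith
      calc (250 : ℝ) ≤ 2 ^ 8 := by norm_num
        _ ≤ Real.exp 1 ^ 8 := by gcongr
        _ = Real.exp 8 := by rw [← Real.exp_nat_mul]; norm_num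
    rw [show -(8 * (n : ℝ)) = (n : ℝ) * (-8) by ring, Real.exp_nat_mul, Real.exp_neg, one_div]
    gcongr
  calc (S.card : ℝ) * (2 * Real.exp (-(8 * n))) ≤ 125 ^ n * (2 * (1 / 250) ^ n) := by gcongr
    _ = 2 * (1 / 2) ^ n := by
      rw [mul_left_comm, ← mul_pow]; norm_num

/-- The coefficient tensor of `A ↦ ∑ R_p ⟨contr A x e_{p.1}, e_{p.2}⟩`, over pairs `p.1 < p.2`. -/
def pairCoeff (x : Vec n) :
    EuclideanSpace ℝ {p : Fin n × Fin n // p.1 < p.2} →ₗ[ℝ] TensorSpace n where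
  toFun R := ∑ p, R p • symCoeff x (EuclideanSpace.single p.1.1 1) (EuclideanSpace.single p.1.2 1)
  map_add' R R' := by simp [add_smul, Finset.sum_add_distrib]
  map_smul' c R := by simp [Finset.smul_sum, smul_smul]

/-- Each square contributes `‖x‖² ‖T‖²`. By symmetry of `T` each cross term equals `‖T x‖²`, which
is nonnegative and can be dropped. -/
lemma sum_cubic_sq (x : Fin n → ℝ) (T : Fin n → Fin n → ℝ) (hT : ∀ i j, T i j = T j i) :
    3 * ((∑ i, x i ^ 2) * ∑ i, ∑ j, T i j ^ 2)
      ≤ ∑ i, ∑ j, ∑ k, (x i * T j k + x j * T i k + x k * T i j) ^ 2 := by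
  have e1 : ∑ i, ∑ j, ∑ k, (x i * T j k) ^ 2 = (∑ i, x i ^ 2) * ∑ i, ∑ j, T i j ^ 2 := by
    rw [Finset.sum_mul]
    simp only [mul_pow, Finset.mul_sum]
  have e2 : ∑ i, ∑ j, ∑ k, (x j * T i k) ^ 2 = (∑ i, x i ^ 2) * ∑ i, ∑ j, T i j ^ 2 := by
    rw [← e1, Finset.sum_comm]
  have e3 : ∑ i, ∑ j, ∑ k, (x k * T i j) ^ 2 = (∑ i, x i ^ 2) * ∑ i, ∑ j, T i j ^ 2 := by
    rw [mul_comm, Finset.sum_mul]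
    refine Finset.sum_congr rfl fun i _ => ?_
    rw [Finset.sum_mul]
    refine Finset.sum_congr rfl fun j _ => ?_
    rw [Finset.mul_sum]
    exact Finset.sum_congr rfl fun k _ => by ring
  have f1 : ∑ i, ∑ j, ∑ k, (x i * T j k) * (x j * T i k) = ∑ k, (∑ i, x i * T i k) ^ 2 := by
    have : ∀ k, (∑ i, x i * T i k) ^ 2 = ∑ i, ∑ j, (x i * T j k) * (x j * T i k) := by
      intro k
      rw [pow_two, Finset.sum_mul_sum]
      refine Finset.sum_congr rfl fun i _ => Finset.sum_congr rfl fun j _ => by ring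
    simp only [this]
    rw [Finset.sum_comm]
    rw [Finset.sum_congr rfl fun j _ => Finset.sum_comm]
    rw [Finset.sum_comm]
    refine Finset.sum_congr rfl fun k _ => ?_
    rw [Finset.sum_comm]
  have f2 : ∑ i, ∑ j, ∑ k, (x i * T j k) * (x k * T i j) = ∑ k, (∑ i, x i * T i k) ^ 2 := by
    rw [← f1]
    refine Finset.sum_congr rfl fun i _ => ?_
    rw [Finset.sum_comm]
    refine Finset.sum_congr rfl fun j _ => Finset.sum_congr rfl fun k _ => ?_
    rw [hT k j]
  have f3 : ∑ i, ∑ j, ∑ k, (x j * T i k) * (x k * T i j) = ∑ k, (∑ i, x i * T i k) ^ 2 := by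
    have : ∀ k, (∑ i, x i * T i k) ^ 2 = ∑ i, ∑ j, (x i * T k j) * (x j * T k i) := by
      intro k
      rw [pow_two, Finset.sum_mul_sum]
      refine Finset.sum_congr rfl fun i _ => Finset.sum_congr rfl fun j _ => ?_
      rw [hT i k, hT j k]; ring
    simp only [this]
  have h0 : 0 ≤ ∑ k, (∑ i, x i * T i k) ^ 2 := Finset.sum_nonneg fun k _ => sq_nonneg _
  have hexp : ∑ i, ∑ j, ∑ k, (x i * T j k + x j * T i k + x k * T i j) ^ 2
      = ∑ i, ∑ j, ∑ k, (x i * T j k) ^ 2 + ∑ i, ∑ j, ∑ k, (x j * T i k) ^ 2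
        + ∑ i, ∑ j, ∑ k, (x k * T i j) ^ 2 + 2 * ∑ i, ∑ j, ∑ k, (x i * T j k) * (x j * T i k)
        + 2 * ∑ i, ∑ j, ∑ k, (x i * T j k) * (x k * T i j)
        + 2 * ∑ i, ∑ j, ∑ k, (x j * T i k) * (x k * T i j) := by
    simp only [Finset.mul_sum, ← Finset.sum_add_distrib]
    refine Finset.sum_congr rfl fun i _ => Finset.sum_congr rfl fun j _ =>
      Finset.sum_congr rfl fun k _ => by ring
  rw [hexp, e1, e2, e3, f1, f2, f3]
  linarith

/-- The coefficient tensor symmetrizes `x ⊗ (U + Uᵀ)`, where `U` is strictly upper triangular with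
entries `R`. The two triangles are disjoint, so `‖U + Uᵀ‖² = 2 ‖R‖²`, and `sum_cubic_sq` supplies
the factor `3`. -/
lemma six_mul_norm_sq_le_pairCoeff {x : Vec n} (hx : ‖x‖ = 1)
    (R : EuclideanSpace ℝ {p : Fin n × Fin n // p.1 < p.2}) :
    6 * ‖R‖ ^ 2 ≤ ‖pairCoeff x R‖ ^ 2 := by
  set e : Fin n → Vec n := fun i => EuclideanSpace.single i (1 : ℝ) with he
  have hee : ∀ i j, e i j = if j = i then 1 else 0 := fun i j => by
    simp [he]
  set U : Fin n → Fin n → ℝ := fun b c => ∑ p, R p * (e p.1.1 b * e p.1.2 c) with hU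
  have hU1 : ∀ p, U p.1.1 p.1.2 = R p := by
    intro p
    rw [hU]
    simp only [hee]
    rw [Finset.sum_eq_single p]
    · simp
    · intro p' _ hne
      by_cases h1 : p.1.1 = p'.1.1
      · by_cases h2 : p.1.2 = p'.1.2
        · exact absurd (Subtype.ext (Prod.ext h1 h2)).symm hne
        · simp [h2]
      · simp [h1]
    · simp
  have hU2 : ∀ p : {p : Fin n × Fin n // p.1 < p.2}, U p.1.2 p.1.1 = 0 := by
    intro p
    rw [hU]
    refine Finset.sum_eq_zero fun p' _ => ?_
    simp only [hee]
    by_cases h1 : p.1.2 = p'.1.1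
    · by_cases h2 : p.1.1 = p'.1.2
      · have := p.2; have := p'.2; rw [← h1, ← h2] at this
        exact absurd p.2 (not_lt.2 this.le)
      · simp [h2]
    · simp [h1]
  have hpush : ∀ W : Fin n → Fin n → ℝ, ∑ b, ∑ c, W b c * U b c = ∑ p, R p * W p.1.1 p.1.2 := by
    intro W
    have : ∀ b c, W b c * U b c = ∑ p, R p * (W b c * (e p.1.1 b * e p.1.2 c)) := by
      intro b c
      rw [hU, Finset.mul_sum]
      exact Finset.sum_congr rfl fun p _ => by ring
    simp only [this]
    rw [Finset.sum_congr rfl fun b _ => Finset.sum_comm, Finset.sum_comm]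
    refine Finset.sum_congr rfl fun p _ => ?_
    simp [hee]
  have hUU : ∑ b, ∑ c, U b c * U b c = ‖R‖ ^ 2 := by
    rw [hpush, EuclideanSpace.real_norm_sq_eq]
    exact Finset.sum_congr rfl fun p _ => by rw [hU1, pow_two]
  have hUUt : ∑ b, ∑ c, U c b * U b c = 0 := by
    rw [hpush fun b c => U c b]
    exact Finset.sum_eq_zero fun p _ => by rw [hU2, mul_zero]
  set T : Fin n → Fin n → ℝ := fun b c => U b c + U c b with hT
  have hTT : ∑ b, ∑ c, T b c ^ 2 = 2 * ‖R‖ ^ 2 := by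
    have h1 : ∑ b, ∑ c, U c b * U c b = ‖R‖ ^ 2 := by rw [Finset.sum_comm, hUU]
    have h2 : ∑ b, ∑ c, T b c ^ 2 = ∑ b, ∑ c, U b c * U b c + ∑ b, ∑ c, U c b * U c b
        + 2 * ∑ b, ∑ c, U c b * U b c := by
      simp only [Finset.mul_sum, ← Finset.sum_add_distrib]
      refine Finset.sum_congr rfl fun i _ => Finset.sum_congr rfl fun j _ => by
        simp only [hT]; ring
    rw [h2, hUU, h1, hUUt]; ring
  have hentry : ∀ i j k, pairCoeff x R (i, j, k) = x i * T j k + x j * T i k + x k * T i j := by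
    intro i j k
    have h1 : pairCoeff x R (i, j, k) = ∑ p, R p * symCoeff x (e p.1.1) (e p.1.2) (i, j, k) := by
      simp [pairCoeff, he]
    rw [h1]
    simp only [hT, hU, ← Finset.sum_add_distrib, Finset.mul_sum]
    refine Finset.sum_congr rfl fun p _ => ?_
    simp only [symCoeff, rankOne, PiLp.add_apply]
    ring
  have hmain := sum_cubic_sq (fun i => x i) T fun i j => by simp only [hT]; ring
  have hx2 : ∑ i, x i ^ 2 = 1 := by rw [← EuclideanSpace.real_norm_sq_eq, hx, one_pow]
  rw [hx2, one_mul, hTT] at hmain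
  rw [EuclideanSpace.real_norm_sq_eq (pairCoeff x R)]
  simp only [Fintype.sum_prod_type, hentry]
  linarith

lemma card_pairs (n : ℕ) : 2 * Fintype.card {p : Fin n × Fin n // p.1 < p.2} = n * (n - 1) := by
  rw [Fintype.card_subtype]
  have h1 : (Finset.univ.filter fun p : Fin n × Fin n => p.1 < p.2).card
      = (Finset.univ.filter fun p : Fin n × Fin n => p.2 < p.1).card := by
    refine Finset.card_bij (fun p _ => (p.2, p.1)) ?_ ?_ ?_
    · intro p hp; simpa using hp
    · rintro ⟨a, b⟩ _ ⟨c, d⟩ _ h; simp at h; simp [h.1, h.2]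
    · rintro ⟨a, b⟩ h; exact ⟨(b, a), by simpa using h, rfl⟩
  have h2 : (Finset.univ : Finset (Fin n)).offDiag.card = n * n - n := by simp
  have h3 : (Finset.univ : Finset (Fin n)).offDiag
      = (Finset.univ.filter fun p : Fin n × Fin n => p.1 < p.2)
        ∪ (Finset.univ.filter fun p : Fin n × Fin n => p.2 < p.1) := by
    ext ⟨a, b⟩
    simp [lt_or_lt_iff_ne]
  rw [h3, Finset.card_union_of_disjoint, ← h1] at h2
  · rw [Nat.mul_sub_one]; omega
  · rw [Finset.disjoint_filter]
    intro p _ h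
    exact not_lt.2 h.le

end

/-! ### Uniform lower bound on the Frobenius norm -/

section

variable {n : ℕ}

/-- The squared Frobenius norm of the matrix `contr A x`. -/
def energy (A : Tensor n) (x : Vec n) : ℝ := ∑ i, ‖contr A x (EuclideanSpace.single i 1)‖ ^ 2

lemma energy_smul (A : Tensor n) (s : ℝ) (x : Vec n) : energy A (s • x) = s ^ 2 * energy A x := by
  simp only [energy, map_smul, LinearMap.smul_apply, norm_smul, mul_pow, Real.norm_eq_abs, sq_abs,
    Finset.mul_sum]

lemma energy_add_le (A : Tensor n) (x y : Vec n) :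
    energy A (x + y) ≤ 2 * energy A x + 2 * energy A y := by
  simp only [energy, Finset.mul_sum, ← Finset.sum_add_distrib]
  refine Finset.sum_le_sum fun i _ => ?_
  rw [map_add, LinearMap.add_apply]
  have h1 := norm_add_le (contr A x (EuclideanSpace.single i 1)) (contr A y (EuclideanSpace.single i 1))
  have h2 := norm_nonneg (contr A x (EuclideanSpace.single i 1) + contr A y (EuclideanSpace.single i 1))
  nlinarith [sq_nonneg (‖contr A x (EuclideanSpace.single i 1)‖
    - ‖contr A y (EuclideanSpace.single i 1)‖)]

lemma energy_le {A : Tensor n} {B : ℝ} (hA : ∀ x y : Vec n, ‖contr A x y‖ ≤ B * ‖x‖ * ‖y‖)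
    (x : Vec n) : energy A x ≤ n * (B * ‖x‖) ^ 2 := by
  have h : ∀ i ∈ (Finset.univ : Finset (Fin n)),
      ‖contr A x (EuclideanSpace.single i 1)‖ ^ 2 ≤ (B * ‖x‖) ^ 2 := fun i _ => by
    have := hA x (EuclideanSpace.single i 1)
    rw [PiLp.norm_single, norm_one, mul_one] at this
    gcongr
  refine (Finset.sum_le_sum h).trans (le_of_eq ?_)
  simp

/-- Only the entries above the diagonal are kept: they form a Gaussian vector with covariance at
least `6`, to which the small ball estimate applies. -/
lemma stdGaussian_energy_le {x : Vec n} (hx : ‖x‖ = 1) (m : ℝ) :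
    stdGaussian (TensorSpace n) {a | energy a.ofLp x ≤ m}
      ≤ ENNReal.ofReal (Real.exp (m / 2)
        * (√(1 - -6))⁻¹ ^ Fintype.card {p : Fin n × Fin n // p.1 < p.2}) := by
  set Y : TensorSpace n → EuclideanSpace ℝ {p : Fin n × Fin n // p.1 < p.2} := fun a =>
    WithLp.toLp 2 fun p => inner ℝ (symCoeff x (EuclideanSpace.single p.1.1 1)
      (EuclideanSpace.single p.1.2 1)) a with hY
  have hYm : Measurable Y := by
    refine Continuous.measurable ?_
    exact (PiLp.continuous_toLp 2 _).comp (continuous_pi fun p => by fun_prop)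
  refine (measure_mono ?_).trans (stdGaussian_norm_sq_le_le (pairCoeff x) Y hYm ?_
    (six_mul_norm_sq_le_pairCoeff hx) m)
  · intro a ha
    refine le_trans ?_ (show energy a.ofLp x ≤ m from ha)
    have h1 : ∀ i, ‖contr a.ofLp x (EuclideanSpace.single i 1)‖ ^ 2 = ∑ j,
        inner ℝ (symCoeff x (EuclideanSpace.single i 1) (EuclideanSpace.single j 1)) a ^ 2 := by
      intro i
      rw [← sum_inner_single_sq]
      simp only [inner_symCoeff]
    simp only [energy, h1]
    rw [EuclideanSpace.real_norm_sq_eq, ← Fintype.sum_prod_type' (f := fun i j : Fin n =>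
      (inner ℝ (symCoeff x (EuclideanSpace.single i 1) (EuclideanSpace.single j 1)) a : ℝ) ^ 2)]
    simp only [hY]
    rw [← Finset.sum_subtype (Finset.univ.filter fun p : Fin n × Fin n => p.1 < p.2) (by simp)
      (fun p : Fin n × Fin n => (inner ℝ (symCoeff x (EuclideanSpace.single p.1 1)
        (EuclideanSpace.single p.2 1)) a : ℝ) ^ 2)]
    exact Finset.sum_le_sum_of_subset_of_nonneg (Finset.subset_univ _) fun _ _ _ => sq_nonneg _
  · intro a R
    simp only [pairCoeff, LinearMap.coe_mk, AddHom.coe_mk, inner_sum, inner_smul_right,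
      PiLp.inner_apply, hY, RCLike.inner_apply, conj_trivial]
    refine Finset.sum_congr rfl fun p _ => ?_
    congr 1
    exact Finset.sum_congr rfl fun _ _ => mul_comm _ _

/-- With about `n² / 2` pairs and `√7 ≥ e^{3/4}`, the small ball gain is about `3 n² / 8` in the
exponent. It beats `n² / 4` from the level `m = n² / 2` and `22 n` from the net, with room for `-n`
once `n ≥ 192`. -/
lemma exp_bound_pairs (hn : 192 ≤ n) :
    ((5 : ℝ) ^ n) ^ 11 * (Real.exp ((n : ℝ) ^ 2 / 2 / 2)
      * (√(1 - -6))⁻¹ ^ Fintype.card {p : Fin n × Fin n // p.1 < p.2}) ≤ (1 / 2) ^ n := by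
  set N := Fintype.card {p : Fin n × Fin n // p.1 < p.2} with hN
  have hcard : 2 * (N : ℝ) = n * (n - 1) := by
    have h := card_pairs n
    rw [← hN] at h
    have h1 : ((n - 1 : ℕ) : ℝ) = n - 1 := by
      rw [Nat.cast_sub (by omega)]; simp
    rw [← h1]
    exact_mod_cast h
  have he : Real.exp 1 < 2.7182818286 := Real.exp_one_lt_d9
  have he' : 2.7182818283 < Real.exp 1 := Real.exp_one_gt_d9
  have h5 : (5 : ℝ) ≤ Real.exp 2 := by
    have : Real.exp 2 = Real.exp 1 ^ 2 := by rw [← Real.exp_nat_mul]; norm_num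
    rw [this]; nlinarith
  have h7 : Real.exp (3 / 4) ≤ √(1 - -6) := by
    refine Real.le_sqrt_of_sq_le ?_
    have h1 : Real.exp (3 / 4) ^ 4 ≤ 49 := by
      rw [← Real.exp_nat_mul]
      have : Real.exp ((4 : ℕ) * (3 / 4 : ℝ)) = Real.exp 1 ^ 3 := by
        rw [← Real.exp_nat_mul]; norm_num
      rw [this]
      calc Real.exp 1 ^ 3 ≤ 2.7182818286 ^ 3 := by gcongr
        _ ≤ 49 := by norm_num
    nlinarith [sq_nonneg (Real.exp (3 / 4))]
  have h7' : (√(1 - -6))⁻¹ ≤ Real.exp (-(3 / 4)) := by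
    rw [Real.exp_neg]
    exact inv_anti₀ (Real.exp_pos _) h7
  have h2 : Real.exp (-1) ≤ 1 / 2 := by
    rw [Real.exp_neg, one_div]
    exact inv_anti₀ (by norm_num) (by linarith)
  calc ((5 : ℝ) ^ n) ^ 11 * (Real.exp ((n : ℝ) ^ 2 / 2 / 2) * (√(1 - -6))⁻¹ ^ N)
      ≤ (Real.exp 2 ^ n) ^ 11 * (Real.exp ((n : ℝ) ^ 2 / 2 / 2) * Real.exp (-(3 / 4)) ^ N) := by
        gcongr
    _ = Real.exp (22 * n + n ^ 2 / 4 - 3 / 4 * N) := by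
        rw [← Real.exp_nat_mul, ← Real.exp_nat_mul, ← Real.exp_nat_mul, ← Real.exp_add,
          ← Real.exp_add]
        congr 1
        push_cast
        ring
    _ ≤ Real.exp (n * (-1)) := by
        refine Real.exp_le_exp.2 ?_
        have h3 : (192 : ℝ) ≤ n := by exact_mod_cast hn
        nlinarith
    _ = Real.exp (-1) ^ n := by rw [Real.exp_nat_mul]
    _ ≤ (1 / 2) ^ n := by gcongr

/-- With overwhelming probability all contractions are bounded in operator norm by `O(√n)` and all
the matrices `contr A x` have Frobenius norm at least of order `n ‖x‖`. -/
lemma stdGaussian_contr_bad_le (hn : 192 ≤ n) :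
    stdGaussian (TensorSpace n) {a | ¬ ((∀ x y : Vec n, ‖contr a.ofLp x y‖
      ≤ 192 * √n * ‖x‖ * ‖y‖) ∧ ∀ x : Vec n, 1 / 32 * ((n : ℝ) ^ 2 * ‖x‖ ^ 2) ≤ energy a.ofLp x)}
      ≤ ENNReal.ofReal (3 * (1 / 2) ^ n) := by
  -- With mesh `2^{-11}` and operator bound `192 √n`, the difference from a net point has energy
  -- `192² 2^{-22} n² < n² / 100`, negligible against the `n² / 8` available at net points of norm
  -- at least `1 / 2`.
  obtain ⟨s, hcard, hs⟩ := exists_net n 11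
  set S := s.filter fun c => 1 / 2 ≤ ‖c‖ with hS
  set E1 : Set (TensorSpace n) := {a | ¬ ∀ x y : Vec n, ‖contr a.ofLp x y‖
      ≤ 192 * √n * ‖x‖ * ‖y‖} with hE1
  have hsub : {a : TensorSpace n | ¬ ((∀ x y : Vec n, ‖contr a.ofLp x y‖
      ≤ 192 * √n * ‖x‖ * ‖y‖) ∧ ∀ x : Vec n, 1 / 32 * ((n : ℝ) ^ 2 * ‖x‖ ^ 2) ≤ energy a.ofLp x)}
      ⊆ E1 ∪ ⋃ c ∈ S, {a | energy a.ofLp (‖c‖⁻¹ • c) ≤ (n : ℝ) ^ 2 / 2} := by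
    intro a ha
    by_contra hcon
    simp only [hE1, Set.mem_union, Set.mem_iUnion, not_or, not_exists, Set.mem_ofPred_eq, not_le,
      not_not] at hcon
    obtain ⟨hop, hc⟩ := hcon
    refine ha ⟨hop, ?_⟩
    have hunit : ∀ x : Vec n, ‖x‖ = 1 → (n : ℝ) ^ 2 / 32 ≤ energy a.ofLp x := by
      intro x hx
      obtain ⟨c, hcs, hxc⟩ := hs x hx.le
      have hcx : 1 / 2 ≤ ‖c‖ := by
        have := norm_sub_norm_le x c
        rw [hx] at this
        have h1 : ((1 : ℝ) / 2) ^ 11 ≤ 1 / 2 := by norm_num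
        linarith
      have h1 := hc c (Finset.mem_filter.2 ⟨hcs, hcx⟩)
      rw [energy_smul] at h1
      have h2 : (n : ℝ) ^ 2 / 8 ≤ energy a.ofLp c := by
        have h3 : energy a.ofLp c = ‖c‖ ^ 2 * (‖c‖⁻¹ ^ 2 * energy a.ofLp c) := by
          field_simp
        rw [h3]
        have h4 : (1 / 2 : ℝ) ^ 2 ≤ ‖c‖ ^ 2 := by gcongr
        have h5 : (0 : ℝ) ≤ (n : ℝ) ^ 2 / 2 := by positivity
        calc (n : ℝ) ^ 2 / 8 = (1 / 2) ^ 2 * ((n : ℝ) ^ 2 / 2) := by ring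
          _ ≤ _ := mul_le_mul h4 h1.le h5 (by positivity)
      have h3 := energy_add_le a.ofLp x (c - x)
      rw [add_sub_cancel] at h3
      have h4 := energy_le hop (c - x)
      rw [norm_sub_rev] at h4
      have h5 : (n : ℝ) * (192 * √n * ‖x - c‖) ^ 2 ≤ n * (192 * √n * (1 / 2) ^ 11) ^ 2 := by gcongr
      have h6 : (n : ℝ) * (192 * √n * (1 / 2) ^ 11) ^ 2 = n ^ 2 * (192 ^ 2 * (1 / 2) ^ 22) := by
        rw [mul_pow, mul_pow, Real.sq_sqrt (by positivity)]
        ring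
      have h7 : (0 : ℝ) ≤ (n : ℝ) ^ 2 := by positivity
      norm_num at h6
      linarith
    intro x
    rcases eq_or_ne x 0 with rfl | hx0
    · simp [energy]
    · have hxn : 0 < ‖x‖ := norm_pos_iff.2 hx0
      have h1 := hunit (‖x‖⁻¹ • x) (by rw [norm_smul, norm_inv, norm_norm, inv_mul_cancel₀ hxn.ne'])
      rw [energy_smul, inv_pow, ← div_eq_inv_mul, le_div_iff₀ (by positivity)] at h1
      linarith
  have hterm : ∀ c ∈ S, stdGaussian (TensorSpace n)
      {a | energy a.ofLp (‖c‖⁻¹ • c) ≤ (n : ℝ) ^ 2 / 2}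
      ≤ ENNReal.ofReal (Real.exp ((n : ℝ) ^ 2 / 2 / 2)
        * (√(1 - -6))⁻¹ ^ Fintype.card {p : Fin n × Fin n // p.1 < p.2}) := by
    intro c hc
    have hcn : 1 / 2 ≤ ‖c‖ := (Finset.mem_filter.1 hc).2
    refine stdGaussian_energy_le ?_ _
    rw [norm_smul, norm_inv, norm_norm, inv_mul_cancel₀ (by linarith)]
  have hS2 : stdGaussian (TensorSpace n) (⋃ c ∈ S, {a | energy a.ofLp (‖c‖⁻¹ • c) ≤ (n : ℝ) ^ 2 / 2})
      ≤ ENNReal.ofReal ((1 / 2) ^ n) := by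
    refine (measure_biUnion_finset_le _ _).trans ((Finset.sum_le_sum hterm).trans ?_)
    rw [Finset.sum_const, nsmul_eq_mul, ← ENNReal.ofReal_natCast,
      ← ENNReal.ofReal_mul (by positivity)]
    refine ENNReal.ofReal_le_ofReal (le_trans ?_ (exp_bound_pairs hn))
    have : (S.card : ℝ) ≤ ((5 : ℝ) ^ n) ^ 11 := by
      exact_mod_cast (Finset.card_filter_le _ _).trans hcard
    gcongr
  refine (measure_mono hsub).trans ((measure_union_le _ _).trans ?_)
  refine (add_le_add (stdGaussian_contr_large_le n) hS2).trans (le_of_eq ?_)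
  rw [← ENNReal.ofReal_add (by positivity) (by positivity)]
  congr 1
  ring

end

/-! ### The trace vector and the independent traceless part -/

section

variable {n : ℕ}

/-- `traceVec` as a linear map. -/
def traceMap (n : ℕ) : TensorSpace n →ₗ[ℝ] Vec n where
  toFun a := traceVec a.ofLp
  map_add' a b := by
    ext j
    simp only [traceVec, PiLp.add_apply, ← Finset.sum_add_distrib]
    exact Finset.sum_congr rfl fun i _ => by ring
  map_smul' c a := by
    ext j
    simp only [traceVec, PiLp.smul_apply, smul_eq_mul, Finset.mul_sum, RingHom.id_apply]
    exact Finset.sum_congr rfl fun i _ => by ring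

/-- The adjoint of `traceMap`: the symmetrization of `3 w ⊗ I`. -/
def traceCoeff (n : ℕ) : Vec n →ₗ[ℝ] TensorSpace n where
  toFun w := WithLp.toLp 2 fun p => (if p.1 = p.2.1 then w p.2.2 else 0)
    + (if p.1 = p.2.2 then w p.2.1 else 0) + (if p.2.1 = p.2.2 then w p.1 else 0)
  map_add' w w' := by
    ext p
    simp only [PiLp.add_apply]
    split_ifs <;> ring
  map_smul' c w := by
    ext p
    simp only [PiLp.smul_apply, smul_eq_mul, RingHom.id_apply]
    split_ifs <;> ring

lemma traceCoeff_apply (w : Vec n) (i j k : Fin n) :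
    traceCoeff n w (i, j, k) = (if i = j then w k else 0) + (if i = k then w j else 0)
      + (if j = k then w i else 0) := rfl

lemma inner_traceCoeff (w : Vec n) (a : TensorSpace n) :
    inner ℝ (traceCoeff n w) a = inner ℝ w (traceMap n a) := by
  have h1 : ∀ i j k, a (i, j, k) * traceCoeff n w (i, j, k)
      = (if i = j then a (i, j, k) * w k else 0) + (if i = k then a (i, j, k) * w j else 0)
        + (if j = k then a (i, j, k) * w i else 0) := by
    intro i j k
    rw [traceCoeff_apply]
    split_ifs <;> ring
  simp only [PiLp.inner_apply, Fintype.sum_prod_type, RCLike.inner_apply, conj_trivial, h1,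
    Finset.sum_add_distrib]
  have e1 : ∑ i, ∑ j, ∑ k, (if i = j then a (i, j, k) * w k else 0)
      = ∑ i, ∑ k, a (i, i, k) * w k := by
    refine Finset.sum_congr rfl fun i _ => ?_
    rw [Finset.sum_comm]
    simp
  have e2 : ∑ i, ∑ j, ∑ k, (if i = k then a (i, j, k) * w j else 0)
      = ∑ i, ∑ j, a (i, j, i) * w j := by simp
  have e3 : ∑ i, ∑ j, ∑ k, (if j = k then a (i, j, k) * w i else 0)
      = ∑ i, ∑ j, a (i, j, j) * w i := by simp
  rw [e1, e2, e3, Finset.sum_comm]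
  conv_lhs => enter [1, 2]; rw [Finset.sum_comm]
  rw [← Finset.sum_add_distrib, ← Finset.sum_add_distrib]
  refine Finset.sum_congr rfl fun j _ => ?_
  rw [← Finset.sum_add_distrib, ← Finset.sum_add_distrib]
  simp only [traceMap, LinearMap.coe_mk, AddHom.coe_mk, traceVec, Finset.sum_mul]
  exact Finset.sum_congr rfl fun i _ => by ring

/-- Since this composition is a scalar, `traceCoeff` is a multiple of an isometry, `u` is an
isotropic Gaussian of variance `3 n + 6` per coordinate, and `traceless` is a projection. -/
lemma traceMap_traceCoeff (w : Vec n) :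
    traceMap n (traceCoeff n w) = (3 * (n : ℝ) + 6) • w := by
  ext j
  have : traceMap n (traceCoeff n w) j = ∑ i, (traceCoeff n w (i, i, j)
    + traceCoeff n w (i, j, i) + traceCoeff n w (j, i, i)) := rfl
  rw [this]
  have h : ∀ i, traceCoeff n w (i, i, j) + traceCoeff n w (i, j, i) + traceCoeff n w (j, i, i)
      = 3 * w j + 6 * (if i = j then w i else 0) := by
    intro i
    simp only [traceCoeff_apply]
    by_cases h : i = j
    · subst h; simp; ring
    · simp [h, Ne.symm h]; ring
  simp only [h, Finset.sum_add_distrib, ← Finset.mul_sum]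
  simp
  ring

lemma norm_sq_traceCoeff (w : Vec n) :
    ‖traceCoeff n w‖ ^ 2 = (3 * (n : ℝ) + 6) * ‖w‖ ^ 2 := by
  rw [← real_inner_self_eq_norm_sq, inner_traceCoeff, traceMap_traceCoeff, inner_smul_right,
    real_inner_self_eq_norm_sq]

lemma contr_traceCoeff (w x y : Vec n) : contr (traceCoeff n w).ofLp x y
    = (6 : ℝ) • ((inner ℝ x y : ℝ) • w + (inner ℝ w y : ℝ) • x + (inner ℝ w x : ℝ) • y) := by
  ext k
  rw [contr_apply]
  have h : ∀ i j, symEntry (traceCoeff n w).ofLp i j k * x i * y j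
      = 6 * ((if i = j then x i * y j * w k else 0) + (if i = k then x i * (w j * y j) else 0)
        + (if j = k then w i * x i * y j else 0)) := by
    intro i j
    simp only [symEntry, traceCoeff_apply, @eq_comm _ j i, @eq_comm _ k i, @eq_comm _ k j]
    split_ifs <;> ring
  have h2 : ∑ i, ∑ j, (if i = k then x i * (w j * y j) else 0) = x k * ∑ j, w j * y j := by
    rw [Finset.sum_comm, Finset.mul_sum]
    simp
  have h3 : ∑ i, ∑ j, (if j = k then w i * x i * y j else 0) = (∑ i, w i * x i) * y k := by
    simp [Finset.sum_mul]
  simp only [h, ← Finset.mul_sum, Finset.sum_add_distrib, h2, h3]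
  simp only [PiLp.smul_apply, PiLp.add_apply, smul_eq_mul, PiLp.inner_apply, RCLike.inner_apply,
    conj_trivial, Finset.sum_ite_eq, Finset.mem_univ, if_true, Finset.sum_mul]
  congr 1
  congr 1
  · congr 1
    · exact Finset.sum_congr rfl fun i _ => by ring
    · rw [mul_comm, Finset.sum_mul]
      exact Finset.sum_congr rfl fun i _ => by ring
  · exact Finset.sum_congr rfl fun i _ => by ring

/-- The orthogonal projection onto the tensors with zero trace vector. -/
def traceless (n : ℕ) : TensorSpace n →ₗ[ℝ] TensorSpace n :=
  LinearMap.id - (3 * (n : ℝ) + 6)⁻¹ • (traceCoeff n ∘ₗ traceMap n)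

lemma traceless_apply (a : TensorSpace n) :
    traceless n a = a - (3 * (n : ℝ) + 6)⁻¹ • traceCoeff n (traceMap n a) := rfl

lemma traceMap_traceless (a : TensorSpace n) : traceMap n (traceless n a) = 0 := by
  have h : (3 * (n : ℝ) + 6) ≠ 0 := by positivity
  rw [traceless_apply, map_sub, map_smul, traceMap_traceCoeff, smul_smul, inv_mul_cancel₀ h,
    one_smul, sub_self]

lemma inner_traceless (a b : TensorSpace n) :
    inner ℝ a (traceless n b) = inner ℝ (traceless n a) b := by
  have h : (inner ℝ a (traceCoeff n (traceMap n b)) : ℝ) = inner ℝ (traceMap n a) (traceMap n b) := by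
    rw [real_inner_comm, inner_traceCoeff, real_inner_comm]
  simp [traceless_apply, inner_sub_left, inner_sub_right, inner_smul_left, inner_smul_right,
    inner_traceCoeff, h]

lemma norm_traceless_le (a : TensorSpace n) : ‖traceless n a‖ ≤ ‖a‖ := by
  have h1 : ‖traceless n a‖ ^ 2 = inner ℝ a (traceless n a) := by
    rw [← real_inner_self_eq_norm_sq, ← inner_traceless]
    congr 1
    rw [traceless_apply, traceMap_traceless, map_zero, smul_zero, sub_zero]
  have h2 := real_inner_le_norm a (traceless n a)
  rw [← h1] at h2
  nlinarith [norm_nonneg (traceless n a), norm_nonneg a]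

/-- The trace vector of a Gaussian tensor is independent of the traceless part. -/
lemma indepFun_traceMap_traceless (n : ℕ) :
    IndepFun (traceMap n) (traceless n) (stdGaussian (TensorSpace n)) := by
  have hG : HasGaussianLaw (id : TensorSpace n → TensorSpace n) (stdGaussian (TensorSpace n)) :=
    ⟨by rw [Measure.map_id]; infer_instance⟩
  have hXY : HasGaussianLaw (fun a => (traceMap n a, traceless n a))
      (stdGaussian (TensorSpace n)) :=
    hG.map ((LinearMap.toContinuousLinearMap (traceMap n)).prod
      (LinearMap.toContinuousLinearMap (traceless n)))
  refine hXY.indepFun_of_covariance_inner fun x y => ?_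
  have e1 : (fun a => (inner ℝ x (traceMap n a) : ℝ)) = fun a => inner ℝ (traceCoeff n x) a := by
    ext a; rw [inner_traceCoeff]
  have e2 : (fun a => (inner ℝ y (traceless n a) : ℝ)) = fun a => inner ℝ (traceless n y) a := by
    ext a; rw [inner_traceless]
  rw [e1, e2, ← covarianceBilin_apply_eq_cov (IsGaussian.memLp_two_id), covarianceBilin_stdGaussian]
  change (inner ℝ (traceCoeff n x) (traceless n y) : ℝ) = 0
  rw [inner_traceCoeff, traceMap_traceless, inner_zero_right]

/-- The contraction of the traceless part of the noise with `v` and the direction of the trace. -/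
def tracelessContr (v : Vec n) (a : TensorSpace n) : Vec n :=
  contr (traceless n a).ofLp v (‖traceMap n a‖⁻¹ • traceMap n a)

lemma continuous_rankOne {α : Type*} [TopologicalSpace α] {f g h : α → Vec n} (hf : Continuous f)
    (hg : Continuous g) (hh : Continuous h) : Continuous fun a => rankOne (f a) (g a) (h a) :=
  (PiLp.continuous_toLp 2 _).comp (continuous_pi fun p => by fun_prop)

lemma continuous_symCoeff (v g : Vec n) : Continuous fun w => symCoeff v w g := by
  unfold symCoeff
  have h1 := continuous_const (y := v) (X := Vec n)
  have h2 := continuous_const (y := g) (X := Vec n)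
  have h3 := continuous_id (X := Vec n)
  exact ((((( continuous_rankOne h1 h3 h2).add (continuous_rankOne h1 h2 h3)).add
    (continuous_rankOne h3 h1 h2)).add (continuous_rankOne h3 h2 h1)).add
    (continuous_rankOne h2 h1 h3)).add (continuous_rankOne h2 h3 h1)

lemma measurable_traceMap (n : ℕ) : Measurable (traceMap n) :=
  (LinearMap.continuous_of_finiteDimensional _).measurable

lemma measurable_traceless (n : ℕ) : Measurable (traceless n) :=
  (LinearMap.continuous_of_finiteDimensional _).measurable

lemma measurable_pairing (v g : Vec n) : Measurable fun p : Vec n × TensorSpace n =>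
    (inner ℝ (symCoeff v (‖p.1‖⁻¹ • p.1) g) p.2 : ℝ) := by
  have h1 : Measurable fun p : Vec n × TensorSpace n => ‖p.1‖⁻¹ • p.1 := by fun_prop
  exact ((continuous_symCoeff v g).measurable.comp h1).inner measurable_snd

lemma measurable_tracelessContr (v : Vec n) : Measurable (tracelessContr v) := by
  have h : ∀ k, Measurable fun a => tracelessContr v a k := by
    intro k
    have h1 : (fun a => tracelessContr v a k)
        = (fun p : Vec n × TensorSpace n => (inner ℝ (symCoeff v (‖p.1‖⁻¹ • p.1)
          (EuclideanSpace.single k 1)) p.2 : ℝ)) ∘ fun a => (traceMap n a, traceless n a) := by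
      ext a
      simp only [Function.comp_apply, inner_symCoeff, tracelessContr]
      rw [EuclideanSpace.inner_single_right]
      simp
    rw [h1]
    exact (measurable_pairing v _).comp ((measurable_traceMap n).prodMk (measurable_traceless n))
  exact (PiLp.continuous_toLp 2 _).measurable.comp (measurable_pi_lambda _ h)

/-- By independence the direction of `u` can be frozen while integrating over the traceless part.
What remains is a Gaussian linear functional with coefficient of norm at most `6 ‖g‖`. -/
lemma lintegral_exp_tracelessContr_le {v : Vec n} (hv : ‖v‖ = 1) (g : Vec n) :
    ∫⁻ a, ENNReal.ofReal (Real.exp (inner ℝ (tracelessContr v a) g)) ∂(stdGaussian (TensorSpace n))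
      ≤ ENNReal.ofReal (Real.exp (36 * ‖g‖ ^ 2 / 2)) := by
  have hX := measurable_traceMap n
  have hY := measurable_traceless n
  have hind := (indepFun_iff_map_prod_eq_prod_map_map hX.aemeasurable hY.aemeasurable).1
    (indepFun_traceMap_traceless n)
  set Φ : Vec n × TensorSpace n → ENNReal := fun p =>
    ENNReal.ofReal (Real.exp (inner ℝ (symCoeff v (‖p.1‖⁻¹ • p.1) g) p.2)) with hΦ
  have hΦm : Measurable Φ := ((measurable_pairing v g).exp).ennreal_ofReal
  have e1 : ∀ a, ENNReal.ofReal (Real.exp (inner ℝ (tracelessContr v a) g))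
      = Φ (traceMap n a, traceless n a) := by
    intro a
    simp only [hΦ, inner_symCoeff, tracelessContr]
  simp only [e1]
  have : IsProbabilityMeasure ((stdGaussian (TensorSpace n)).map (traceMap n)) :=
    Measure.isProbabilityMeasure_map hX.aemeasurable
  have : IsProbabilityMeasure ((stdGaussian (TensorSpace n)).map (traceless n)) :=
    Measure.isProbabilityMeasure_map hY.aemeasurable
  rw [← lintegral_map hΦm (hX.prodMk hY), hind, lintegral_prod _ hΦm.aemeasurable]
  have h2 : ∀ x, ∫⁻ y, Φ (x, y) ∂((stdGaussian (TensorSpace n)).map (traceless n))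
      ≤ ENNReal.ofReal (Real.exp (36 * ‖g‖ ^ 2 / 2)) := by
    intro x
    have hm : Measurable fun y => Φ (x, y) := hΦm.comp measurable_prodMk_left
    rw [lintegral_map hm hY]
    simp only [hΦ, inner_traceless]
    rw [lintegral_exp_inner_stdGaussian]
    refine ENNReal.ofReal_le_ofReal (Real.exp_le_exp.2 ?_)
    have hx : ‖‖x‖⁻¹ • x‖ ≤ 1 := by
      rw [norm_smul, norm_inv, norm_norm]
      exact inv_mul_le_one
    have h3 : ‖traceless n (symCoeff v (‖x‖⁻¹ • x) g)‖ ≤ 6 * ‖g‖ := by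
      refine (norm_traceless_le _).trans ((norm_symCoeff_le _ _ _).trans ?_)
      rw [hv, one_mul]
      have := mul_le_mul_of_nonneg_right hx (norm_nonneg g)
      linarith
    have h4 : ‖traceless n (symCoeff v (‖x‖⁻¹ • x) g)‖ ^ 2 ≤ (6 * ‖g‖) ^ 2 := by gcongr
    linarith
  refine (lintegral_mono h2).trans ?_
  simp

/-- The base of the exponential tail bound for squared norms of Gaussian vectors. -/
def tailBase : ℝ := (√(1 - 1 / 4))⁻¹ * Real.exp (-(3 / 16))

lemma stdGaussian_trace_bad_le {v : Vec n} (hv : ‖v‖ = 1) :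
    stdGaussian (TensorSpace n) {a | ¬ (‖traceVec a.ofLp‖ ^ 2 ≤ 3 / 2 * (3 * n + 6) * n ∧
      ‖tracelessContr v a‖ ^ 2 ≤ 54 * n)} ≤ ENNReal.ofReal (2 * tailBase ^ n) := by
  have h1 := measure_norm_sq_ge_le_of_subgaussian (μ := stdGaussian (TensorSpace n))
    (measurable_traceMap n) (c := 3 * n + 6) (by positivity) fun g => by
      have e : ∀ a, (inner ℝ (traceMap n a) g : ℝ) = inner ℝ (traceCoeff n g) a := fun a => by
        rw [inner_traceCoeff, real_inner_comm]
      simp only [e]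
      rw [lintegral_exp_inner_stdGaussian, norm_sq_traceCoeff]
  have h2 := measure_norm_sq_ge_le_of_subgaussian (μ := stdGaussian (TensorSpace n))
    (measurable_tracelessContr v) (c := 36) (by norm_num) (lintegral_exp_tracelessContr_le hv)
  refine (measure_mono ?_).trans ((measure_union_le _ _).trans ((add_le_add h1 h2).trans
    (le_of_eq ?_)))
  · intro a ha
    by_contra hcon
    simp only [Set.mem_union, Set.mem_ofPred_eq, not_or, not_le] at hcon
    refine ha ⟨hcon.1.le, ?_⟩
    have := hcon.2
    linarith
  · have : 0 ≤ tailBase := by unfold tailBase; positivity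
    rw [← ENNReal.ofReal_add (by positivity) (by positivity)]
    congr 1
    rw [tailBase]
    ring

/-- The trace part of the noise contracts `v` and `u` to a multiple of `2 ⟨u, v⟩ u + ‖u‖² v`. Its
large component is along `v` and disappears in `perp`; the other is small because `u` is nearly
orthogonal to `v`. -/
lemma norm_perp_contr_trace_le {v : Vec n} (hv : ‖v‖ = 1) (a : TensorSpace n) :
    ‖perp v (contr a.ofLp v (traceVec a.ofLp))‖ ≤ ‖traceVec a.ofLp‖ * ‖tracelessContr v a‖
      + 12 * |inner ℝ (traceVec a.ofLp) v| * ‖traceVec a.ofLp‖ / (3 * n + 6) := by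
  set u := traceVec a.ofLp with hu
  have hu' : traceMap n a = u := rfl
  have h1 : contr (traceless n a).ofLp v u = ‖u‖ • tracelessContr v a := by
    rw [tracelessContr, hu', map_smul, smul_smul]
    rcases eq_or_ne u 0 with h | h
    · rw [h]; simp
    · rw [mul_inv_cancel₀ (norm_ne_zero_iff.2 h), one_smul]
  have h2 : contr a.ofLp v u = ‖u‖ • tracelessContr v a
      + (3 * (n : ℝ) + 6)⁻¹ • contr (traceCoeff n u).ofLp v u := by
    rw [← h1, traceless_apply, contr_sub_smul, hu', sub_add_cancel]
  have h3 : perp v (contr a.ofLp v u) = ‖u‖ • perp v (tracelessContr v a)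
      + ((3 * (n : ℝ) + 6)⁻¹ * (12 * inner ℝ u v)) • perp v u := by
    rw [h2, perp_add, perp_smul, contr_traceCoeff, perp_smul, perp_smul, perp_add, perp_add,
      perp_smul, perp_smul, perp_smul, perp_self hv, smul_zero, add_zero, real_inner_comm,
      ← add_smul, smul_smul, smul_smul]
    congr 2
    ring
  rw [h3]
  refine (norm_add_le _ _).trans ?_
  rw [norm_smul, norm_smul, norm_norm, Real.norm_eq_abs, abs_mul, abs_mul, abs_inv,
    abs_of_pos (by positivity : (0 : ℝ) < 3 * n + 6), abs_of_pos (by norm_num : (0 : ℝ) < 12)]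
  have h4 := norm_perp_le hv (tracelessContr v a)
  have h5 := norm_perp_le hv u
  have h6 : 12 * |inner ℝ u v| * ‖u‖ / (3 * n + 6)
      = (3 * (n : ℝ) + 6)⁻¹ * (12 * |inner ℝ u v|) * ‖u‖ := by ring
  rw [h6]
  gcongr

end

/-! ### Verification of the noise bounds and asymptotics in `n` -/

section

variable {n : ℕ}

lemma NoiseBounds.of_regular {K q l : ℝ} {v : Vec n} {a : TensorSpace n} (hv : ‖v‖ = 1)
    (hn : 192 ≤ n) (hK : 0 < K) (hq : 0 < q) (hq4 : q ^ 4 = n) (hl : 0 ≤ l)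
    (hτ : tau n = q ^ 3 * l) (hsqrt : √n = q ^ 2) (hlog : √(n * Real.log n) ≤ q ^ 2 * l)
    (hKl : 20 * K ^ 2 * l ≤ q ^ 4)
    (hcontr : ∀ x y : Vec n, ‖contr a.ofLp x y‖ ≤ 192 * √n * ‖x‖ * ‖y‖)
    (henergy : ∀ x : Vec n, 1 / 32 * ((n : ℝ) ^ 2 * ‖x‖ ^ 2) ≤ energy a.ofLp x)
    (htrace : TraceRegular K v a.ofLp)
    (hu : ‖traceVec a.ofLp‖ ^ 2 ≤ 3 / 2 * (3 * n + 6) * n)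
    (hZ : ‖tracelessContr v a‖ ^ 2 ≤ 54 * n) : NoiseBounds 192 (1 / 32) K q l v a.ofLp := by
  have habs : |inner ℝ (traceVec a.ofLp) v| ≤ K * (q ^ 2 * l) :=
    htrace.2.2.trans (by gcongr)
  refine ⟨hv, hq4, hτ, ?_, ?_, ?_, ?_, habs, ?_⟩
  · rwa [← hsqrt]
  · intro x
    have := henergy x
    rw [← hq4, ← pow_mul] at this
    exact this
  · rw [hq4]; exact htrace.1
  · rw [hq4]; exact htrace.2.1
  · refine (norm_perp_contr_trace_le hv a).trans ?_
    have hn' : (192 : ℝ) ≤ n := by exact_mod_cast hn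
    rw [← hq4] at hu hZ hn' ⊢
    have hub : ‖traceVec a.ofLp‖ ≤ K * q ^ 4 := by rw [hq4]; exact htrace.2.1
    -- The product has square about `(9/2) · 54 q¹² = 243 q¹²`, and `√243 < 79 / 5`; the remaining
    -- `1 / 5` of the constant `16` is left for the trace part.
    have h1 : ‖traceVec a.ofLp‖ * ‖tracelessContr v a‖ ≤ 79 / 5 * q ^ 6 := by
      refine abs_le_of_sq_le_sq' ?_ (by positivity) |>.2
      calc (‖traceVec a.ofLp‖ * ‖tracelessContr v a‖) ^ 2
          = ‖traceVec a.ofLp‖ ^ 2 * ‖tracelessContr v a‖ ^ 2 := by ring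
        _ ≤ (3 / 2 * (3 * q ^ 4 + 6) * q ^ 4) * (54 * q ^ 4) := by gcongr
        _ = q ^ 8 * (243 * q ^ 4 + 486) := by ring
        _ ≤ q ^ 8 * ((79 / 5) ^ 2 * q ^ 4) := by
          refine mul_le_mul_of_nonneg_left ?_ (by positivity)
          linarith
        _ = (79 / 5 * q ^ 6) ^ 2 := by ring
    have h2 : 12 * |inner ℝ (traceVec a.ofLp) v| * ‖traceVec a.ofLp‖ / (3 * q ^ 4 + 6)
        ≤ 1 / 5 * q ^ 6 := by
      rw [div_le_iff₀ (by positivity)]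
      calc 12 * |inner ℝ (traceVec a.ofLp) v| * ‖traceVec a.ofLp‖
          ≤ 12 * (K * (q ^ 2 * l)) * (K * q ^ 4) := by gcongr
        _ = 3 / 5 * q ^ 6 * (20 * K ^ 2 * l) := by ring
        _ ≤ 3 / 5 * q ^ 6 * q ^ 4 := by gcongr
        _ ≤ 1 / 5 * q ^ 6 * (3 * q ^ 4 + 6) := by
          have : 0 < q ^ 6 := by positivity
          linarith
    linarith

lemma tendsto_rpow_mul_pow {r : ℝ} (hr0 : 0 ≤ r) (hr : r < 1) (s : ℝ) :
    Tendsto (fun n : ℕ => (n : ℝ) ^ s * r ^ n) atTop (𝓝 0) := by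
  refine squeeze_zero' (Eventually.of_forall fun n => by positivity) ?_
    (tendsto_pow_const_mul_const_pow_of_abs_lt_one ⌈s⌉₊ (by rwa [abs_of_nonneg hr0]))
  filter_upwards [eventually_ge_atTop 1] with n hn
  have : (n : ℝ) ^ s ≤ (n : ℝ) ^ ⌈s⌉₊ := by
    rw [← Real.rpow_natCast]
    exact Real.rpow_le_rpow_of_exponent_le (by exact_mod_cast hn) (Nat.le_ceil s)
  gcongr

lemma tailBase_lt_one : tailBase < 1 := by
  have h1 : (4 : ℝ) / 3 < Real.exp (3 / 8) := by
    have := Real.add_one_le_exp (3 / 8 : ℝ)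
    linarith
  have h2 : Real.exp (-(3 / 16)) < √(1 - 1 / 4) := by
    refine Real.lt_sqrt_of_sq_lt ?_
    rw [← Real.exp_nat_mul, show ((2 : ℕ) : ℝ) * -(3 / 16) = -(3 / 8) by norm_num, Real.exp_neg]
    calc (Real.exp (3 / 8))⁻¹ < (4 / 3 : ℝ)⁻¹ := inv_strictAnti₀ (by norm_num) h1
      _ = 1 - 1 / 4 := by norm_num
  have h3 : 0 < √(1 - 1 / 4 : ℝ) := (Real.exp_pos _).trans h2
  rw [tailBase, inv_mul_lt_iff₀ h3, mul_one]
  exact h2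

lemma eventually_failure_le {γ γ' : ℝ} (hγ : γ' < γ) :
    ∀ᶠ n : ℕ in atTop, (n : ℝ) ^ (-γ) + (3 * (1 / 2) ^ n + 2 * tailBase ^ n) ≤ (n : ℝ) ^ (-γ') := by
  have h1 := tendsto_rpow_mul_pow (r := 1 / 2) (by norm_num) (by norm_num) γ'
  have h2 := tendsto_rpow_mul_pow (r := tailBase) (by unfold tailBase; positivity)
    tailBase_lt_one γ'
  have h3 : Tendsto (fun n : ℕ => (n : ℝ) ^ (-(γ - γ'))) atTop (𝓝 0) :=
    (tendsto_rpow_neg_atTop (sub_pos.2 hγ)).comp tendsto_natCast_atTop_atTop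
  have h4 := (h3.add ((h1.const_mul 3).add (h2.const_mul 2)))
  simp only [mul_zero, add_zero] at h4
  filter_upwards [h4.eventually (gt_mem_nhds one_pos), eventually_ge_atTop 1] with n hn hn1
  have hn0 : (0 : ℝ) < n := by exact_mod_cast hn1
  have h5 : (n : ℝ) ^ (-γ') * (n : ℝ) ^ γ' = 1 := by
    rw [← Real.rpow_add hn0, neg_add_cancel, Real.rpow_zero]
  have h6 : (n : ℝ) ^ (-γ') * (n : ℝ) ^ (-(γ - γ')) = (n : ℝ) ^ (-γ) := by
    rw [← Real.rpow_add hn0]; congr 1; ring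
  have h7 : (0 : ℝ) < (n : ℝ) ^ (-γ') := by positivity
  calc (n : ℝ) ^ (-γ) + (3 * (1 / 2) ^ n + 2 * tailBase ^ n)
      = (n : ℝ) ^ (-γ') * (n : ℝ) ^ (-(γ - γ')) + ((n : ℝ) ^ (-γ') * (n : ℝ) ^ γ')
        * (3 * (1 / 2) ^ n + 2 * tailBase ^ n) := by rw [h5, h6, one_mul]
    _ = (n : ℝ) ^ (-γ') * ((n : ℝ) ^ (-(γ - γ')) + (3 * ((n : ℝ) ^ γ' * (1 / 2) ^ n)
        + 2 * ((n : ℝ) ^ γ' * tailBase ^ n))) := by ring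
    _ ≤ (n : ℝ) ^ (-γ') * 1 := by gcongr
    _ = _ := mul_one _

lemma eventually_mul_log_lt (B : ℝ) :
    ∀ᶠ n : ℕ in atTop, B * Real.log n < (n : ℝ) ^ (1 / 4 : ℝ) := by
  have h := ((isLittleO_log_rpow_atTop (r := 1 / 4) (by norm_num)).tendsto_div_nhds_zero).comp
    tendsto_natCast_atTop_atTop
  have h2 := h.const_mul B
  rw [mul_zero] at h2
  filter_upwards [h2.eventually (gt_mem_nhds one_pos), eventually_ge_atTop 1] with n hn hn1
  have hn0 : (0 : ℝ) < n := by exact_mod_cast hn1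
  have h3 : (0 : ℝ) < (n : ℝ) ^ (1 / 4 : ℝ) := by positivity
  simp only [Function.comp_apply] at hn
  rwa [← mul_div_assoc, div_lt_one h3] at hn

/-- For `K ≤ 0` the lower bound on `‖u‖` fails surely, so the exceptional event has probability one,
more than `n^{-γ}`. -/
lemma StrongIndependenceConjecture.pos {K γ : ℝ} {κ : ℕ → ℝ} (hγ : 0 < γ)
    (h : StrongIndependenceConjecture K γ κ) : 0 < K := by
  obtain ⟨n, hn, hn2⟩ := (h.and (eventually_ge_atTop 2)).exists
  have : NeZero n := ⟨by omega⟩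
  have hn0 : (1 : ℝ) < n := by exact_mod_cast hn2
  have h1 := hn (EuclideanSpace.single 0 1) (by simp)
  have hprob : IsProbabilityMeasure (noiseMeasure n) := by unfold noiseMeasure; infer_instance
  by_contra hK
  have h2 : ∀ A : Tensor n, ¬ TraceRegular K (EuclideanSpace.single 0 1) A := by
    intro A hA
    have h3 := hA.1
    have h4 := mul_nonneg (neg_nonneg.2 (not_lt.1 hK)) (norm_nonneg (traceVec A))
    linarith
  simp only [h2, false_and, not_false_eq_true, Set.ofPred_true, measure_univ] at h1
  have h3 : (n : ℝ) ^ (-γ) < 1 := Real.rpow_lt_one_of_one_lt_of_neg hn0 (by linarith)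
  have h4 : ENNReal.ofReal ((n : ℝ) ^ (-γ)) < 1 := by
    rwa [ENNReal.ofReal_lt_one]
  exact absurd h1 (not_le.2 h4)

end

end TensorPCA

end

/-! ### The theorem on the intersection of the good events -/

theorem theorem4 (K γ γ' : ℝ) (hγ' : 0 < γ') (hγ : γ' < γ) (κ : ℕ → ℝ)
    (hκ : ∀ᶠ n : ℕ in atTop, κ n ≤ (n : ℝ) ^ (1 / 4 : ℝ))
    (hSIC : TensorPCA.StrongIndependenceConjecture K γ κ) :
    ∃ C M : ℝ, 0 < C ∧ 0 < M ∧ ∃ ε : ℕ → ℝ, Tendsto ε atTop (𝓝 0) ∧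
      ∀ᶠ n : ℕ in atTop, ∀ v : TensorPCA.Vec n, ‖v‖ = 1 →
        TensorPCA.noiseMeasure n {A | ¬ (
          -- large smoothing: a local maximizer close to the one at infinity
          (∀ t : ℝ, C / n ≤ t → ∃ x : TensorPCA.Vec n, IsLocalMax (TensorPCA.gr v A t) x ∧
            ‖x - TensorPCA.xDagger v A‖ ≤ ε n * ‖TensorPCA.xDagger v A‖) ∧
          -- small smoothing: every local maximizer is good or bad
          (∀ t : ℝ, 0 ≤ t → t < 1 / (n * Real.log n ^ 2) →
            ∀ x : TensorPCA.Vec n, IsLocalMax (TensorPCA.gr v A t) x →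
              TensorPCA.IsGood M v x ∨
              (TensorPCA.HasBadNorm M x ∧
                inner ℝ v x ≤ TensorPCA.badCorr n M ∧
                (TensorPCA.NoiseRegularAt K (κ n) v A x →
                  |inner ℝ v x| ≤ TensorPCA.badCorr n M))) ∧
          -- small smoothing: the top Hessian eigenvector is close to the signal
          (∀ t : ℝ, 0 ≤ t → t < 1 / (n * Real.log n ^ 2) →
            ∀ b : TensorPCA.Vec n,
              TensorPCA.IsTopEigenvector
                (TensorPCA.hessian (TensorPCA.gr v A t) (TensorPCA.xDagger v A)) b →
              Real.sin (InnerProductGeometry.angle b v) ≤ 1 / Real.log n ^ 2))}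
          ≤ ENNReal.ofReal ((n : ℝ) ^ (-γ')) := by
  have hK : 0 < K := hSIC.pos (hγ'.trans hγ)
  refine ⟨4, TensorPCA.smallSmoothingConst 192 (1 / 32) K, by norm_num, ?_,
    fun n => 18 * K * (Real.log n / (n : ℝ) ^ (1 / 4 : ℝ)) + 18 * K * (K + 1) * (1 / Real.log n),
    ?_, ?_⟩
  · unfold TensorPCA.smallSmoothingConst
    positivity
  · have hlog : Tendsto (fun n : ℕ => Real.log n) atTop atTop :=
      Real.tendsto_log_atTop.comp tendsto_natCast_atTop_atTop
    have h1 : Tendsto (fun n : ℕ => Real.log n / (n : ℝ) ^ (1 / 4 : ℝ)) atTop (𝓝 0) :=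
      ((isLittleO_log_rpow_atTop (r := 1 / 4) (by norm_num)).tendsto_div_nhds_zero).comp
        tendsto_natCast_atTop_atTop
    have h2 : Tendsto (fun n : ℕ => 1 / Real.log n) atTop (𝓝 0) := by
      simp only [one_div]
      exact tendsto_inv_atTop_zero.comp hlog
    have h3 := (h1.const_mul (18 * K)).add (h2.const_mul (18 * K * (K + 1)))
    simpa only [mul_zero, add_zero] using h3
  · set B := TensorPCA.smallSmoothingThreshold 192 (1 / 32) K with hB
    set B' := TensorPCA.eigenvectorThreshold 192 K with hB'
    set B'' := TensorPCA.largeSmoothingThreshold 192 K with hB''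
    have hlog : Tendsto (fun n : ℕ => Real.log n) atTop atTop :=
      Real.tendsto_log_atTop.comp tendsto_natCast_atTop_atTop
    filter_upwards [hκ, hSIC, TensorPCA.eventually_failure_le hγ, eventually_ge_atTop 192,
      hlog.eventually_gt_atTop B, hlog.eventually_gt_atTop B', hlog.eventually_gt_atTop B'',
      hlog.eventually_gt_atTop 1, TensorPCA.eventually_mul_log_lt B,
      TensorPCA.eventually_mul_log_lt B', TensorPCA.eventually_mul_log_lt B'',
      TensorPCA.eventually_mul_log_lt (20 * K ^ 2)]
      with n hκn hS hfail hn hlB hlB' hlB'' hl1 hqB hqB' hqB'' hqK v hv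
    set l := Real.log n with hl
    set q := (n : ℝ) ^ (1 / 4 : ℝ) with hq
    have hn' : (192 : ℝ) ≤ n := by exact_mod_cast hn
    have hn0 : (0 : ℝ) < n := by linarith
    have hq1 : 1 ≤ q := Real.one_le_rpow (by linarith) (by norm_num)
    have hq0 : 0 < q := by linarith
    have hl0 : 0 < l := by linarith
    have hqpow : ∀ k : ℕ, q ^ k = (n : ℝ) ^ ((k : ℝ) / 4) := by
      intro k
      rw [hq, ← Real.rpow_natCast, ← Real.rpow_mul hn0.le]
      congr 1
      ring
    have hq4 : q ^ 4 = n := by rw [hqpow]; norm_num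
    have hsqrt : √n = q ^ 2 := by rw [hqpow, Real.sqrt_eq_rpow]; norm_num
    have hτ : TensorPCA.tau n = q ^ 3 * l := by rw [hqpow, TensorPCA.tau]; norm_num [hl]
    have hinv1 : (n : ℝ) ^ (-(1 / 4) : ℝ) = 1 / q := by rw [Real.rpow_neg hn0.le, ← one_div]
    have hinv2 : (n : ℝ) ^ (-(1 / 2) : ℝ) = 1 / q ^ 2 := by
      rw [Real.rpow_neg hn0.le, ← hsqrt, Real.sqrt_eq_rpow, ← one_div]
    have hsl : √(n * Real.log n) ≤ q ^ 2 * l := by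
      rw [Real.sqrt_mul hn0.le, hsqrt]
      refine mul_le_mul_of_nonneg_left ?_ (by positivity)
      rw [← hl]
      exact Real.sqrt_le_iff.2 ⟨hl0.le, by nlinarith⟩
    have hKl : 20 * K ^ 2 * l ≤ q ^ 4 :=
      hqK.le.trans (le_self_pow₀ hq1 (by norm_num))
    refine le_trans ?_ (ENNReal.ofReal_le_ofReal hfail)
    have hρ : 0 ≤ TensorPCA.tailBase := by unfold TensorPCA.tailBase; positivity
    rw [ENNReal.ofReal_add (by positivity) (by positivity),
      ENNReal.ofReal_add (by positivity) (by positivity)]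
    have m1 := hS v hv
    have m2 := TensorPCA.stdGaussian_contr_bad_le hn
    have m3 := TensorPCA.stdGaussian_trace_bad_le (n := n) hv
    have e2 := TensorPCA.noiseMeasure_eq (n := n) fun A => ¬ ((∀ x y : TensorPCA.Vec n,
      ‖TensorPCA.contr A x y‖ ≤ 192 * √n * ‖x‖ * ‖y‖) ∧
      ∀ x : TensorPCA.Vec n, 1 / 32 * ((n : ℝ) ^ 2 * ‖x‖ ^ 2) ≤ TensorPCA.energy A x)
    have e3 := TensorPCA.noiseMeasure_eq (n := n) fun A => ¬ (
      ‖TensorPCA.traceVec A‖ ^ 2 ≤ 3 / 2 * (3 * n + 6) * n ∧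
      ‖TensorPCA.tracelessContr v (WithLp.toLp 2 A)‖ ^ 2 ≤ 54 * n)
    rw [← e2] at m2
    rw [← e3] at m3
    -- Union bound: the claims can fail only if the conjectured event, the contraction bounds or the
    -- trace bounds fail.
    refine (measure_mono ?_).trans ((measure_union_le _ _).trans (add_le_add m1
      ((measure_union_le _ _).trans (add_le_add m2 m3))))
    intro A hA
    by_contra hcon
    simp only [Set.mem_union, Set.mem_ofPred_eq, not_or, not_not] at hcon
    obtain ⟨⟨htr, hreg⟩, ⟨hop, hen⟩, hu, hZ⟩ := hcon
    -- The condition `κ n ≤ n^{1/4} = q` enters here; the landscape analysis needs the noise along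
    -- `v` only at level `K q`.
    have hδ : ∀ x, TensorPCA.NoiseRegularAt K (κ n) v A x →
        |inner ℝ (TensorPCA.delta A x) v| ≤ K * q * ‖x‖ ^ 2 := fun x hx =>
      hx.2.2.trans (by gcongr)
    have hNB : TensorPCA.NoiseBounds 192 (1 / 32) K q l v A :=
      TensorPCA.NoiseBounds.of_regular (a := WithLp.toLp 2 A) hv hn hK hq0 hq4 hl0.le hτ hsqrt hsl
        hKl hop hen htr hu hZ
    refine hA ⟨fun t ht => ?_, fun t ht0 ht x hx => ?_, fun t _ _ b hb => ?_⟩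
    · exact hNB.exists_isLocalMax (by norm_num) hK hlB'' hqB''
        (fun t₀ y hy s hs => hδ _ (hreg t₀ y hy s hs)) ht
    · have ht2 : t ^ 2 * (q ^ 8 * l ^ 4) ≤ 1 := by
        have h1 : t * (n * l ^ 2) ≤ 1 := by
          rw [lt_div_iff₀ (by positivity)] at ht
          exact ht.le
        have h2 : t ^ 2 * (q ^ 8 * l ^ 4) = (t * (n * l ^ 2)) ^ 2 := by rw [← hq4]; ring
        rw [h2]
        exact pow_le_one₀ (by positivity) h1
      have h3 : (n : ℝ) ^ (-(1 / 4) : ℝ) / l = 1 / (q * l) := by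
        rw [hinv1, div_div]
      have h4 : (n : ℝ) ^ (-(1 / 2) : ℝ) / l = 1 / (q ^ 2 * l) := by
        rw [hinv2, div_div]
      simp only [TensorPCA.HasBadNorm, TensorPCA.badCorr]
      rw [h3, h4]
      rcases hNB.good_or_bad (by norm_num) hK (by norm_num) hlB hqB ht2
        ((TensorPCA.isLocalMax_gr_iff hv A t x).1 hx) with h | ⟨h5, h6, h7, h8⟩
      · exact Or.inl h
      · exact Or.inr ⟨⟨h5, h6⟩, h7, fun hr => h8 (hδ x hr)⟩
    · rw [TensorPCA.hessian_gr hv] at hb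
      exact hNB.sin_angle_le (by norm_num) hK hlB' hqB' hb
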